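/- Let $\mathcal O_0$ be the principal block of the BGG category $\mathcal O$ of $\mathfrak{sl}_2(\mathbf C)$, that is, the full subcategory of those modules in $\mathcal O$ all of whose composition factors are $L(0)$ or $L(-2)$, where $L(c)$ denotes the simple module of highest weight $c$. Let $P(e)$ and $P(s)$ be the indecomposable projective objects of $\mathcal O_0$ with simple quotients $L(0)$ and $L(-2)$, and let $a\colon P(e)\to P(s)$ and $b\colon P(s)\to P(e)$ be arbitrary non-zero morphisms (such objects and morphisms exist); write $ab\colon P(s)\to P(s)$ for "first $b$, then $a$". Let $T_0^{-1}\colon\mathcal O_0\to\mathcal O_{-1}$ and $T_{-1}^0\colon\mathcal O_{-1}\to\mathcal O_0$ be the translation functors onto and out of the wall, which send $M$ to the direct summand of $M\otimes L(1)$ lying in the target block; they are adjoint to each other on both sides. Let $\Theta_s=T_{-1}^0T_0^{-1}$, let $\eta_s\colon\mathrm{id}\Rightarrow\Theta_s$ be the unit of $T_0^{-1}\dashv T_{-1}^0$ and $\varepsilon_s\colon\Theta_s\Rightarrow\mathrm{id}$ the counit of $T_{-1}^0\dashv T_0^{-1}$ (for any choice of these adjunctions), and let $\mathrm{Sh}_s=\operatorname{coker}\eta_s$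 and $\mathrm{Csh}_s=\ker\varepsilon_s$ be the shuffling and the coshuffling functor. Then the left derived functor $\mathbf L\mathrm{Sh}_s$ and the right derived functor $\mathbf R\mathrm{Csh}_s$ exist on the bounded derived category $D^{\mathrm b}(\mathcal O_0)$, and there is an action, that is, a group homomorphism $$B_{S_2}\longrightarrow\operatorname{Aut}\bigl(D^{\mathrm b}(\mathcal O_0)\bigr),\qquad s\longmapsto\mathbf L\mathrm{Sh}_s,\quad s^{-1}\longmapsto\mathbf R\mathrm{Csh}_s,$$ of the Artin braid group $B_{S_2}=\langle s\rangle$ of the Weyl group $S_2$, which is infinite cyclic, into the group of isomorphism classes of autoequivalences of $D^{\mathrm b}(\mathcal O_0)$. One has $b\circ a=0$, and for every $n\in\mathbf Z$ the element $s^n$ acts on the indecomposable projectives, up to isomorphism in $D^{\mathrm b}(\mathcal O_0)$, by $P(s)\mapsto P(s)$ and $$P(e)\longmapsto\begin{cases}\bigl\{P(e)\xrightarrow{a}P(s)\xrightarrow{ab}P(s)\xrightarrow{ab}\cdots\xrightarrow{ab}P(s)\bigr\}&\text{if }n\ge 0,\\[2pt]\bigl\{P(s)\xrightarrow{ab}P(s)\xrightarrow{ab}\cdots\xrightarrow{ab}P(s)\xrightarrow{b}P(e)\bigr\}&\text{if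 }n\le 0.\end{cases}$$ In the first complex there are $n$ copies of $P(s)$ and, in cohomological grading, $P(e)$ is in degree $-n$ and the last $P(s)$ is in degree $0$; in the second complex there are $-n$ copies of $P(s)$, the first of them in degree $0$, and $P(e)$ is in degree $-n$. For $n=0$ both complexes are $P(e)$ in degree $0$. -/

import Mathlib

open CategoryTheory Limits

noncomputable section

namespace SL2

attribute [local instance 100] LieRing.ofAssociativeRing

/-- The Lie algebra `𝔰𝔩₂(ℂ)`. -/
abbrev 𝔤 : Type := LieAlgebra.SpecialLinear.sl (Fin 2) ℂ

/-- The universal enveloping algebra `U(𝔰𝔩₂)`. -/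
abbrev U : Type := UniversalEnvelopingAlgebra ℂ 𝔤

/-- The raising matrix, spanning `𝔫⁺`. -/
def E₀ : 𝔤 := LieAlgebra.SpecialLinear.single 0 1 (by decide) 1

/-- The lowering matrix, spanning `𝔫⁻`. -/
def F₀ : 𝔤 := LieAlgebra.SpecialLinear.single 1 0 (by decide) 1

/-- The coroot `diag(1, -1)`, spanning the Cartan subalgebra `𝔥`. -/
def H₀ : 𝔤 := LieAlgebra.SpecialLinear.singleSubSingle 0 1 1

/-- The image of the raising matrix in `U(𝔰𝔩₂)`. -/
def E : U := UniversalEnvelopingAlgebra.ι ℂ E₀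

/-- The image of the lowering matrix in `U(𝔰𝔩₂)`. -/
def F : U := UniversalEnvelopingAlgebra.ι ℂ F₀

/-- The image of the coroot in `U(𝔰𝔩₂)`. -/
def H : U := UniversalEnvelopingAlgebra.ι ℂ H₀

theorem lie_H₀_E₀ : ⁅H₀, E₀⁆ = (2 : ℂ) • E₀ := by
  ext i j
  fin_cases i <;> fin_cases j <;>
    simp [H₀, E₀, LieRing.of_associative_ring_bracket, Matrix.mul_apply, Matrix.single]
  norm_num

theorem lie_H₀_F₀ : ⁅H₀, F₀⁆ = (-2 : ℂ) • F₀ := by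
  ext i j
  fin_cases i <;> fin_cases j <;>
    simp [H₀, F₀, LieRing.of_associative_ring_bracket, Matrix.mul_apply, Matrix.single]
  norm_num

theorem lie_E₀_F₀ : ⁅E₀, F₀⁆ = H₀ := by
  ext i j
  fin_cases i <;> fin_cases j <;>
    simp [H₀, E₀, F₀, LieRing.of_associative_ring_bracket, Matrix.mul_apply, Matrix.single]

theorem HE : H * E = E * H + (2 : ℂ) • E := by
  have h := (UniversalEnvelopingAlgebra.ι ℂ (L := 𝔤)).map_lie H₀ E₀
  rw [lie_H₀_E₀, map_smul, LieRing.of_associative_ring_bracket] at h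
  change (2 : ℂ) • E = H * E - E * H at h
  rw [h]; abel

theorem HF : H * F = F * H + (-2 : ℂ) • F := by
  have h := (UniversalEnvelopingAlgebra.ι ℂ (L := 𝔤)).map_lie H₀ F₀
  rw [lie_H₀_F₀, map_smul, LieRing.of_associative_ring_bracket] at h
  change (-2 : ℂ) • F = H * F - F * H at h
  rw [h]; abel

theorem EF : E * F = F * E + H := by
  have h := (UniversalEnvelopingAlgebra.ι ℂ (L := 𝔤)).map_lie E₀ F₀
  rw [lie_E₀_F₀, LieRing.of_associative_ring_bracket] at h
  change H = E * F - F * E at h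
  rw [h]; abel

theorem decomp (x : 𝔤) : x = (x.1 0 1) • E₀ + (x.1 1 0) • F₀ + (x.1 0 0) • H₀ := by
  have hx : x.1 0 0 + x.1 1 1 = 0 := by
    have := x.2
    change Matrix.trace x.1 = 0 at this
    simpa [Matrix.trace] using this
  ext i j
  fin_cases i <;> fin_cases j <;> simp [H₀, E₀, F₀, Matrix.single]
  linear_combination hx

theorem ι_decomp (x : 𝔤) : UniversalEnvelopingAlgebra.ι ℂ x =
    (x.1 0 1) • E + (x.1 1 0) • F + (x.1 0 0) • H := by
  conv_lhs => rw [decomp x]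
  simp only [map_add, map_smul, E, F, H]

theorem adjoin_eq_top (S : Subalgebra ℂ U) (hE : E ∈ S) (hF : F ∈ S) (hH : H ∈ S) : S = ⊤ := by
  have hι : ∀ x : 𝔤, UniversalEnvelopingAlgebra.ι ℂ x ∈ S := fun x => by
    rw [ι_decomp]
    exact S.add_mem (S.add_mem (S.smul_mem hE _) (S.smul_mem hF _)) (S.smul_mem hH _)
  let g : 𝔤 →ₗ⁅ℂ⁆ S :=
    { toFun := fun x => ⟨UniversalEnvelopingAlgebra.ι ℂ x, hι x⟩
      map_add' := fun x y => Subtype.ext (by simp)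
      map_smul' := fun c x => Subtype.ext (by simp)
      map_lie' := fun {x y} => Subtype.ext (by
        simp [LieRing.of_associative_ring_bracket]) }
  have key : S.val.comp (UniversalEnvelopingAlgebra.lift ℂ g) = AlgHom.id ℂ U := by
    apply UniversalEnvelopingAlgebra.hom_ext
    ext x
    simp only [LieHom.comp_apply, AlgHom.coe_toLieHom, AlgHom.comp_apply,
      UniversalEnvelopingAlgebra.lift_ι_apply]
    rfl
  refine Algebra.eq_top_iff.2 fun u => ?_
  have := DFunLike.congr_fun key u
  simp only [AlgHom.comp_apply, AlgHom.id_apply] at this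
  rw [← this]
  exact (UniversalEnvelopingAlgebra.lift ℂ g u).2

theorem EF_smul {M : Type*} [AddCommGroup M] [Module U M] (m : M) :
    E • F • m = F • E • m + H • m := by
  rw [← mul_smul, EF, add_smul, mul_smul]

theorem finite_of_nil {M : Type*} [AddCommGroup M] [Module ℂ M] [Module U M] (m : M) (h : ∃ k : ℕ, E ^ k • m = 0) :
    FiniteDimensional ℂ (Submodule.span ℂ (Set.range fun k : ℕ => E ^ k • m)) := by
  obtain ⟨k, hk⟩ := h
  have hfin : FiniteDimensional ℂ
      (Submodule.span ℂ (insert 0 ((fun k : ℕ => E ^ k • m) '' (Set.Iio k)))) :=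
    FiniteDimensional.span_of_finite ℂ (((Set.finite_Iio k).image _).insert 0)
  refine Submodule.finiteDimensional_of_le (Submodule.span_mono ?_)
    (S₂ := Submodule.span ℂ (insert 0 ((fun k : ℕ => E ^ k • m) '' (Set.Iio k))))
  rintro _ ⟨l, rfl⟩
  rcases lt_or_ge l k with hl | hl
  · exact Or.inr ⟨l, hl, rfl⟩
  · left
    obtain ⟨d, rfl⟩ := Nat.exists_eq_add_of_le' hl
    change E ^ (d + k) • m = 0
    rw [pow_add, mul_smul, hk, smul_zero]

section Modules

variable {M : Type*} [AddCommGroup M] [Module ℂ M] [Module U M] [IsScalarTower ℂ U M]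
variable {N : Type*} [AddCommGroup N] [Module ℂ N] [Module U N] [IsScalarTower ℂ U N]

theorem HE_smul (m : M) : H • E • m = E • H • m + (2 : ℂ) • E • m := by
  rw [← mul_smul, HE, add_smul, mul_smul, smul_assoc]

theorem HF_smul (m : M) : H • F • m = F • H • m + (-2 : ℂ) • F • m := by
  rw [← mul_smul, HF, add_smul, mul_smul, smul_assoc]

theorem E_weight {c : ℂ} {m : M} (h : H • m = c • m) (k : ℕ) :
    H • E ^ k • m = (c + 2 * k) • E ^ k • m := by
  induction k with
  | zero => simpa using h
  | succ k ih =>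
    rw [pow_succ', mul_smul, HE_smul, ih, smul_comm E, ← add_smul]
    congr 1
    push_cast
    ring

theorem F_weight {c : ℂ} {m : M} (h : H • m = c • m) (k : ℕ) :
    H • F ^ k • m = (c - 2 * k) • F ^ k • m := by
  induction k with
  | zero => simpa using h
  | succ k ih =>
    rw [pow_succ', mul_smul, HF_smul, ih, smul_comm F, ← add_smul]
    congr 1
    push_cast
    ring

variable (M) in
/-- The weight space `M_c`: weights of `𝔥` are identified with complex numbers by evaluating them
at the coroot. -/
def weightSpace (c : ℂ) : Submodule ℂ M :=
  Module.End.eigenspace (Algebra.lsmul ℂ ℂ M H) c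

theorem mem_weightSpace {c : ℂ} {m : M} : m ∈ weightSpace M c ↔ H • m = c • m :=
  Module.End.mem_eigenspace_iff

variable (M) in
/-- The objects of the BGG category `𝓞` of `𝔰𝔩₂`, among the modules over `U(𝔰𝔩₂)`. Since `𝔫⁺` is
spanned by `E`, the orbit `U(𝔫⁺)m` is the span of all `Eᵏm`. -/
structure IsCatO : Prop where
  finite : Module.Finite U M
  weight : ⨆ c : ℂ, weightSpace M c = ⊤
  locallyFinite : ∀ m : M,
    FiniteDimensional ℂ (Submodule.span ℂ (Set.range fun k : ℕ => E ^ k • m))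

/-- Every highest weight vector of a quotient `M/Q` that comes from an element of `P` has its
weight in `S`. If `M` lies in `𝓞`, this says that all composition factors of `P` are of the form
`L(c)` with `c ∈ S`. -/
def HighestWeightsIn (S : Set ℂ) (P : Submodule U M) : Prop :=
  ∀ (Q : Submodule U M) (v : M) (c : ℂ),
    v ∈ P → v ∉ Q → E • v ∈ Q → H • v - c • v ∈ Q → c ∈ S

/-- The orbit of a weight under the dot-action of the Weyl group `{e, s}`, where
`s · lam = - lam - 2`. -/
def dotOrbit (lam : ℂ) : Set ℂ := {lam, -lam - 2}

variable (M) in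
/-- The objects of the block `𝓞_lam`: the modules in `𝓞` whose composition factors have highest
weights in the dot-orbit of `lam`. -/
structure IsInBlock (lam : ℂ) : Prop where
  isCatO : IsCatO M
  highestWeights : HighestWeightsIn (dotOrbit lam) (⊤ : Submodule U M)

/-! ### Weight decompositions -/

theorem weight_sum (h : ⨆ c : ℂ, weightSpace M c = ⊤) (m : M) :
    ∃ (s : Finset ℂ) (y : ℂ → M), (∀ c, H • y c = c • y c) ∧ ∑ c ∈ s, y c = m := by
  have hm : m ∈ ⨆ c : ℂ, weightSpace M c := h ▸ Submodule.mem_top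
  obtain ⟨y, hy, hsum⟩ := (Submodule.mem_iSup_iff_exists_finsupp _ _).1 hm
  exact ⟨y.support, y, fun c => mem_weightSpace.1 (hy c), hsum⟩

theorem weight_of_sum (h : ∀ m : M, ∃ (s : Finset ℂ) (y : ℂ → M),
    (∀ c ∈ s, H • y c = c • y c) ∧ ∑ c ∈ s, y c = m) : ⨆ c : ℂ, weightSpace M c = ⊤ := by
  refine eq_top_iff.2 fun m _ => ?_
  obtain ⟨s, y, hy, rfl⟩ := h m
  exact Submodule.sum_mem _ fun c hc =>
    Submodule.mem_iSup_of_mem c (mem_weightSpace.2 (hy c hc))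

theorem comp_mem (P : Submodule ℂ M) (hP : ∀ x ∈ P, H • x ∈ P) (s : Finset ℂ) :
    ∀ y : ℂ → M, (∀ c ∈ s, H • y c = c • y c) → ∑ c ∈ s, y c ∈ P → ∀ c ∈ s, y c ∈ P := by
  classical
  induction s using Finset.induction_on with
  | empty => simp
  | insert a s ha ih =>
    intro y hy hsum
    have hs : ∀ c ∈ s, y c ∈ P := by
      intro c hc
      have h1 : ∑ c ∈ s, (c - a) • y c ∈ P := by
        have h2 := P.sub_mem (hP _ hsum) (P.smul_mem a hsum)
        have h3 : H • ∑ c ∈ insert a s, y c - a • ∑ c ∈ insert a s, y c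
            = ∑ c ∈ s, (c - a) • y c := by
          rw [Finset.smul_sum, Finset.smul_sum, ← Finset.sum_sub_distrib,
            Finset.sum_insert ha, hy a (Finset.mem_insert_self _ _), sub_self, zero_add]
          exact Finset.sum_congr rfl fun c hc => by
            rw [hy c (Finset.mem_insert_of_mem hc), sub_smul]
        rwa [h3] at h2
      have h4 := ih (fun c => (c - a) • y c) (fun c hc => by
        rw [smul_comm H, hy c (Finset.mem_insert_of_mem hc), smul_comm]) h1 c hc
      have hne : c - a ≠ 0 := sub_ne_zero.2 fun h => ha (h ▸ hc)
      exact (P.smul_mem_iff hne).1 h4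
    intro c hc
    rcases Finset.mem_insert.1 hc with rfl | hc
    · rw [Finset.sum_insert ha] at hsum
      exact (P.add_mem_iff_left (P.sum_mem hs)).1 hsum
    · exact hs c hc

theorem weight_of_injective (f : M →ₗ[U] N) (hf : Function.Injective f)
    (h : ⨆ c : ℂ, weightSpace N c = ⊤) : ⨆ c : ℂ, weightSpace M c = ⊤ := by
  refine weight_of_sum fun m => ?_
  obtain ⟨s, y, hy, hsum⟩ := weight_sum h (f m)
  have hmem := comp_mem ((LinearMap.range f).restrictScalars ℂ)
    (fun x hx => (LinearMap.range f).smul_mem H hx) s y (fun c _ => hy c) (hsum ▸ ⟨m, rfl⟩)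
  have hx : ∀ c, ∃ x : M, c ∈ s → f x = y c := fun c => by
    by_cases hc : c ∈ s
    · obtain ⟨x, hx⟩ := hmem c hc
      exact ⟨x, fun _ => hx⟩
    · exact ⟨0, fun h => absurd h hc⟩
  choose x hx using hx
  refine ⟨s, x, fun c hc => hf ?_, hf ?_⟩
  · rw [map_smul, hx c hc, hy, LinearMap.map_smul_of_tower, hx c hc]
  · rw [map_sum, Finset.sum_congr rfl hx, hsum]

theorem weight_of_surjective (f : M →ₗ[U] N) (hf : Function.Surjective f)
    (h : ⨆ c : ℂ, weightSpace M c = ⊤) : ⨆ c : ℂ, weightSpace N c = ⊤ := by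
  refine weight_of_sum fun n => ?_
  obtain ⟨m, rfl⟩ := hf n
  obtain ⟨s, y, hy, rfl⟩ := weight_sum h m
  exact ⟨s, fun c => f (y c), fun c _ => by
    rw [← map_smul, hy, LinearMap.map_smul_of_tower], by rw [map_sum]⟩

theorem weight_of_span (X : Set M) (hX : Submodule.span ℂ X = ⊤)
    (h : ∀ x ∈ X, ∃ c : ℂ, H • x = c • x) : ⨆ c : ℂ, weightSpace M c = ⊤ := by
  rw [← top_le_iff, ← hX, Submodule.span_le]
  intro x hx
  obtain ⟨c, hc⟩ := h x hx
  exact Submodule.mem_iSup_of_mem c (mem_weightSpace.2 hc)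

theorem span_weight (h : ⨆ c : ℂ, weightSpace M c = ⊤) :
    Submodule.span ℂ {m : M | ∃ c : ℂ, H • m = c • m} = ⊤ := by
  rw [← top_le_iff, ← h, iSup_le_iff]
  exact fun c m hm => Submodule.subset_span ⟨c, mem_weightSpace.1 hm⟩

theorem weightSpace_le {ι : Type*} (x : ι → M) (w : ι → ℂ) (hx : ∀ i, H • x i = w i • x i)
    (hspan : Submodule.span ℂ (Set.range x) = ⊤) (c : ℂ) :
    weightSpace M c ≤ Submodule.span ℂ (x '' {i | w i = c}) := by
  intro y hy
  have htop : Submodule.span ℂ (x '' {i | w i = c}) ⊔ Submodule.span ℂ (x '' {i | w i ≠ c})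
      = ⊤ := by
    rw [← Submodule.span_union, ← Set.image_union, ← hspan, ← Set.image_univ]
    congr 2
    ext i
    simp [em]
  obtain ⟨a, ha, b, hb, rfl⟩ := Submodule.mem_sup.1 (htop ▸ Submodule.mem_top (x := y))
  have ha' : a ∈ weightSpace M c := by
    refine Submodule.span_le.2 ?_ ha
    rintro _ ⟨i, rfl, rfl⟩
    exact mem_weightSpace.2 (hx i)
  have hb' : b ∈ weightSpace M c := ((weightSpace M c).add_mem_iff_right ha').1 hy
  have hb'' : b ∈ ⨆ (d) (_ : d ≠ c), weightSpace M d := by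
    refine Submodule.span_le.2 ?_ hb
    rintro _ ⟨i, hi, rfl⟩
    exact Submodule.mem_iSup_of_mem (w i)
      (Submodule.mem_iSup_of_mem hi (mem_weightSpace.2 (hx i)))
  have : b = 0 := Submodule.disjoint_def.1
    (Module.End.eigenspaces_iSupIndep (Algebra.lsmul ℂ ℂ M H) c) b hb' hb''
  rwa [this, add_zero]

/-! ### Local nilpotency of the raising operator -/

theorem nil_of_finite (h : ⨆ c : ℂ, weightSpace M c = ⊤)
    (hf : ∀ m : M, FiniteDimensional ℂ (Submodule.span ℂ (Set.range fun k : ℕ => E ^ k • m)))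
    (m : M) : ∃ k : ℕ, E ^ k • m = 0 := by
  have hmono : ∀ {m : M} {k l : ℕ}, k ≤ l → E ^ k • m = 0 → E ^ l • m = 0 := by
    intro m k l hkl h0
    obtain ⟨d, rfl⟩ := Nat.exists_eq_add_of_le' hkl
    rw [pow_add, mul_smul, h0, smul_zero]
  have hw : ∀ (c : ℂ) (m : M), H • m = c • m → ∃ k : ℕ, E ^ k • m = 0 := by
    intro c m hm
    by_contra! hne
    have hli : LinearIndependent ℂ (fun k : ℕ => E ^ k • m) :=
      Module.End.eigenvectors_linearIndependent' (Algebra.lsmul ℂ ℂ M H)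
        (fun k : ℕ => c + 2 * (k : ℂ))
        (fun a b hab => by
          have : (a : ℂ) = b := by simpa using hab
          exact_mod_cast this) _
        (fun k => Module.End.hasEigenvector_iff.2
          ⟨mem_weightSpace.2 (E_weight hm k), hne k⟩)
    have := hf m
    have hli' := linearIndependent_span hli
    have : Finite ℕ := hli'.finite
    exact not_finite ℕ
  obtain ⟨s, y, hy, rfl⟩ := weight_sum h m
  choose k hk using fun c => hw c (y c) (hy c)
  refine ⟨s.sup k, ?_⟩
  rw [Finset.smul_sum]
  exact Finset.sum_eq_zero fun c hc => hmono (Finset.le_sup hc) (hk c)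

end Modules
/-- A complex subspace that is stable under `E`, `F` and `H` is a submodule over `U(𝔰𝔩₂)`. -/
def ofStable {M : Type*} [AddCommGroup M] [Module ℂ M] [Module U M] [IsScalarTower ℂ U M]
    (P : Submodule ℂ M) (hE : ∀ x ∈ P, E • x ∈ P) (hF : ∀ x ∈ P, F • x ∈ P)
    (hH : ∀ x ∈ P, H • x ∈ P) : Submodule U M where
  carrier := P
  add_mem' := P.add_mem
  zero_mem' := P.zero_mem
  smul_mem' := by
    let S : Subalgebra ℂ U :=
      { carrier := {u | ∀ x ∈ P, u • x ∈ P}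
        mul_mem' := fun {a b} ha hb x hx => by rw [mul_smul]; exact ha _ (hb _ hx)
        add_mem' := fun {a b} ha hb x hx => by
          rw [add_smul]; exact P.add_mem (ha _ hx) (hb _ hx)
        algebraMap_mem' := fun c x hx => by rw [algebraMap_smul]; exact P.smul_mem c hx }
    intro u x hx
    have hu : u ∈ S := (adjoin_eq_top S hE hF hH) ▸ Algebra.mem_top
    exact hu x hx

theorem mem_ofStable {M : Type*} [AddCommGroup M] [Module ℂ M] [Module U M]
    [IsScalarTower ℂ U M] {P : Submodule ℂ M} {hE : ∀ x ∈ P, E • x ∈ P}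
    {hF : ∀ x ∈ P, F • x ∈ P} {hH : ∀ x ∈ P, H • x ∈ P} {x : M} :
    x ∈ ofStable P hE hF hH ↔ x ∈ P := Iff.rfl

section Finiteness

variable {M : Type*} [AddCommGroup M] [Module ℂ M] [Module U M] [IsScalarTower ℂ U M]

/-- The commutation relation of `E` with powers of `F`, on weight vectors. -/
theorem EF_pow {c : ℂ} {m : M} (h : H • m = c • m) (k : ℕ) :
    E • F ^ (k + 1) • m = F ^ (k + 1) • E • m + ((k + 1) * (c - k)) • F ^ k • m := by
  induction k with
  | zero => simp [EF_smul, h]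
  | succ k ih =>
    rw [pow_succ' F (k + 1), mul_smul, EF_smul, ih, smul_add, F_weight h,
      smul_comm F (((k : ℂ) + 1) * (c - k)), ← mul_smul F (F ^ (k + 1)), ← mul_smul F (F ^ k),
      ← pow_succ', ← pow_succ', add_assoc, ← add_smul]
    congr 2
    push_cast
    ring

/-- In a finitely generated weight module on which `E` is locally nilpotent, all weight spaces are
finite-dimensional. -/
theorem finite_weightSpace (hfin : Module.Finite U M) (h : ⨆ c : ℂ, weightSpace M c = ⊤)
    (hnil : ∀ m : M, ∃ k : ℕ, E ^ k • m = 0) (c : ℂ) :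
    FiniteDimensional ℂ (weightSpace M c) := by
  classical
  -- a finite set of weight vectors, closed under `E` up to zero, that generates `M`
  have hgen : ∃ T : Set M, T.Finite ∧ (∀ m ∈ T, ∃ c : ℂ, H • m = c • m) ∧
      (∀ m ∈ T, E • m ∈ Submodule.span ℂ T) ∧ Submodule.span U T = ⊤ := by
    obtain ⟨G, hG⟩ := hfin
    choose s y hy hsum using weight_sum h
    choose k hk using hnil
    let T : Set M := ⋃ g ∈ G, ⋃ c ∈ s g, ⋃ i ∈ Finset.range (k (y g c)), {E ^ i • y g c}
    have hT : ∀ g ∈ G, ∀ c ∈ s g, ∀ i, i < k (y g c) → E ^ i • y g c ∈ T := by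
      intro g hg c hc i hi
      simp only [T, Set.mem_iUnion, Finset.mem_range]
      exact ⟨g, hg, c, hc, i, hi, rfl⟩
    have hT' : ∀ g ∈ G, ∀ c ∈ s g, ∀ i, E ^ i • y g c ∈ Submodule.span ℂ T := by
      intro g hg c hc i
      rcases lt_or_ge i (k (y g c)) with hi | hi
      · exact Submodule.subset_span (hT g hg c hc i hi)
      · obtain ⟨d, rfl⟩ := Nat.exists_eq_add_of_le' hi
        rw [pow_add, mul_smul, hk, smul_zero]
        exact Submodule.zero_mem _
    refine ⟨T, ?_, ?_, ?_, ?_⟩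
    · exact G.finite_toSet.biUnion fun g _ => (s g).finite_toSet.biUnion fun c _ =>
        (Finset.range _).finite_toSet.biUnion fun i _ => Set.finite_singleton _
    · intro m hm
      simp only [T, Set.mem_iUnion] at hm
      obtain ⟨g, hg, c, hc, i, hi, rfl⟩ := hm
      exact ⟨_, E_weight (hy g c) i⟩
    · intro m hm
      simp only [T, Set.mem_iUnion] at hm
      obtain ⟨g, hg, c, hc, i, hi, rfl⟩ := hm
      rw [← mul_smul, ← pow_succ']
      exact hT' g hg c hc (i + 1)
    · rw [← top_le_iff, ← hG, Submodule.span_le]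
      intro g hg
      rw [← hsum g]
      refine Submodule.sum_mem _ fun c hc => ?_
      have h0 := hT' g hg c hc 0
      rw [pow_zero, one_smul] at h0
      exact Submodule.span_le_restrictScalars ℂ U T h0
  obtain ⟨T, hTfin, hTw, hTE, hTtop⟩ := hgen
  choose! w hw using hTw
  -- `M` is spanned by the vectors `Fᵏt`
  let x : ℕ × T → M := fun p => F ^ p.1 • (p.2 : M)
  have hx : ∀ p : ℕ × T, H • x p = (w p.2 - 2 * p.1) • x p := fun p =>
    F_weight (hw _ p.2.2) _
  let P := Submodule.span ℂ (Set.range x)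
  have hPx : ∀ k : ℕ, ∀ t ∈ T, F ^ k • t ∈ P := fun k t ht =>
    Submodule.subset_span ⟨(k, ⟨t, ht⟩), rfl⟩
  have hPspan : ∀ k : ℕ, ∀ v ∈ Submodule.span ℂ T, F ^ k • v ∈ P := by
    intro k v hv
    induction hv using Submodule.span_induction with
    | mem v hv => exact hPx k v hv
    | zero => rw [smul_zero]; exact P.zero_mem
    | add a b _ _ ha hb => rw [smul_add]; exact P.add_mem ha hb
    | smul c a _ ha => rw [smul_comm]; exact P.smul_mem c ha
  have hstab : ∀ u : U, (∀ p : ℕ × T, u • x p ∈ P) → ∀ v ∈ P, u • v ∈ P := by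
    intro u hu v hv
    induction hv using Submodule.span_induction with
    | mem v hv => obtain ⟨p, rfl⟩ := hv; exact hu p
    | zero => rw [smul_zero]; exact P.zero_mem
    | add a b _ _ ha hb => rw [smul_add]; exact P.add_mem ha hb
    | smul c a _ ha => rw [smul_comm]; exact P.smul_mem c ha
  have hPtop : P = ⊤ := by
    let P' : Submodule U M := ofStable P
      (hstab E (by
        rintro ⟨k, t, ht⟩
        change E • F ^ k • t ∈ P
        cases k with
        | zero => simpa using hPspan 0 _ (hTE t ht)
        | succ k =>
          rw [EF_pow (hw t ht)]
          exact P.add_mem (hPspan _ _ (hTE t ht)) (P.smul_mem _ (hPx k t ht))))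
      (hstab F (by
        rintro ⟨k, t, ht⟩
        change F • F ^ k • t ∈ P
        rw [← mul_smul, ← pow_succ']
        exact hPx _ t ht))
      (hstab H (fun p => by
        rw [hx]
        exact P.smul_mem _ (Submodule.subset_span ⟨p, rfl⟩)))
    have hP' : P' = ⊤ := by
      rw [← top_le_iff, ← hTtop, Submodule.span_le]
      intro t ht
      have h0 := hPx 0 t ht
      rw [pow_zero, one_smul] at h0
      exact h0
    refine eq_top_iff.2 fun m _ => ?_
    have hm : m ∈ P' := hP' ▸ Submodule.mem_top
    exact hm
  have hle := weightSpace_le x (fun p => w p.2 - 2 * (p.1 : ℂ)) hx hPtop c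
  have hfinset : {p : ℕ × T | w p.2 - 2 * (p.1 : ℂ) = c}.Finite := by
    have : Finite T := hTfin
    refine Set.Finite.of_finite_image (f := Prod.snd) (Set.toFinite _) ?_
    rintro ⟨k, t⟩ hk ⟨l, t'⟩ hl htt'
    simp only [Set.mem_ofPred_eq] at hk hl htt'
    subst htt'
    have : (k : ℂ) = l := by linear_combination (hl - hk) / 2
    rw [Nat.cast_injective this]
  have := FiniteDimensional.span_of_finite ℂ (hfinset.image x)
  exact Submodule.finiteDimensional_of_le hle

/-- In a weight module with finite-dimensional weight spaces on which `E` is locally nilpotent,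
a submodule whose highest weights lie in a finite set is finitely generated. -/
theorem fg_of_highestWeightsIn (h : ⨆ c : ℂ, weightSpace M c = ⊤)
    (hnil : ∀ m : M, ∃ k : ℕ, E ^ k • m = 0)
    (hfd : ∀ c : ℂ, FiniteDimensional ℂ (weightSpace M c))
    {S : Set ℂ} (hS : S.Finite) (P : Submodule U M) (hP : HighestWeightsIn S P) : P.FG := by
  classical
  let W : ℂ → Submodule ℂ M := fun c => weightSpace M c ⊓ P.restrictScalars ℂ
  have hW : ∀ c, (W c).FG := fun c => by
    have := hfd c
    have : FiniteDimensional ℂ (W c) := Submodule.finiteDimensional_of_le inf_le_left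
    exact (Submodule.fg_iff_finiteDimensional _).2 this
  choose G hG using hW
  let Q : Submodule U M := Submodule.span U (⋃ c ∈ S, (G c : Set M))
  have hQfg : Q.FG :=
    Submodule.fg_def.2 ⟨_, hS.biUnion fun c _ => (G c).finite_toSet, rfl⟩
  have hWQ : ∀ c ∈ S, ∀ m ∈ W c, m ∈ Q := by
    intro c hc m hm
    rw [← hG c] at hm
    exact Submodule.span_mono (Set.subset_biUnion_of_mem (u := fun c => (G c : Set M)) hc)
      (Submodule.span_le_restrictScalars ℂ U _ hm)
  have hQP : Q ≤ P := by
    refine Submodule.span_le.2 ?_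
    intro m hm
    simp only [Set.mem_iUnion] at hm
    obtain ⟨c, _, hm⟩ := hm
    have : m ∈ W c := hG c ▸ Submodule.subset_span hm
    exact this.2
  have hw : ∀ (c : ℂ) (m : M), H • m = c • m → m ∈ P → m ∈ Q := by
    intro c m hm hmP
    by_contra hmQ
    have hex : ∃ k, E ^ k • m ∈ Q := by
      obtain ⟨k, hk⟩ := hnil m
      exact ⟨k, hk ▸ Q.zero_mem⟩
    let k := Nat.find hex
    have hk : E ^ k • m ∈ Q := Nat.find_spec hex
    have hk0 : k ≠ 0 := fun h0 => hmQ (by rw [h0] at hk; simpa using hk)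
    obtain ⟨l, hl⟩ := Nat.exists_eq_succ_of_ne_zero hk0
    have hlQ : E ^ l • m ∉ Q := Nat.find_min hex (show l < k by omega)
    have hlP : E ^ l • m ∈ P := P.smul_mem _ hmP
    have hlw := E_weight hm l
    have hcS : c + 2 * (l : ℂ) ∈ S := hP Q (E ^ l • m) (c + 2 * l) hlP hlQ
      (by rw [← mul_smul, ← pow_succ']; rw [hl] at hk; exact hk)
      (by rw [hlw, sub_self]; exact Q.zero_mem)
    exact hlQ (hWQ _ hcS _ ⟨mem_weightSpace.2 hlw, hlP⟩)
  have hPQ : P ≤ Q := by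
    intro m hm
    obtain ⟨s, y, hy, rfl⟩ := weight_sum h m
    exact Submodule.sum_mem _ fun c hc => hw c _ (hy c)
      (comp_mem (P.restrictScalars ℂ) (fun x hx => P.smul_mem H hx) s y (fun c _ => hy c) hm c hc)
  rwa [le_antisymm hPQ hQP]

end Finiteness
section Closure

theorem HighestWeightsIn.mono {M : Type*} [AddCommGroup M] [Module ℂ M] [Module U M]
    {S : Set ℂ} {P Q : Submodule U M} (h : P ≤ Q)
    (hQ : HighestWeightsIn S Q) : HighestWeightsIn S P :=
  fun R v c hv hvR => hQ R v c (h hv) hvR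

variable {M : Type*} [AddCommGroup M] [Module ℂ M] [Module U M] [IsScalarTower ℂ U M]
variable {N : Type*} [AddCommGroup N] [Module ℂ N] [Module U N] [IsScalarTower ℂ U N]

theorem HighestWeightsIn.sup {S : Set ℂ} {P Q : Submodule U M} (hP : HighestWeightsIn S P)
    (hQ : HighestWeightsIn S Q) : HighestWeightsIn S (P ⊔ Q) := by
  intro R v c hv hvR hE hH
  obtain ⟨p, hp, q, hq, rfl⟩ := Submodule.mem_sup.1 hv
  by_cases hqR : q ∈ R ⊔ P
  · obtain ⟨r, hr, p', hp', rfl⟩ := Submodule.mem_sup.1 hqR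
    have e : p + (r + p') = r + (p + p') := by abel
    rw [e] at hvR hE hH
    refine hP R (p + p') c (P.add_mem hp hp') (fun h => hvR (R.add_mem hr h)) ?_ ?_
    · rw [smul_add] at hE
      exact (R.add_mem_iff_right (R.smul_mem E hr)).1 hE
    · have e2 : H • (r + (p + p')) - c • (r + (p + p'))
          = (H • r - c • r) + (H • (p + p') - c • (p + p')) := by
        rw [smul_add H, smul_add c]; abel
      rw [e2] at hH
      exact (R.add_mem_iff_right
        (R.sub_mem (R.smul_mem H hr) (R.smul_of_tower_mem c hr))).1 hH
  · refine hQ (R ⊔ P) q c hq hqR ?_ ?_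
    · rw [smul_add] at hE
      exact ((R ⊔ P).add_mem_iff_right (Submodule.mem_sup_right (P.smul_mem E hp))).1
        (Submodule.mem_sup_left hE)
    · have e2 : H • (p + q) - c • (p + q) = (H • p - c • p) + (H • q - c • q) := by
        rw [smul_add, smul_add]; abel
      rw [e2] at hH
      exact ((R ⊔ P).add_mem_iff_right (Submodule.mem_sup_right
        (P.sub_mem (P.smul_mem H hp) (P.smul_of_tower_mem c hp)))).1 (Submodule.mem_sup_left hH)

theorem HighestWeightsIn.map {S : Set ℂ} {P : Submodule U M} (hP : HighestWeightsIn S P)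
    (f : M →ₗ[U] N) : HighestWeightsIn S (P.map f) := by
  rintro R _ c ⟨v, hv, rfl⟩ hvR hE hH
  refine hP (R.comap f) v c hv hvR ?_ ?_
  · rw [Submodule.mem_comap, map_smul]; exact hE
  · rw [Submodule.mem_comap, map_sub, map_smul, LinearMap.map_smul_of_tower]; exact hH

theorem HighestWeightsIn.of_injective {S : Set ℂ} {P : Submodule U M} (f : M →ₗ[U] N)
    (hf : Function.Injective f) (hP : HighestWeightsIn S (P.map f)) : HighestWeightsIn S P := by
  intro R v c hv hvR hE hH
  refine hP (R.map f) (f v) c ⟨v, hv, rfl⟩ ?_ ?_ ?_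
  · rintro ⟨r, hr, hrv⟩
    exact hvR (hf hrv ▸ hr)
  · exact ⟨_, hE, map_smul f E v⟩
  · exact ⟨_, hH, by rw [map_sub, map_smul, LinearMap.map_smul_of_tower]⟩

theorem dotOrbit_finite (lam : ℂ) : (dotOrbit lam).Finite :=
  (Set.finite_singleton _).insert _

theorem IsCatO.nil (h : IsCatO M) (m : M) : ∃ k : ℕ, E ^ k • m = 0 :=
  nil_of_finite h.weight h.locallyFinite m

theorem IsCatO.finite_weightSpace (h : IsCatO M) (c : ℂ) :
    FiniteDimensional ℂ (weightSpace M c) :=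
  SL2.finite_weightSpace h.finite h.weight h.nil c

/-- A criterion for a submodule of a possibly large module to lie in a block. -/
theorem isInBlock_of_injective {lam : ℂ} (f : M →ₗ[U] N) (hf : Function.Injective f)
    (h : ⨆ c : ℂ, weightSpace N c = ⊤) (hnil : ∀ m : N, ∃ k : ℕ, E ^ k • m = 0)
    (hfd : ∀ c : ℂ, FiniteDimensional ℂ (weightSpace N c))
    (hP : HighestWeightsIn (dotOrbit lam) (LinearMap.range f)) : IsInBlock M lam where
  isCatO :=
    { finite := by
        have h1 := fg_of_highestWeightsIn h hnil hfd (dotOrbit_finite lam) _ hP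
        have : Module.Finite U (LinearMap.range f) := Module.Finite.iff_fg.2 h1
        exact Module.Finite.equiv (LinearEquiv.ofInjective f hf).symm
      weight := weight_of_injective f hf h
      locallyFinite := fun m => finite_of_nil m (by
        obtain ⟨k, hk⟩ := hnil (f m)
        exact ⟨k, hf (by rw [map_smul, hk, map_zero])⟩) }
  highestWeights := HighestWeightsIn.of_injective f hf (by rwa [Submodule.map_top])

theorem IsInBlock.of_injective {lam : ℂ} (f : M →ₗ[U] N) (hf : Function.Injective f)
    (h : IsInBlock N lam) : IsInBlock M lam :=
  isInBlock_of_injective f hf h.isCatO.weight h.isCatO.nil h.isCatO.finite_weightSpace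
    (h.highestWeights.mono le_top)

theorem IsInBlock.of_surjective {lam : ℂ} (f : M →ₗ[U] N) (hf : Function.Surjective f)
    (h : IsInBlock M lam) : IsInBlock N lam where
  isCatO :=
    { finite := have := h.isCatO.finite; Module.Finite.of_surjective f hf
      weight := weight_of_surjective f hf h.isCatO.weight
      locallyFinite := fun n => finite_of_nil n (by
        obtain ⟨m, rfl⟩ := hf n
        obtain ⟨k, hk⟩ := h.isCatO.nil m
        exact ⟨k, by rw [← map_smul, hk, map_zero]⟩) }
  highestWeights := by
    have := h.highestWeights.map f
    rwa [Submodule.map_top, LinearMap.range_eq_top.2 hf] at this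

theorem IsInBlock.prod {lam : ℂ} (hM : IsInBlock M lam) (hN : IsInBlock N lam) :
    IsInBlock (M × N) lam where
  isCatO :=
    { finite := have := hM.isCatO.finite; have := hN.isCatO.finite; inferInstance
      weight := by
        refine weight_of_span ({m | ∃ c : ℂ, H • m = c • m}) ?_ (fun _ h => h)
        refine eq_top_iff.2 fun p _ => ?_
        obtain ⟨s, y, hy, h1⟩ := weight_sum hM.isCatO.weight p.1
        obtain ⟨t, z, hz, h2⟩ := weight_sum hN.isCatO.weight p.2
        have hp : p = ∑ c ∈ s, ((y c, 0) : M × N) + ∑ c ∈ t, ((0, z c) : M × N) := by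
          ext <;> simp [Prod.fst_sum, Prod.snd_sum, h1, h2]
        rw [hp]
        exact Submodule.add_mem _
          (Submodule.sum_mem _ fun c _ => Submodule.subset_span ⟨c, by simp [hy]⟩)
          (Submodule.sum_mem _ fun c _ => Submodule.subset_span ⟨c, by simp [hz]⟩)
      locallyFinite := fun p => finite_of_nil p (by
        obtain ⟨k, hk⟩ := hM.isCatO.nil p.1
        obtain ⟨l, hl⟩ := hN.isCatO.nil p.2
        refine ⟨k + l, Prod.ext ?_ ?_⟩
        · rw [add_comm, pow_add, mul_smul, Prod.smul_fst, Prod.smul_fst, hk, smul_zero]; rfl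
        · rw [pow_add, mul_smul, Prod.smul_snd, Prod.smul_snd, hl, smul_zero]; rfl) }
  highestWeights := by
    have h1 := hM.highestWeights.map (LinearMap.inl U M N)
    have h2 := hN.highestWeights.map (LinearMap.inr U M N)
    have h3 := h1.sup h2
    rwa [Submodule.map_top, Submodule.map_top, LinearMap.sup_range_inl_inr] at h3

theorem IsInBlock.of_subsingleton (lam : ℂ) [Subsingleton M] : IsInBlock M lam where
  isCatO :=
    { finite := inferInstance
      weight := Subsingleton.elim _ _
      locallyFinite := fun m => finite_of_nil m ⟨0, Subsingleton.elim _ _⟩ }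
  highestWeights := fun Q v _ _ hvQ => absurd (Subsingleton.elim v 0 ▸ Q.zero_mem) hvQ

end Closure

/-! ### The blocks as abelian categories -/

attribute [local instance] ModuleCat.moduleOfAlgebraModule
attribute [local instance] ModuleCat.isScalarTower_of_algebra_moduleCat

/-- The block `𝓞_lam` as a property of modules over `U(𝔰𝔩₂)`. -/
def blockProperty (lam : ℂ) : ObjectProperty (ModuleCat.{0} U) := fun M => IsInBlock M lam

/-- The block `𝓞_lam` of the BGG category `𝓞` of `𝔰𝔩₂`. -/
abbrev Block (lam : ℂ) := (blockProperty lam).FullSubcategory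

instance (lam : ℂ) : (blockProperty lam).IsClosedUnderSubobjects where
  prop_of_mono f _ h :=
    IsInBlock.of_injective f.hom ((ModuleCat.mono_iff_injective f).1 inferInstance) h

instance (lam : ℂ) : (blockProperty lam).IsClosedUnderQuotients where
  prop_of_epi f _ h :=
    IsInBlock.of_surjective f.hom ((ModuleCat.epi_iff_surjective f).1 inferInstance) h

instance (lam : ℂ) : (blockProperty lam).ContainsZero where
  exists_zero := ⟨ModuleCat.of U PUnit, ModuleCat.isZero_of_subsingleton _,
    IsInBlock.of_subsingleton lam⟩

instance (lam : ℂ) : (blockProperty lam).IsClosedUnderBinaryProducts where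
  limitsOfShape_le := by
    rintro X ⟨p⟩
    have h1 := p.prop_diag_obj ⟨WalkingPair.left⟩
    have h2 := p.prop_diag_obj ⟨WalkingPair.right⟩
    refine IsInBlock.of_injective
      ((p.π.app ⟨WalkingPair.left⟩).hom.prod (p.π.app ⟨WalkingPair.right⟩).hom) ?_
      (IsInBlock.prod h1 h2)
    intro x y hxy
    have h3 : ModuleCat.ofHom (LinearMap.toSpanSingleton U X x)
        = ModuleCat.ofHom (LinearMap.toSpanSingleton U X y) := by
      refine p.isLimit.hom_ext ?_
      rintro ⟨_ | _⟩
      · refine ModuleCat.hom_ext (LinearMap.ext_ring ?_)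
        simpa using congrArg Prod.fst hxy
      · refine ModuleCat.hom_ext (LinearMap.ext_ring ?_)
        simpa using congrArg Prod.snd hxy
    simpa using congrArg (fun g => g.hom (1 : U)) h3

instance (lam : ℂ) : (blockProperty lam).IsClosedUnderFiniteProducts :=
  (.mk' : (blockProperty lam).IsClosedUnderFiniteProducts)
/-! ### Translation functors -/

open scoped TensorProduct

/-- The natural representation `L(1) = ℂ²` of `𝔰𝔩₂`. -/
def naturalRep : 𝔤 →ₗ⁅ℂ⁆ Module.End ℂ (Fin 2 → ℂ) :=
  { toFun := fun x => Matrix.toLin' x.1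
    map_add' := fun x y => by simp
    map_smul' := fun c x => by simp
    map_lie' := fun {x y} => by
      simp [LieRing.of_associative_ring_bracket,
        Matrix.toLin'_mul, Module.End.mul_eq_comp] }

section TensorBasic

variable (M : Type) [AddCommGroup M] [Module ℂ M]

/-- The underlying space of `M ⊗ L(1)`. -/
def TensorV : Type := M ⊗[ℂ] (Fin 2 → ℂ)

instance : AddCommGroup (TensorV M) := inferInstanceAs (AddCommGroup (M ⊗[ℂ] (Fin 2 → ℂ)))

instance : Module ℂ (TensorV M) := inferInstanceAs (Module ℂ (M ⊗[ℂ] (Fin 2 → ℂ)))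

variable {M}

/-- Pure tensors in `M ⊗ L(1)`. -/
def tens (m : M) (v : Fin 2 → ℂ) : TensorV M := m ⊗ₜ[ℂ] v

theorem zero_tens (v : Fin 2 → ℂ) : tens (0 : M) v = 0 := TensorProduct.zero_tmul _ _

theorem tens_eq (m : M) (v : Fin 2 → ℂ) :
    tens m v = v 0 • tens m (Pi.single 0 1) + v 1 • tens m (Pi.single 1 1) := by
  have h : v = v 0 • Pi.single 0 1 + v 1 • Pi.single 1 1 := by
    ext i; fin_cases i <;> simp
  conv_lhs => rw [h]
  refine (TensorProduct.tmul_add _ _ _).trans ?_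
  exact congrArg₂ _ (TensorProduct.tmul_smul _ _ _) (TensorProduct.tmul_smul _ _ _)

theorem tens_induction {p : TensorV M → Prop} (h0 : p 0) (ht : ∀ m v, p (tens m v))
    (hadd : ∀ a b, p a → p b → p (a + b)) (t : TensorV M) : p t :=
  TensorProduct.induction_on (motive := p) t h0 ht hadd

end TensorBasic

section Tensor

variable (M : Type) [AddCommGroup M] [Module ℂ M] [Module U M] [IsScalarTower ℂ U M]

/-- The tensor product representation of `𝔰𝔩₂` on `M ⊗ L(1)`. -/
def tensorRep : 𝔤 →ₗ⁅ℂ⁆ Module.End ℂ (M ⊗[ℂ] (Fin 2 → ℂ)) :=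
  { toFun := fun x =>
      (Algebra.lsmul ℂ ℂ M (UniversalEnvelopingAlgebra.ι ℂ x)).rTensor (Fin 2 → ℂ)
        + (naturalRep x).lTensor M
    map_add' := fun x y => by
      rw [map_add, map_add, map_add, LinearMap.rTensor_add, LinearMap.lTensor_add]; abel
    map_smul' := fun c x => by
      rw [map_smul, map_smul, map_smul, LinearMap.rTensor_smul, LinearMap.lTensor_smul,
        RingHom.id_apply, smul_add]
    map_lie' := fun {x y} => by
      refine TensorProduct.ext' fun m v => ?_
      simp only [LieHom.map_lie, LieRing.of_associative_ring_bracket, map_sub, map_mul,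
        LinearMap.add_apply, LinearMap.sub_apply, Module.End.mul_apply,
        LinearMap.rTensor_tmul, LinearMap.lTensor_tmul, map_add,
        TensorProduct.sub_tmul, TensorProduct.tmul_sub]
      abel }

/-- The action of `U(𝔰𝔩₂)` on `M ⊗ L(1)`. -/
def tensorAction : U →ₐ[ℂ] Module.End ℂ (M ⊗[ℂ] (Fin 2 → ℂ)) :=
  UniversalEnvelopingAlgebra.lift ℂ (tensorRep M)

instance : Module U (TensorV M) :=
  Module.compHom (M ⊗[ℂ] (Fin 2 → ℂ)) (tensorAction M).toRingHom

theorem tensorV_smul (u : U) (t : M ⊗[ℂ] (Fin 2 → ℂ)) :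
    (u • (show TensorV M from t) : TensorV M) = tensorAction M u t := rfl

instance : IsScalarTower ℂ U (TensorV M) where
  smul_assoc c u t := by
    change tensorAction M (c • u) t = c • tensorAction M u t
    rw [map_smul]
    rfl

variable {M}

theorem ι_tens (x : 𝔤) (m : M) (v : Fin 2 → ℂ) :
    UniversalEnvelopingAlgebra.ι ℂ x • tens m v
      = tens (UniversalEnvelopingAlgebra.ι ℂ x • m) v + tens m (naturalRep x v) := by
  change tensorAction M (UniversalEnvelopingAlgebra.ι ℂ x) (m ⊗ₜ[ℂ] v) = _
  rw [tensorAction, UniversalEnvelopingAlgebra.lift_ι_apply]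
  rfl

theorem H_tens_zero {c : ℂ} {m : M} (h : H • m = c • m) :
    H • tens m (Pi.single 0 1) = (c + 1) • tens m (Pi.single 0 1) := by
  have h1 : naturalRep H₀ (Pi.single 0 1) = Pi.single 0 1 := by
    ext i; fin_cases i <;> simp [naturalRep, H₀, Matrix.single]
  rw [H, ι_tens, h1, ← H, h, add_smul, one_smul]
  rfl

theorem H_tens_one {c : ℂ} {m : M} (h : H • m = c • m) :
    H • tens m (Pi.single 1 1) = (c - 1) • tens m (Pi.single 1 1) := by
  have h1 : naturalRep H₀ (Pi.single 1 1) = (-1 : ℂ) • Pi.single 1 1 := by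
    ext i; fin_cases i <;> simp [naturalRep, H₀, Matrix.single]
  rw [H, ι_tens, h1, ← H, h, sub_eq_add_neg, add_smul]
  exact congrArg _ (TensorProduct.tmul_smul _ _ _)

theorem E_tens_zero (m : M) : E • tens m (Pi.single 0 1) = tens (E • m) (Pi.single 0 1) := by
  have h1 : naturalRep E₀ (Pi.single 0 1) = 0 := by
    ext i; fin_cases i <;> simp [naturalRep, E₀, Matrix.single]
  rw [E, ι_tens, h1]
  exact (congrArg _ (TensorProduct.tmul_zero _ _)).trans (add_zero _)

theorem E_tens_one (m : M) : E • tens m (Pi.single 1 1)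
    = tens (E • m) (Pi.single 1 1) + tens m (Pi.single 0 1) := by
  have h1 : naturalRep E₀ (Pi.single 1 1) = Pi.single 0 1 := by
    ext i; fin_cases i <;> simp [naturalRep, E₀, Matrix.single]
  rw [E, ι_tens, h1]

theorem tensorV_induction {p : TensorV M → Prop} (hadd : ∀ a b, p a → p b → p (a + b))
    (hsmul : ∀ (c : ℂ) a, p a → p (c • a)) (h : ⨆ c : ℂ, weightSpace M c = ⊤)
    (h0 : ∀ (c : ℂ) (m : M), H • m = c • m → p (tens m (Pi.single 0 1)))
    (h1 : ∀ (c : ℂ) (m : M), H • m = c • m → p (tens m (Pi.single 1 1))) (t : TensorV M) :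
    p t := by
  have hz : p 0 := by simpa using hsmul 0 _ (h0 0 0 (by simp))
  have key : ∀ v : Fin 2 → ℂ, (∀ (c : ℂ) (m : M), H • m = c • m → p (tens m v)) →
      ∀ m, p (tens m v) := by
    intro v hv m
    have hm : m ∈ Submodule.span ℂ {m : M | ∃ c : ℂ, H • m = c • m} :=
      span_weight h ▸ Submodule.mem_top
    induction hm using Submodule.span_induction with
    | mem m hm => exact hv hm.choose m hm.choose_spec
    | zero => rwa [zero_tens]
    | add a b _ _ ha hb =>
      have := hadd _ _ ha hb
      rwa [show tens (a + b) v = tens a v + tens b v from TensorProduct.add_tmul _ _ _]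
    | smul c a _ ha =>
      have := hsmul c _ ha
      rwa [show tens (c • a) v = c • tens a v from TensorProduct.smul_tmul' _ _ _]
  refine tens_induction hz (fun m v => ?_) hadd t
  rw [tens_eq]
  exact hadd _ _ (hsmul _ _ (key _ h0 m)) (hsmul _ _ (key _ h1 m))

theorem tensorV_weight (h : ⨆ c : ℂ, weightSpace M c = ⊤) :
    ⨆ c : ℂ, weightSpace (TensorV M) c = ⊤ := by
  refine eq_top_iff.2 fun t _ => ?_
  refine tensorV_induction (p := fun t => t ∈ ⨆ c : ℂ, weightSpace (TensorV M) c)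
    (fun _ _ => Submodule.add_mem _) (fun c _ => Submodule.smul_mem _ c) h
    (fun c m hm => ?_) (fun c m hm => ?_) t
  · exact Submodule.mem_iSup_of_mem (c + 1) (mem_weightSpace.2 (H_tens_zero hm))
  · exact Submodule.mem_iSup_of_mem (c - 1) (mem_weightSpace.2 (H_tens_one hm))

theorem tensorV_nil (h : ⨆ c : ℂ, weightSpace M c = ⊤) (hnil : ∀ m : M, ∃ k : ℕ, E ^ k • m = 0)
    (t : TensorV M) : ∃ k : ℕ, E ^ k • t = 0 := by
  have e0 : ∀ (k : ℕ) (m : M),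
      E ^ k • tens m (Pi.single 0 1) = tens (E ^ k • m) (Pi.single 0 1) := by
    intro k m
    induction k with
    | zero => simp
    | succ k ih => rw [pow_succ', mul_smul, ih, E_tens_zero, ← mul_smul]
  have e1 : ∀ (k : ℕ) (m : M), E ^ k • tens m (Pi.single 1 1)
      = tens (E ^ k • m) (Pi.single 1 1) + (k : ℂ) • tens (E ^ (k - 1) • m) (Pi.single 0 1) := by
    intro k m
    induction k with
    | zero => simp
    | succ k ih =>
      rw [pow_succ', mul_smul, ih, smul_add, E_tens_one, ← mul_smul E (E ^ k), smul_comm E,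
        E_tens_zero, ← mul_smul E (E ^ (k - 1)), add_assoc, Nat.add_sub_cancel]
      congr 1
      cases k with
      | zero => simp
      | succ k =>
        rw [Nat.add_sub_cancel, ← pow_succ']
        push_cast
        module
  have hmono : ∀ {t : TensorV M} {k : ℕ} (l : ℕ), E ^ k • t = 0 → E ^ (k + l) • t = 0 := by
    intro t k l h0
    rw [add_comm, pow_add, mul_smul, h0, smul_zero]
  refine tensorV_induction (p := fun t => ∃ k : ℕ, E ^ k • t = 0) ?_ ?_ h ?_ ?_ t
  · rintro a b ⟨k, hk⟩ ⟨l, hl⟩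
    exact ⟨k + l, by rw [smul_add, hmono l hk, add_comm k l, hmono k hl, add_zero]⟩
  · rintro c a ⟨k, hk⟩
    exact ⟨k, by rw [smul_comm, hk, smul_zero]⟩
  · intro c m _
    obtain ⟨k, hk⟩ := hnil m
    exact ⟨k, by rw [e0, hk, zero_tens]⟩
  · intro c m _
    obtain ⟨k, hk⟩ := hnil m
    exact ⟨k + 1, by
      rw [e1, Nat.add_sub_cancel, pow_succ', mul_smul, hk, smul_zero, zero_tens, zero_tens,
        smul_zero, add_zero]⟩

theorem tensorV_finite (h : ⨆ c : ℂ, weightSpace M c = ⊤)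
    (hfd : ∀ c : ℂ, FiniteDimensional ℂ (weightSpace M c)) (c : ℂ) :
    FiniteDimensional ℂ (weightSpace (TensorV M) c) := by
  let ι := ((Σ c : ℂ, weightSpace M c) ⊕ (Σ c : ℂ, weightSpace M c))
  let x : ι → TensorV M := Sum.elim (fun p => tens p.2.1 (Pi.single 0 1))
    (fun p => tens p.2.1 (Pi.single 1 1))
  let w : ι → ℂ := Sum.elim (fun p => p.1 + 1) (fun p => p.1 - 1)
  have hx : ∀ i, H • x i = w i • x i := by
    rintro (⟨c, m, hm⟩ | ⟨c, m, hm⟩)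
    · exact H_tens_zero (mem_weightSpace.1 hm)
    · exact H_tens_one (mem_weightSpace.1 hm)
  have hspan : Submodule.span ℂ (Set.range x) = ⊤ := by
    refine eq_top_iff.2 fun t _ => ?_
    refine tensorV_induction (p := fun t => t ∈ Submodule.span ℂ (Set.range x))
      (fun _ _ => Submodule.add_mem _) (fun c _ => Submodule.smul_mem _ c) h
      (fun c m hm => ?_) (fun c m hm => ?_) t
    · exact Submodule.subset_span ⟨Sum.inl ⟨c, m, mem_weightSpace.2 hm⟩, rfl⟩
    · exact Submodule.subset_span ⟨Sum.inr ⟨c, m, mem_weightSpace.2 hm⟩, rfl⟩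
  let f : (Fin 2 → ℂ) → M →ₗ[ℂ] TensorV M := fun v => (TensorProduct.mk ℂ M (Fin 2 → ℂ)).flip v
  have := hfd (c - 1)
  have := hfd (c + 1)
  refine Submodule.finiteDimensional_of_le (S₂ := (weightSpace M (c - 1)).map (f (Pi.single 0 1))
    ⊔ (weightSpace M (c + 1)).map (f (Pi.single 1 1)))
    ((weightSpace_le x w hx hspan c).trans (Submodule.span_le.2 ?_))
  rintro _ ⟨⟨d, m, hm⟩ | ⟨d, m, hm⟩, hd, rfl⟩
  · have hd' : d = c - 1 := eq_sub_of_add_eq hd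
    subst hd'
    exact Submodule.mem_sup_left ⟨m, hm, rfl⟩
  · have hd' : d = c + 1 := eq_add_of_sub_eq hd
    subst hd'
    exact Submodule.mem_sup_right ⟨m, hm, rfl⟩

end Tensor

section BlockPart

variable {M : Type*} [AddCommGroup M] [Module ℂ M] [Module U M] [IsScalarTower ℂ U M]
variable {N : Type*} [AddCommGroup N] [Module ℂ N] [Module U N] [IsScalarTower ℂ U N]

variable (M) in
/-- The largest submodule of `M` all of whose composition factors are of the form `L(c)` with `c`
in the dot-orbit of `lam`. For `M` in `𝓞`, it is the direct summand of `M` lying in `𝓞_lam`. -/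
def blockPart (lam : ℂ) : Submodule U M where
  carrier := {m | HighestWeightsIn (dotOrbit lam) (Submodule.span U {m})}
  zero_mem' := by
    intro Q v c hv hvQ
    rw [Submodule.span_zero_singleton, Submodule.mem_bot] at hv
    exact absurd (hv ▸ Q.zero_mem) hvQ
  add_mem' {a b} ha hb := by
    refine (HighestWeightsIn.sup ha hb).mono ?_
    rw [Submodule.span_singleton_le_iff_mem]
    exact Submodule.add_mem_sup (Submodule.mem_span_singleton_self a)
      (Submodule.mem_span_singleton_self b)
  smul_mem' u m hm := by
    refine HighestWeightsIn.mono ?_ hm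
    rw [Submodule.span_singleton_le_iff_mem]
    exact Submodule.smul_mem _ u (Submodule.mem_span_singleton_self m)

theorem highestWeightsIn_blockPart (lam : ℂ) :
    HighestWeightsIn (dotOrbit lam) (blockPart M lam) :=
  fun Q v c hv => hv Q v c (Submodule.mem_span_singleton_self v)

theorem le_blockPart {lam : ℂ} {P : Submodule U M} (hP : HighestWeightsIn (dotOrbit lam) P) :
    P ≤ blockPart M lam :=
  fun _ hm => hP.mono ((Submodule.span_singleton_le_iff_mem _ _).2 hm)

theorem map_blockPart (lam : ℂ) (f : M →ₗ[U] N) {m : M} (hm : m ∈ blockPart M lam) :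
    f m ∈ blockPart N lam :=
  le_blockPart ((highestWeightsIn_blockPart lam).map f) ⟨m, hm, rfl⟩

end BlockPart

/-- The `U(𝔰𝔩₂)`-linear map `f ⊗ L(1)`. -/
def tensorMap {M N : Type} [AddCommGroup M] [Module ℂ M] [Module U M] [IsScalarTower ℂ U M]
    [AddCommGroup N] [Module ℂ N] [Module U N] [IsScalarTower ℂ U N] (f : M →ₗ[U] N) :
    TensorV M →ₗ[U] TensorV N where
  toFun t := (f.restrictScalars ℂ).rTensor (Fin 2 → ℂ) t
  map_add' a b := LinearMap.map_add ((f.restrictScalars ℂ).rTensor (Fin 2 → ℂ)) a b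
  map_smul' := by
    let g : TensorV M →ₗ[ℂ] TensorV N := (f.restrictScalars ℂ).rTensor (Fin 2 → ℂ)
    let S : Subalgebra ℂ U :=
      { carrier := {u | ∀ t, g (u • t) = u • g t}
        mul_mem' := fun {a b} ha hb t => by rw [mul_smul, ha, hb, mul_smul]
        add_mem' := fun {a b} ha hb t => by rw [add_smul, map_add, ha, hb, add_smul]
        algebraMap_mem' := fun c t => by rw [algebraMap_smul, algebraMap_smul, map_smul] }
    have hι : ∀ x : 𝔤, UniversalEnvelopingAlgebra.ι ℂ x ∈ S := by
      intro x t
      refine tens_induction (p := fun t => g (UniversalEnvelopingAlgebra.ι ℂ x • t)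
          = UniversalEnvelopingAlgebra.ι ℂ x • g t) ?_ ?_ ?_ t
      · rw [smul_zero, map_zero, smul_zero]
      · intro m v
        have hg : ∀ m v, g (tens m v) = tens (f m) v := fun m v => rfl
        rw [ι_tens, map_add, hg, hg, hg, ι_tens, map_smul]
      · intro a b ha hb
        rw [smul_add, map_add, ha, hb, map_add, smul_add]
    intro u t
    have hu : u ∈ S := (adjoin_eq_top S (hι _) (hι _) (hι _)) ▸ Algebra.mem_top
    exact hu t

theorem blockProperty_of_injective {lam : ℂ} (X : ModuleCat.{0} U) {N : Type} [AddCommGroup N]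
    [Module ℂ N] [Module U N] [IsScalarTower ℂ U N] (f : X →ₗ[U] N) (hf : Function.Injective f)
    (h : ⨆ c : ℂ, weightSpace N c = ⊤) (hnil : ∀ m : N, ∃ k : ℕ, E ^ k • m = 0)
    (hfd : ∀ c : ℂ, FiniteDimensional ℂ (weightSpace N c))
    (hP : HighestWeightsIn (dotOrbit lam) (LinearMap.range f)) : blockProperty lam X :=
  isInBlock_of_injective f hf h hnil hfd hP

theorem blockProperty_blockPart {M : Type} [AddCommGroup M] [Module ℂ M] [Module U M]
    [IsScalarTower ℂ U M] (lam : ℂ) (h : ⨆ c : ℂ, weightSpace M c = ⊤)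
    (hnil : ∀ m : M, ∃ k : ℕ, E ^ k • m = 0)
    (hfd : ∀ c : ℂ, FiniteDimensional ℂ (weightSpace M c)) :
    blockProperty lam (ModuleCat.of U (blockPart M lam)) :=
  blockProperty_of_injective _ (blockPart M lam).subtype Subtype.val_injective h hnil hfd
    (by rw [Submodule.range_subtype]; exact highestWeightsIn_blockPart lam)

/-- The translation functor `T_lam^mu : 𝓞_lam ⥤ 𝓞_mu` for integral weights `lam`, `mu` with
`|mu - lam| = 1`: it assigns to `M` the direct summand of `M ⊗ L(1)` lying in `𝓞_mu`. -/
def translation (lam mu : ℂ) : Block lam ⥤ Block mu where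
  obj M :=
    { obj := ModuleCat.of U (blockPart (TensorV M.obj) mu)
      property :=
        blockProperty_blockPart mu (tensorV_weight M.property.isCatO.weight)
          (tensorV_nil M.property.isCatO.weight M.property.isCatO.nil)
          (tensorV_finite M.property.isCatO.weight M.property.isCatO.finite_weightSpace) }
  map f := ObjectProperty.homMk (ModuleCat.ofHom
    ((tensorMap f.hom.hom).restrict fun _ ht => map_blockPart mu _ ht))
  map_id M := by
    ext ⟨t, ht⟩
    exact LinearMap.congr_fun (LinearMap.rTensor_id (Fin 2 → ℂ) M.obj) t
  map_comp f g := by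
    ext ⟨t, ht⟩
    exact LinearMap.congr_fun (LinearMap.rTensor_comp (Fin 2 → ℂ)
      (g.hom.hom.restrictScalars ℂ) (f.hom.hom.restrictScalars ℂ)) t

/-! ### Shuffling functors -/

/-- The principal block `𝓞₀` of `𝔰𝔩₂`. -/
abbrev O₀ := Block 0

/-- Translation onto the `s`-wall: `-1` is the integral weight whose stabiliser under the dot-action
is `{e, s}`. -/
abbrev ontoWall : O₀ ⥤ Block (-1) := translation 0 (-1)

/-- Translation out of the `s`-wall. -/
abbrev outOfWall : Block (-1) ⥤ O₀ := translation (-1) 0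

instance (lam mu : ℂ) : (translation lam mu).PreservesZeroMorphisms where
  map_zero M N := by
    ext ⟨t, ht⟩
    refine Subtype.ext ?_
    exact LinearMap.congr_fun (LinearMap.rTensor_zero (R := ℂ) (Fin 2 → ℂ)
      (P := N.obj) (N := M.obj)) t

/-- Translation through the `s`-wall, `Θ_s`. -/
abbrev Θ : O₀ ⥤ O₀ := ontoWall ⋙ outOfWall

/-- The shuffling functor, the cokernel of `η : id ⟹ Θ_s`. -/
def shuffling (η : 𝟭 O₀ ⟶ Θ) : O₀ ⥤ O₀ where
  obj M := cokernel (η.app M)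
  map f := cokernel.map _ _ f (Θ.map f) (η.naturality f).symm
  map_id M := by
    rw [← cancel_epi (cokernel.π (η.app M))]
    simp
  map_comp f g := by
    rw [← cancel_epi (cokernel.π (η.app _))]
    simp

/-- The coshuffling functor, the kernel of `ε : Θ_s ⟹ id`. -/
def coshuffling (ε : Θ ⟶ 𝟭 O₀) : O₀ ⥤ O₀ where
  obj M := kernel (ε.app M)
  map f := kernel.map _ _ (Θ.map f) f (ε.naturality f).symm
  map_id M := by
    rw [← cancel_mono (kernel.ι (ε.app M))]
    simp
  map_comp f g := by
    rw [← cancel_mono (kernel.ι (ε.app _))]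
    simp

instance (η : 𝟭 O₀ ⟶ Θ) : (shuffling η).PreservesZeroMorphisms where
  map_zero M N := by
    change cokernel.map (η.app M) (η.app N) 0 (Θ.map 0) (η.naturality 0).symm = 0
    rw [← cancel_epi (cokernel.π (η.app M))]
    simp

instance (ε : Θ ⟶ 𝟭 O₀) : (coshuffling ε).PreservesZeroMorphisms where
  map_zero M N := by
    change kernel.map (ε.app M) (ε.app N) (Θ.map 0) 0 (ε.naturality 0).symm = 0
    rw [← cancel_mono (kernel.ι (ε.app N))]
    simp

/-- `P` is the indecomposable projective object of `𝓞_lam` whose simple quotient is the simple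
module `L(c)` of highest weight `c`. -/
def IsIndecomposableProjective {lam : ℂ} (P : Block lam) (c : ℂ) : Prop :=
  Projective P ∧ Indecomposable P ∧ ∃ (L : Block lam) (p : P ⟶ L), Epi p ∧ Simple L ∧
    ∃ v : L.obj, v ≠ 0 ∧ E • v = 0 ∧ H • v = c • v

end SL2

end

/-! ### Bounded derived categories and derived functors -/

namespace BoundedDerived

noncomputable section

variable (C : Type*) [Category* C] [Abelian C]

/-- Boundedness of cochain complexes. -/
def bounded : ObjectProperty (CochainComplex C ℤ) :=
  fun K => ∃ a b : ℤ, K.IsStrictlyGE a ∧ K.IsStrictlyLE b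

/-- The category `C^b(C)` of bounded cochain complexes. -/
abbrev Cb := (bounded C).FullSubcategory

/-- The class of quasi-isomorphisms between bounded complexes. -/
def quasiIso : MorphismProperty (Cb C) :=
  (HomologicalComplex.quasiIso C (ComplexShape.up ℤ)).inverseImage (bounded C).ι

/-- The bounded derived category: the localization of the category of bounded complexes at the
quasi-isomorphisms. -/
abbrev Db := (quasiIso C).Localization

/-- The localization functor `C^b(C) ⥤ D^b(C)`. -/
abbrev Q : Cb C ⥤ Db C := (quasiIso C).Q

variable {C}

theorem bounded_single (X : C) :
    bounded C ((HomologicalComplex.single C (ComplexShape.up ℤ) 0).obj X) :=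
  ⟨0, 0, inferInstance, inferInstance⟩

/-- An object of an abelian category, as an object of the bounded derived category concentrated
in degree zero. -/
def single (X : C) : Db C := (Q C).obj ⟨_, bounded_single X⟩

/-- The extension of a functor to bounded complexes. -/
def mapCb (G : C ⥤ C) [G.PreservesZeroMorphisms] : Cb C ⥤ Cb C :=
  ObjectProperty.lift _ ((bounded C).ι ⋙ G.mapHomologicalComplex (ComplexShape.up ℤ)) (by
    rintro ⟨K, a, b, ha, hb⟩
    refine ⟨a, b, ?_, ?_⟩
    · change CochainComplex.IsStrictlyGE ((G.mapHomologicalComplex (ComplexShape.up ℤ)).obj K) a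
      infer_instance
    · change CochainComplex.IsStrictlyLE ((G.mapHomologicalComplex (ComplexShape.up ℤ)).obj K) b
      infer_instance)

/-- `LG` is the left derived functor of `G` on the bounded derived category. -/
def IsLeftDerived (G : C ⥤ C) [G.PreservesZeroMorphisms] (LG : Db C ⥤ Db C) : Prop :=
  ∃ α : Q C ⋙ LG ⟶ mapCb G ⋙ Q C, LG.IsLeftDerivedFunctor α (quasiIso C)

/-- `RG` is the right derived functor of `G` on the bounded derived category. -/
def IsRightDerived (G : C ⥤ C) [G.PreservesZeroMorphisms] (RG : Db C ⥤ Db C) : Prop :=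
  ∃ α : mapCb G ⋙ Q C ⟶ Q C ⋙ RG, RG.IsRightDerivedFunctor α (quasiIso C)

open scoped ZeroObject

/-- The kinds of objects that occur in the complexes below. -/
inductive Spot
  | zero
  | e
  | s

/-- The shape of the complexes below, in cohomological grading: the position `-n` carries the
object `e`, and the positions strictly between it and the far side of degree zero carry `s`. For
`n ≥ 0` this is `e, s, …, s` in degrees `-n, …, 0`; for `n ≤ 0` it is `s, …, s, e` in degrees
`0, …, -n`. -/
def spot (n i : ℤ) : Spot :=
  if i = -n then .e else if (-n < i ∧ i ≤ 0) ∨ (0 ≤ i ∧ i < -n) then .s else .zero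

/-- The object placed at a spot. -/
def spotObj (Pe Ps : C) : Spot → C
  | .zero => 0
  | .e => Pe
  | .s => Ps

/-- The differential between two neighbouring spots: `a : Pe ⟶ Ps`, the endomorphism `ab` of `Ps`
(first `b`, then `a`), or `b : Ps ⟶ Pe`. -/
def spotHom {Pe Ps : C} (a : Pe ⟶ Ps) (b : Ps ⟶ Pe) :
    (x y : Spot) → (spotObj Pe Ps x ⟶ spotObj Pe Ps y)
  | .e, .s => a
  | .s, .s => b ≫ a
  | .s, .e => b
  | _, _ => 0

theorem spotHom_comp {Pe Ps : C} (a : Pe ⟶ Ps) (b : Ps ⟶ Pe) (w : a ≫ b = 0) {x y z : Spot}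
    (h : ¬(x = .s ∧ y = .e ∧ z = .s)) : spotHom a b x y ≫ spotHom a b y z = 0 := by
  match x, y, z, h with
  | .zero, y, z, _ => exact (congrArg (· ≫ spotHom a b y z)
      (show spotHom a b .zero y = 0 by cases y <;> rfl)).trans zero_comp
  | x, y, .zero, _ => exact (congrArg (spotHom a b x y ≫ ·)
      (show spotHom a b y .zero = 0 by cases y <;> rfl)).trans comp_zero
  | x, .zero, z, _ => exact (congrArg (spotHom a b x .zero ≫ ·)
      (show spotHom a b .zero z = 0 by cases z <;> rfl)).trans comp_zero
  | .e, .e, z, _ => exact zero_comp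
  | x, .e, .e, _ => exact comp_zero
  | .e, .s, .e, _ => exact w
  | .e, .s, .s, _ =>
    change a ≫ b ≫ a = 0
    rw [← Category.assoc, w, zero_comp]
  | .s, .s, .e, _ =>
    change (b ≫ a) ≫ b = 0
    rw [Category.assoc, w, comp_zero]
  | .s, .s, .s, _ =>
    change (b ≫ a) ≫ b ≫ a = 0
    rw [Category.assoc, ← Category.assoc a, w, zero_comp, comp_zero]
  | .s, .e, .s, h => exact absurd ⟨rfl, rfl, rfl⟩ h

/-- For `n ≥ 0` the complex `{Pe → Ps → ⋯ → Ps}` with `n` copies of `Ps`, the last of them in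
degree zero; for `n ≤ 0` the complex `{Ps → ⋯ → Ps → Pe}` with `-n` copies of `Ps`, the first of
them in degree zero. The differentials are `a`, `b` and, between copies of `Ps`, `ab`. -/
def stringComplex {Pe Ps : C} (a : Pe ⟶ Ps) (b : Ps ⟶ Pe) (w : a ≫ b = 0) (n : ℤ) :
    CochainComplex C ℤ where
  X i := spotObj Pe Ps (spot n i)
  d i j := if i + 1 = j then spotHom a b (spot n i) (spot n j) else 0
  shape i j h := if_neg h
  d_comp_d' i j k hij hjk := by
    have hij' : i + 1 = j := hij
    have hjk' : j + 1 = k := hjk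
    rw [if_pos hij', if_pos hjk']
    refine spotHom_comp a b w ?_
    rintro ⟨h1, h2, h3⟩
    simp only [spot] at h1 h2 h3
    grind

theorem bounded_stringComplex {Pe Ps : C} (a : Pe ⟶ Ps) (b : Ps ⟶ Pe) (w : a ≫ b = 0) (n : ℤ) :
    bounded C (stringComplex a b w n) := by
  have hz : ∀ i, spot n i = .zero → IsZero ((stringComplex a b w n).X i) := fun i hi => by
    change IsZero (spotObj Pe Ps (spot n i))
    rw [hi]
    exact isZero_zero C
  refine ⟨-|n|, |n|, ?_, ?_⟩
  · rw [CochainComplex.isStrictlyGE_iff]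
    intro i hi
    refine hz i ?_
    have := neg_abs_le n
    have := le_abs_self n
    rw [spot, if_neg (by omega), if_neg (by omega)]
  · rw [CochainComplex.isStrictlyLE_iff]
    intro i hi
    refine hz i ?_
    have := neg_abs_le n
    have := le_abs_self n
    rw [spot, if_neg (by omega), if_neg (by omega)]

/-- The string complex as an object of the bounded derived category. -/
def stringObject {Pe Ps : C} (a : Pe ⟶ Ps) (b : Ps ⟶ Pe) (w : a ≫ b = 0) (n : ℤ) : Db C :=
  (Q C).obj ⟨_, bounded_stringComplex a b w n⟩

end

end BoundedDerived

/-! ### Groups of autoequivalences and braid groups -/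

/-- Two autoequivalences are identified if their underlying functors are isomorphic. -/
def autoeqSetoid (D : Type*) [Category* D] : Setoid (D ≌ D) where
  r e e' := Nonempty (e.functor ≅ e'.functor)
  iseqv :=
    { refl := fun _ => ⟨Iso.refl _⟩
      symm := fun ⟨i⟩ => ⟨i.symm⟩
      trans := fun ⟨i⟩ ⟨j⟩ => ⟨i ≪≫ j⟩ }

/-- The group of isomorphism classes of autoequivalences of a category. -/
def Autoeq (D : Type*) [Category* D] := Quotient (autoeqSetoid D)

namespace Autoeq

variable {D : Type*} [Category* D]

/-- The class of an autoequivalence. -/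
def mk (e : D ≌ D) : Autoeq D := Quotient.mk (autoeqSetoid D) e

/-- The product of the classes of `e` and `e'` is the class of the composite `e ∘ e'`. -/
instance : Group (Autoeq D) where
  mul := Quotient.map₂ (fun e e' => CategoryTheory.Equivalence.trans e' e) (by
    rintro a b ⟨i⟩ c d ⟨j⟩
    exact ⟨Functor.isoWhiskerRight j _ ≪≫ Functor.isoWhiskerLeft _ i⟩)
  one := mk CategoryTheory.Equivalence.refl
  inv := Quotient.map CategoryTheory.Equivalence.symm (by
    rintro a b ⟨i⟩
    exact ⟨CategoryTheory.Iso.isoInverseOfIsoFunctor i⟩)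
  mul_assoc := by
    rintro ⟨a⟩ ⟨b⟩ ⟨c⟩
    exact Quotient.sound ⟨Iso.refl _⟩
  one_mul := by
    rintro ⟨a⟩
    exact Quotient.sound ⟨Iso.refl _⟩
  mul_one := by
    rintro ⟨a⟩
    exact Quotient.sound ⟨Iso.refl _⟩
  inv_mul_cancel := by
    rintro ⟨a⟩
    exact Quotient.sound ⟨a.unitIso.symm⟩

/-- The functor `G` belongs to the class `x` of autoequivalences. -/
def Represents (G : D ⥤ D) (x : Autoeq D) : Prop :=
  ∃ e : D ≌ D, mk e = x ∧ Nonempty (e.functor ≅ G)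

end Autoeq

/-- The alternating word `iji⋯` with `m` letters in the free group. -/
def alternatingWord {B : Type*} (i j : B) : ℕ → FreeGroup B
  | 0 => 1
  | m + 1 => FreeGroup.of i * alternatingWord j i m

/-- The braid group of a Coxeter matrix: it has the Coxeter generators, subject to the braid
relations `iji⋯ = jij⋯` with `M i j` letters on both sides. -/
abbrev BraidGroup {B : Type*} (M : CoxeterMatrix B) :=
  PresentedGroup {r : FreeGroup B | ∃ i j : B,
    r = alternatingWord i j (M i j) * (alternatingWord j i (M i j))⁻¹}

/-- The Artin braid group `B_{S₂}` (of type `A₁`). -/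
abbrev BraidA₁ := BraidGroup (CoxeterMatrix.A 1)

/-- The generator of `B_{S₂}`. -/
def braidGen : BraidA₁ := PresentedGroup.of 0

/-! Write T and T' for translation onto and out of the wall, Θ = T'T, η for the unit of T ⊣ T', ε
for the counit of T' ⊣ T, and Sh, Csh for the cokernel of η and the kernel of ε.

The derived functor of Sh is the termwise mapping cone of η. This cone preserves quasi-isomorphisms
because Θ is exact, and it is quasi-isomorphic to Sh wherever η is a monomorphism. Each module M is
functorially a quotient of such a module, namely of the sum of ΘM and the dominant Verma module on
the weight space M₀, and the kernel of this quotient is again such a module. So M has functorial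
two-term resolutions, and the criterion `isRightKanExtension_of_resolution` applies
(`isLeftDerivedFunctor_onDb_unitCone`).

The cone of η is an equivalence because the block on the wall is semisimple with one simple object
X, and TT' doubles multiplicities. Comparing multiplicities shows that TΘM is the sum of two copies
of TM, embedded by T(η) and by the unit of T' ⊣ T at TM (`eq_zero_of_unit_comp`). Hence Θ applied to
the cone of η at M is ΘM, and the cone of ε at the cone of η is M[1]. The dual argument treats the
other order (`nonempty_unitCone_comp_counitCone`, `nonempty_counitCone_comp_unitCone`). Since Sh ⊣
Csh, it is then formal that the inverse equivalence is the right derived functor of Csh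
(`exists_isRightDerivedFunctor_inverse`).

The facts about 𝔰𝔩₂ come from two sources. The Casimir element splits M ⊗ L(1) into blocks, so that
the self-duality of L(1) cuts down to a biadjunction of translation functors. The dimensions of the
weight spaces are additive on short exact sequences, and those at the dot-orbit, which are the
weights 0 and -2 in the principal block, detect isomorphisms. In these terms P(e) is the dominant
Verma module with dimensions (1, 1), and P(s) = T'X has dimensions (1, 2).

For the complexes, Sh P(s) ≅ P(s), while Sh P(e) has dimensions (0, 1) and is the cokernel of a :
P(e) → P(s). Replacing Sh P(e) by this presentation inside the termwise image of the n-th complex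
gives the (n+1)-st complex; the comparison is `stringMap`, and `quasiIso_stringMap` is the point of
the computation. A single step n ↦ n + 1, valid for all integers n, then gives all powers of the
generator. -/

section KanExtensions

/-! ### Derived functors as Kan extensions along a localization. -/

variable {𝒦 D H : Type*} [Category* 𝒦] [Category* D] [Category* H]

/-- A natural transformation `α : L ⋙ LF ⟶ F` is a right Kan extension along the localization
functor `L` as soon as there are functorial resolutions on which `α` is an isomorphism. -/
theorem isRightKanExtension_of_resolution {L : 𝒦 ⥤ D} (W : MorphismProperty 𝒦)
    [L.IsLocalization W] {F : 𝒦 ⥤ H} {LF : D ⥤ H} (α : L ⋙ LF ⟶ F) (R : 𝒦 ⥤ 𝒦) (r : R ⟶ 𝟭 𝒦)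
    (hr : ∀ X, IsIso (L.map (r.app X))) (hα : ∀ X, IsIso (α.app (R.obj X))) :
    LF.IsRightKanExtension α := by
  -- Transformations out of a functor on `D` are determined on the objects `L.obj X`, and, since `r`
  -- becomes invertible, on resolutions. There `α` is an isomorphism and can be cancelled.
  have ext_of : ∀ {G : D ⥤ H} (γ₁ γ₂ : G ⟶ LF),
      Functor.whiskerLeft L γ₁ ≫ α = Functor.whiskerLeft L γ₂ ≫ α → γ₁ = γ₂ := by
    intro G γ₁ γ₂ h
    refine Localization.natTrans_ext L W fun X => ?_
    have h1 := congr_app h (R.obj X)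
    simp only [NatTrans.comp_app, Functor.whiskerLeft_app] at h1
    have h2 := (cancel_mono _).1 h1
    rw [← cancel_epi (G.map (L.map (r.app X)))]
    simp only [Functor.id_obj, NatTrans.naturality]
    rw [h2]
  have lift : ∀ (G : D ⥤ H) (β : L ⋙ G ⟶ F), ∃ γ : G ⟶ LF, Functor.whiskerLeft L γ ≫ α = β := by
    intro G β
    -- The lift is forced: on a resolution it must be `β` followed by the inverse of `α`, and `r`
    -- transports this to every object.
    let γ' : L ⋙ G ⟶ L ⋙ LF :=
      { app := fun X => inv (G.map (L.map (r.app X))) ≫ β.app (R.obj X) ≫ inv (α.app (R.obj X)) ≫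
          LF.map (L.map (r.app X))
        naturality := fun X Y f => by
          have h1 : G.map (L.map f) ≫ inv (G.map (L.map (r.app Y)))
              = inv (G.map (L.map (r.app X))) ≫ G.map (L.map (R.map f)) := by
            rw [IsIso.comp_inv_eq, Category.assoc, IsIso.eq_inv_comp, ← G.map_comp, ← G.map_comp,
              ← L.map_comp, ← L.map_comp, r.naturality]
            rfl
          have h2 : inv (α.app (R.obj X)) ≫ LF.map (L.map (R.map f))
              = F.map (R.map f) ≫ inv (α.app (R.obj Y)) := by
            rw [IsIso.eq_comp_inv, Category.assoc, IsIso.inv_comp_eq]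
            exact α.naturality (R.map f)
          have h3 := β.naturality (R.map f)
          simp only [Functor.comp_map] at h3 ⊢
          rw [← Category.assoc, h1]
          simp only [Category.assoc]
          rw [reassoc_of% h3, ← reassoc_of% h2, ← LF.map_comp, ← LF.map_comp, ← L.map_comp,
            ← L.map_comp, r.naturality]
          rfl }
    refine ⟨Localization.liftNatTrans L W (L ⋙ G) (L ⋙ LF) G LF γ', ?_⟩
    ext X
    have h1 := α.naturality (r.app X)
    have h2 := β.naturality (r.app X)
    simp only [Functor.comp_map, Functor.id_obj] at h1 h2
    simp only [NatTrans.comp_app, Functor.whiskerLeft_app, Localization.liftNatTrans_app,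
      Localization.Lifting.iso, γ']
    simp [h1, ← h2]
  refine ⟨⟨IsTerminal.ofUniqueHom (fun G => CostructuredArrow.homMk (lift _ G.hom).choose
    (lift _ G.hom).choose_spec) fun G m => ?_⟩⟩
  ext1
  exact ext_of _ _ ((CostructuredArrow.w m).trans (lift _ G.hom).choose_spec.symm)

theorem isLeftKanExtension_of_bijective {L : 𝒦 ⥤ D} {F : 𝒦 ⥤ H} {RF : D ⥤ H} (α : F ⟶ L ⋙ RF)
    (hα : ∀ G : D ⥤ H, Function.Bijective
      fun γ : RF ⟶ G => (α ≫ Functor.whiskerLeft L γ : F ⟶ L ⋙ G)) :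
    RF.IsLeftKanExtension α := by
  refine ⟨⟨IsInitial.ofUniqueHom (fun G => StructuredArrow.homMk ((hα _).2 G.hom).choose
    ((hα _).2 G.hom).choose_spec) fun G m => ?_⟩⟩
  ext1
  exact (hα _).1 ((StructuredArrow.w m).trans ((hα _).2 G.hom).choose_spec.symm)

end KanExtensions

section KanExtensions

variable {𝒦 D : Type*} [Category* 𝒦] [Category* D]

/-- If `F ⊣ G` and the left derived functor of `F` is an equivalence `e`, computed by functorial
resolutions, then the inverse of `e` is the right derived functor of `G`. -/
theorem exists_isRightDerivedFunctor_inverse {L : 𝒦 ⥤ D} (W : MorphismProperty 𝒦)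
    [L.IsLocalization W] {F G : 𝒦 ⥤ 𝒦} (adj : F ⊣ G) (e : D ≌ D) (α : L ⋙ e.functor ⟶ F ⋙ L)
    (R : 𝒦 ⥤ 𝒦) (r : R ⟶ 𝟭 𝒦)
    (hr : ∀ X, IsIso (L.map (r.app X))) (hα : ∀ X, IsIso (α.app (R.obj X))) :
    ∃ β : G ⋙ L ⟶ L ⋙ e.inverse, e.inverse.IsRightDerivedFunctor β W := by
  -- This is the mate of `α` with respect to the equivalence `e` and the adjunction `F ⊣ G`.
  let β : G ⋙ L ⟶ L ⋙ e.inverse :=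
    { app := fun Z => e.unit.app (L.obj (G.obj Z)) ≫
        e.inverse.map (α.app (G.obj Z) ≫ L.map (adj.counit.app Z))
      naturality := fun Y Z f => by
        have h1 := e.unit.naturality (L.map (G.map f))
        have h2 := α.naturality (G.map f)
        have h3 := adj.counit.naturality f
        simp only [Functor.comp_map, Functor.id_map, Functor.id_obj] at h1 h2 h3
        simp only [Functor.comp_map, Category.assoc]
        rw [reassoc_of% h1, ← e.inverse.map_comp, ← e.inverse.map_comp, reassoc_of% h2,
          ← L.map_comp, h3, L.map_comp, Category.assoc] }
  refine ⟨β, ⟨isLeftKanExtension_of_bijective β fun X => ?_⟩⟩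
  -- The universal property of `β` is a chain of three bijections through `𝟭 D ⟶ e.functor ⋙ X` and
  -- `L ⟶ F ⋙ L ⋙ X`. The first one is transposition along the equivalence `e`.
  have b1 : Function.Bijective fun δ : e.inverse ⟶ X =>
      (e.unit ≫ Functor.whiskerLeft e.functor δ : 𝟭 D ⟶ e.functor ⋙ X) := by
    refine Function.bijective_iff_has_inverse.2 ⟨fun θ =>
      { app := fun Y => θ.app (e.inverse.obj Y) ≫ X.map (e.counit.app Y)
        naturality := fun Y Z f => ?_ }, fun δ => ?_, fun θ => ?_⟩
    · have h1 := θ.naturality (e.inverse.map f)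
      simp only [Functor.comp_map, Functor.id_map] at h1
      rw [reassoc_of% h1, Category.assoc, ← X.map_comp, ← X.map_comp]
      congr 2
      exact e.counit.naturality f
    · ext Y
      have h := δ.naturality (e.counit.app Y)
      simp only [Functor.id_obj, Functor.comp_obj] at h
      simp only [NatTrans.comp_app, Functor.whiskerLeft_app, Category.assoc]
      exact (congrArg (e.unit.app (e.inverse.obj Y) ≫ ·) h.symm).trans
        (by rw [← Category.assoc, e.unit_inverse_comp]; exact Category.id_comp _)
    · ext Y
      have h := θ.naturality (e.unit.app Y)
      simp only [Functor.id_obj, Functor.comp_obj, Functor.comp_map, Functor.id_map] at h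
      simp only [NatTrans.comp_app, Functor.whiskerLeft_app]
      rw [← Category.assoc, h, Category.assoc, ← X.map_comp]
      simp
  -- Applying `X` keeps `α` invertible on resolutions, so the resolution criterion shows that
  -- `e.functor ⋙ X` is again a right Kan extension.
  have b2 : Function.Bijective fun θ : 𝟭 D ⟶ e.functor ⋙ X =>
      ({ app := fun Z => θ.app (L.obj Z) ≫ X.map (α.app Z)
         naturality := fun Y Z f => by
          have h1 := θ.naturality (L.map f)
          have h2 := α.naturality f
          simp only [Functor.comp_map, Functor.id_map] at h1 h2 ⊢
          rw [reassoc_of% h1, Category.assoc, ← X.map_comp, ← X.map_comp, h2] } :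
        L ⟶ F ⋙ L ⋙ X) := by
    let α' : L ⋙ e.functor ⋙ X ⟶ F ⋙ L ⋙ X := Functor.whiskerRight α X
    have hα' : ∀ Z, IsIso (α'.app (R.obj Z)) := fun Z => by
      have := hα Z
      change IsIso (X.map (α.app (R.obj Z)))
      infer_instance
    have hk := isRightKanExtension_of_resolution W α' R r hr hα'
    constructor
    · intro θ θ' h
      refine (e.functor ⋙ X).hom_ext_of_isRightKanExtension α' θ θ' ?_
      ext Z
      exact congr_app h Z
    · intro κ
      let κ' : L ⋙ 𝟭 D ⟶ F ⋙ L ⋙ X := κ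
      refine ⟨(e.functor ⋙ X).liftOfIsRightKanExtension α' (𝟭 D) κ', ?_⟩
      ext Z
      exact (e.functor ⋙ X).liftOfIsRightKanExtension_fac_app α' (𝟭 D) κ' Z
  -- Transposition along `F ⊣ G`.
  have b3 : Function.Bijective fun κ : L ⟶ F ⋙ L ⋙ X =>
      ({ app := fun Z => κ.app (G.obj Z) ≫ X.map (L.map (adj.counit.app Z))
         naturality := fun Y Z f => by
          have h1 := κ.naturality (G.map f)
          have h2 := adj.counit.naturality f
          simp only [Functor.comp_map, Functor.id_map] at h1 h2 ⊢
          rw [reassoc_of% h1, Category.assoc, ← X.map_comp, ← X.map_comp, ← L.map_comp,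
            ← L.map_comp, h2] } : G ⋙ L ⟶ L ⋙ X) := by
    refine Function.bijective_iff_has_inverse.2 ⟨fun γ =>
      { app := fun Y => L.map (adj.unit.app Y) ≫ γ.app (F.obj Y)
        naturality := fun Y Z f => ?_ }, fun κ => ?_, fun γ => ?_⟩
    · have h1 := γ.naturality (F.map f)
      have h2 := adj.unit.naturality f
      simp only [Functor.comp_map, Functor.id_map] at h1 h2 ⊢
      rw [← L.map_comp_assoc, h2, L.map_comp_assoc, h1, Category.assoc]
    · ext Y
      have h := κ.naturality (adj.unit.app Y)
      simp only [Functor.id_obj, Functor.comp_obj, Functor.comp_map] at h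
      simp only [← Category.assoc]
      rw [h, Category.assoc, ← X.map_comp, ← L.map_comp]
      simp
    · ext Y
      have h := γ.naturality (adj.counit.app Y)
      simp only [Functor.id_obj, Functor.comp_obj, Functor.comp_map] at h
      simp only [Category.assoc]
      rw [← h, ← L.map_comp_assoc]
      simp
  -- By naturality of `δ`, the composite of the three bijections is whiskering `δ` and precomposing
  -- with `β`.
  refine Eq.mp (congrArg Function.Bijective ?_) (b3.comp (b2.comp b1))
  funext δ
  ext Z
  have h := δ.naturality (α.app (G.obj Z) ≫ L.map (adj.counit.app Z))
  simp only [Function.comp_apply, NatTrans.comp_app, Functor.whiskerLeft_app, Category.assoc, β]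
  rw [← X.map_comp]
  exact congrArg (_ ≫ ·) h.symm

end KanExtensions

/-! ### Functors on complexes that descend to bounded derived categories. -/

namespace BoundedDerived

noncomputable section

variable {C : Type*} [Category* C] [Abelian C]

/-- Functors between categories of complexes that induce functors of bounded derived
categories. -/
structure Descends (F : CochainComplex C ℤ ⥤ CochainComplex C ℤ) : Prop where
  bounded : ∀ K, BoundedDerived.bounded C K → BoundedDerived.bounded C (F.obj K)
  quasiIso : ∀ {K L : CochainComplex C ℤ} (f : K ⟶ L), QuasiIso f → QuasiIso (F.map f)

/-- The restriction of a functor to bounded complexes. -/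
def onCb (F : CochainComplex C ℤ ⥤ CochainComplex C ℤ)
    (hF : ∀ K, bounded C K → bounded C (F.obj K)) : Cb C ⥤ Cb C :=
  ObjectProperty.lift _ ((bounded C).ι ⋙ F) fun K => hF _ K.property

theorem isIso_Q_map {K L : Cb C} (f : K ⟶ L) (hf : QuasiIso f.hom) : IsIso ((Q C).map f) :=
  Localization.inverts (Q C) (quasiIso C) f hf

theorem isInvertedBy_onCb (F : CochainComplex C ℤ ⥤ CochainComplex C ℤ) (hF : Descends F) :
    (quasiIso C).IsInvertedBy (onCb F hF.bounded ⋙ Q C) :=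
  fun _ _ f hf => isIso_Q_map _ (hF.quasiIso f.hom hf)

/-- The functor induced on the bounded derived category. -/
def onDb (F : CochainComplex C ℤ ⥤ CochainComplex C ℤ) (hF : Descends F) : Db C ⥤ Db C :=
  Localization.lift (onCb F hF.bounded ⋙ Q C) (isInvertedBy_onCb F hF) (Q C)

/-- The functor on the bounded derived category extends the one on complexes. -/
def onDbFac (F : CochainComplex C ℤ ⥤ CochainComplex C ℤ) (hF : Descends F) :
    Q C ⋙ onDb F hF ≅ onCb F hF.bounded ⋙ Q C :=
  Localization.fac _ (isInvertedBy_onCb F hF) _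

theorem nonempty_iso_of_Q {F G : Db C ⥤ Db C} (i : Q C ⋙ F ≅ Q C ⋙ G) : Nonempty (F ≅ G) :=
  ⟨Localization.liftNatIso (Q C) (quasiIso C) (Q C ⋙ F) (Q C ⋙ G) F G i⟩

/-- Natural quasi-isomorphisms become invertible in the localization. A zig-zag of functors on
complexes is turned into an isomorphism of functors on `Db C` by applying this to each of its steps.
-/
theorem nonempty_onDb_iso {F G : CochainComplex C ℤ ⥤ CochainComplex C ℤ} (hF : Descends F)
    (hG : Descends G) (τ : F ⟶ G) (hτ : ∀ K, QuasiIso (τ.app K)) :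
    Nonempty (onDb F hF ≅ onDb G hG) := by
  refine nonempty_iso_of_Q (onDbFac F hF ≪≫ ?_ ≪≫ (onDbFac G hG).symm)
  let t (K : Cb C) : (onCb F hF.bounded).obj K ⟶ (onCb G hG.bounded).obj K :=
    ObjectProperty.homMk (τ.app K.obj)
  have ht (K : Cb C) : IsIso ((Q C).map (t K)) := isIso_Q_map _ (hτ K.obj)
  refine NatIso.ofComponents (fun K => asIso ((Q C).map (t K))) fun {K L} f => ?_
  have h : (onCb F hF.bounded).map f ≫ t L = t K ≫ (onCb G hG.bounded).map f :=
    InducedCategory.hom_ext (τ.naturality f.hom)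
  simp only [Functor.comp_map, asIso_hom, ← Functor.map_comp, h]

theorem Descends.comp {F G : CochainComplex C ℤ ⥤ CochainComplex C ℤ} (hF : Descends F)
    (hG : Descends G) : Descends (F ⋙ G) :=
  ⟨fun _ hK => hG.bounded _ (hF.bounded _ hK), fun _ hf => hG.quasiIso _ (hF.quasiIso _ hf)⟩

theorem Descends.id : Descends (𝟭 (CochainComplex C ℤ)) :=
  ⟨fun _ hK => hK, fun _ hf => hf⟩

theorem nonempty_onDb_comp {F G : CochainComplex C ℤ ⥤ CochainComplex C ℤ} (hF : Descends F)
    (hG : Descends G) : Nonempty (onDb (F ⋙ G) (hF.comp hG) ≅ onDb F hF ⋙ onDb G hG) :=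
  nonempty_iso_of_Q (onDbFac _ _ ≪≫
    (Functor.isoWhiskerLeft (onCb F hF.bounded) (onDbFac G hG)).symm ≪≫
    Functor.isoWhiskerRight (onDbFac F hF).symm (onDb G hG))

theorem nonempty_onDb_id : Nonempty (onDb (𝟭 (CochainComplex C ℤ)) .id ≅ 𝟭 (Db C)) :=
  nonempty_iso_of_Q (onDbFac _ _)

/-- A functor with quasi-inverses on both sides, up to a zig-zag, is an equivalence. -/
theorem isEquivalence_of_comp {A : Type*} [Category* A] {F G S : A ⥤ A} [S.IsEquivalence]
    (h₁ : Nonempty (F ⋙ G ≅ S)) (h₂ : Nonempty (G ⋙ F ≅ S)) : F.IsEquivalence := by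
  obtain ⟨i⟩ := h₁
  obtain ⟨j⟩ := h₂
  have e₁ : (F ⋙ G).IsEquivalence := Functor.isEquivalence_of_iso i.symm
  have e₂ : (G ⋙ F).IsEquivalence := Functor.isEquivalence_of_iso j.symm
  have f₁ : F.Faithful := Functor.Faithful.of_comp F G
  have f₂ : G.Faithful := Functor.Faithful.of_comp G F
  -- Fullness of `F` needs `G` to be faithful, which comes from the composite in the other order.
  have : F.Full := Functor.Full.of_comp_faithful F G
  have : F.EssSurj := ⟨fun Y => ⟨G.obj ((G ⋙ F).objPreimage Y),
    ⟨(G ⋙ F).objObjPreimageIso Y⟩⟩⟩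
  exact { }

end

end BoundedDerived

/-! ### Mapping cones of natural transformations. -/

namespace CochainComplex

variable {C : Type*} [Category* C] [Abelian C]

/-- In the derived category the cones complete distinguished triangles, and the five lemma for
triangles applies. The unbounded derived category serves only as a tool for testing
quasi-isomorphisms. -/
theorem quasiIso_mappingCone_map {K₁ L₁ K₂ L₂ : CochainComplex C ℤ} (φ₁ : K₁ ⟶ L₁) (φ₂ : K₂ ⟶ L₂)
    (a : K₁ ⟶ K₂) (b : L₁ ⟶ L₂) (comm : φ₁ ≫ b = a ≫ φ₂) (ha : QuasiIso a) (hb : QuasiIso b) :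
    QuasiIso (mappingCone.map φ₁ φ₂ a b comm) := by
  let := HasDerivedCategory.standard C
  rw [← DerivedCategory.isIso_Q_map_iff_quasiIso] at ha hb ⊢
  exact Pretriangulated.isIso₃_of_isIso₁₂
    (DerivedCategory.Q.mapTriangle.map (mappingCone.triangleMap φ₁ φ₂ a b comm))
    (DerivedCategory.mappingCone_triangle_distinguished φ₁)
    (DerivedCategory.mappingCone_triangle_distinguished φ₂) ha hb

theorem bounded_mappingCone {K L : CochainComplex C ℤ} (φ : K ⟶ L)
    (hK : BoundedDerived.bounded C K) (hL : BoundedDerived.bounded C L) :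
    BoundedDerived.bounded C (mappingCone φ) := by
  obtain ⟨a, b, ha, hb⟩ := hK
  obtain ⟨a', b', ha', hb'⟩ := hL
  rw [CochainComplex.isStrictlyGE_iff] at ha ha'
  rw [CochainComplex.isStrictlyLE_iff] at hb hb'
  refine ⟨min (a - 1) a', max b b', ?_, ?_⟩
  · rw [CochainComplex.isStrictlyGE_iff]
    exact fun i hi => (mappingCone.isZero_X_iff φ i).2 ⟨ha _ (by lia), ha' _ (by lia)⟩
  · rw [CochainComplex.isStrictlyLE_iff]
    exact fun i hi => (mappingCone.isZero_X_iff φ i).2 ⟨hb _ (by lia), hb' _ (by lia)⟩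

end CochainComplex

namespace BoundedDerived

open CochainComplex hiding shiftFunctor

noncomputable section

variable {C : Type*} [Category* C] [Abelian C] {𝒦 : Type*} [Category* 𝒦]

/-- The mapping cone of a natural transformation between functors to complexes. -/
def coneFunctor {F G : 𝒦 ⥤ CochainComplex C ℤ} (τ : F ⟶ G) : 𝒦 ⥤ CochainComplex C ℤ where
  obj K := mappingCone (τ.app K)
  map f := mappingCone.map _ _ (F.map f) (G.map f) (τ.naturality f).symm
  map_id K := by
    refine Eq.trans ?_ (mappingCone.map_id _)
    congr 1 <;> exact CategoryTheory.Functor.map_id _ _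
  map_comp f g := by
    refine Eq.trans ?_ (mappingCone.map_comp _ _ _ _ _ (τ.naturality f).symm _ _
      (τ.naturality g).symm)
    congr 1 <;> exact CategoryTheory.Functor.map_comp _ _ _

/-- The inclusion of the target in the mapping cone. -/
def coneInr {F G : 𝒦 ⥤ CochainComplex C ℤ} (τ : F ⟶ G) : G ⟶ coneFunctor τ where
  app K := mappingCone.inr (τ.app K)
  naturality K L f := by
    simp [coneFunctor, mappingCone.map]

/-- The connecting morphism from the mapping cone to the shifted source. -/
def coneδ {F G : 𝒦 ⥤ CochainComplex C ℤ} (τ : F ⟶ G) :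
    coneFunctor τ ⟶ F ⋙ shiftFunctor (CochainComplex C ℤ) (1 : ℤ) where
  app K := (mappingCone.triangle (τ.app K)).mor₃
  naturality K L f := (mappingCone.triangleMap (τ.app K) (τ.app L) (F.map f) (G.map f)
    (τ.naturality f).symm).comm₃.symm

/-- The morphism of mapping cones induced by a commutative square. -/
def coneMap {F G F' G' : 𝒦 ⥤ CochainComplex C ℤ} (τ : F ⟶ G) (τ' : F' ⟶ G') (α : F ⟶ F')
    (β : G ⟶ G') (w : τ ≫ β = α ≫ τ') : coneFunctor τ ⟶ coneFunctor τ' where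
  app K := mappingCone.map _ _ (α.app K) (β.app K) (congr_app w K)
  naturality K L f := by
    refine (mappingCone.map_comp _ _ _ _ _ (τ.naturality f).symm _ _ (congr_app w L)).symm.trans
      (Eq.trans ?_ (mappingCone.map_comp _ _ _ _ _ (congr_app w K) _ _ (τ'.naturality f).symm))
    congr 1 <;> exact NatTrans.naturality _ _

theorem quasiIso_coneMap_app {F G F' G' : 𝒦 ⥤ CochainComplex C ℤ} (τ : F ⟶ G) (τ' : F' ⟶ G')
    (α : F ⟶ F') (β : G ⟶ G') (w : τ ≫ β = α ≫ τ') (K : 𝒦) (hα : QuasiIso (α.app K))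
    (hβ : QuasiIso (β.app K)) : QuasiIso ((coneMap τ τ' α β w).app K) :=
  quasiIso_mappingCone_map _ _ _ _ (congr_app w K) hα hβ

/-- The morphism from the mapping cone to a functor receiving the cokernel. -/
def coneDesc {F G H : 𝒦 ⥤ CochainComplex C ℤ} (τ : F ⟶ G) (π : G ⟶ H) (w : τ ≫ π = 0) :
    coneFunctor τ ⟶ H where
  app K := mappingCone.descShortComplex (ShortComplex.mk (τ.app K) (π.app K) (congr_app w K))
  naturality K L f := mappingCone.map_descShortComplex
    (ShortComplex.mk (τ.app K) (π.app K) (congr_app w K))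
    (ShortComplex.mk (τ.app L) (π.app L) (congr_app w L))
    { τ₁ := F.map f, τ₂ := G.map f, τ₃ := H.map f }

theorem quasiIso_coneDesc_app {F G H : 𝒦 ⥤ CochainComplex C ℤ} (τ : F ⟶ G) (π : G ⟶ H)
    (w : τ ≫ π = 0) (K : 𝒦)
    (h : ∀ i, (ShortComplex.mk ((τ.app K).f i) ((π.app K).f i)
      (by rw [← HomologicalComplex.comp_f, ← NatTrans.comp_app, w]; rfl)).ShortExact) :
    QuasiIso ((coneDesc τ π w).app K) :=
  mappingCone.quasiIso_descShortComplex
    (HomologicalComplex.shortExact_of_degreewise_shortExact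
      (ShortComplex.mk (τ.app K) (π.app K) (congr_app w K)) h)

theorem coneInr_coneδ {F G : 𝒦 ⥤ CochainComplex C ℤ} (τ : F ⟶ G) : coneInr τ ≫ coneδ τ = 0 := by
  ext1; ext1 K
  exact mappingCone.inr_triangleδ (τ.app K)

/-- Rotation of the cone triangle: the cone of the inclusion of the target is homotopy equivalent to
the shifted source. -/
theorem quasiIso_coneDesc_coneδ_app {F G : 𝒦 ⥤ CochainComplex C ℤ} (τ : F ⟶ G) (K : 𝒦) :
    QuasiIso ((coneDesc (coneInr τ) (coneδ τ) (coneInr_coneδ τ)).app K) :=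
  inferInstanceAs (QuasiIso (mappingCone.rotateHomotopyEquiv (τ.app K)).inv)

theorem descends_coneFunctor {F G : CochainComplex C ℤ ⥤ CochainComplex C ℤ} (τ : F ⟶ G)
    (hF : Descends F) (hG : Descends G) :
    Descends (coneFunctor τ) :=
  ⟨fun _ hK => bounded_mappingCone _ (hF.bounded _ hK) (hG.bounded _ hK),
    fun f hf => quasiIso_mappingCone_map _ _ _ _ (τ.naturality f).symm (hF.quasiIso _ hf)
      (hG.quasiIso _ hf)⟩

theorem descends_shift (n : ℤ) : Descends (shiftFunctor (CochainComplex C ℤ) n) := by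
  refine ⟨?_, fun f hf => ?_⟩
  · rintro K ⟨a, b, ha, hb⟩
    rw [CochainComplex.isStrictlyGE_iff] at ha
    rw [CochainComplex.isStrictlyLE_iff] at hb
    refine ⟨a - n, b - n, ?_, ?_⟩
    · rw [CochainComplex.isStrictlyGE_iff]
      exact fun i hi => ha _ (by lia)
    · rw [CochainComplex.isStrictlyLE_iff]
      exact fun i hi => hb _ (by lia)
  · exact (quasiIso_shift_iff f n).2 hf

/-- The composites of the cones of unit and counit will be shifts and not identities. Invertibility
of the shift is what turns them into equivalences. -/
theorem isEquivalence_onDb_shift :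
    (onDb (shiftFunctor (CochainComplex C ℤ) (1 : ℤ))
      (descends_shift 1)).IsEquivalence := by
  have key : ∀ n m : ℤ, n + m = 0 → Nonempty
      (onDb (shiftFunctor (CochainComplex C ℤ) n) (descends_shift n) ⋙
        onDb (shiftFunctor (CochainComplex C ℤ) m) (descends_shift m) ≅ 𝟭 _) := by
    intro n m h
    obtain ⟨i⟩ := nonempty_onDb_comp (descends_shift (C := C) n)
      (descends_shift (C := C) m)
    obtain ⟨j⟩ := nonempty_onDb_iso
      ((descends_shift n).comp (descends_shift m)) Descends.id
      (shiftFunctorCompIsoId (CochainComplex C ℤ) n m h).hom (fun K => inferInstance)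
    obtain ⟨k⟩ := nonempty_onDb_id (C := C)
    exact ⟨i.symm ≪≫ j ≪≫ k⟩
  exact isEquivalence_of_comp (key 1 (-1) (by simp)) (key (-1) 1 (by simp))

end

end BoundedDerived

/-! ### The cones of the unit and of the counit are inverse up to a shift. -/

namespace BoundedDerived

open CochainComplex hiding shiftFunctor

noncomputable section

variable {C : Type*} [Category* C] [Abelian C]

-- Rotating `h₂` gives a second triangle that starts with `g`, so an isomorphism `c` identifies `W`
-- with `X⟦1⟧` and `h` is `-c ≫ i⟦1⟧'`. The retraction `ρ` cancels `i` and leaves `-c`.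
open Pretriangulated in
theorem isIso_connecting_comp_shift {A : Type*} [Category* A] [HasZeroObject A] [HasShift A ℤ]
    [Preadditive A] [∀ n : ℤ, (CategoryTheory.shiftFunctor A n).Additive] [Pretriangulated A]
    {X Y Z W : A} {i : X ⟶ Y} {g : Y ⟶ Z} {δ : Z ⟶ X⟦(1 : ℤ)⟧} {u : Z ⟶ W} {h : W ⟶ Y⟦(1 : ℤ)⟧}
    (h₁ : Triangle.mk g u h ∈ distTriang A) (h₂ : Triangle.mk i g δ ∈ distTriang A)
    (ρ : Y ⟶ X) (hρ : i ≫ ρ = 𝟙 _) : IsIso (h ≫ ρ⟦(1 : ℤ)⟧') := by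
  have h₂' : Triangle.mk g δ (-i⟦(1 : ℤ)⟧') ∈ distTriang A := rot_of_distTriang _ h₂
  obtain ⟨c, hc₁, hc₂⟩ : ∃ c : W ⟶ X⟦(1 : ℤ)⟧, u ≫ c = 𝟙 Z ≫ δ ∧
      h ≫ (𝟙 Y)⟦(1 : ℤ)⟧' = c ≫ (-i⟦(1 : ℤ)⟧') :=
    complete_distinguished_triangle_morphism _ _ h₁ h₂' (𝟙 Y) (𝟙 Z)
      ((Category.comp_id _).trans (Category.id_comp _).symm)
  let φ : Triangle.mk g u h ⟶ Triangle.mk g δ (-i⟦(1 : ℤ)⟧') :=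
    { hom₁ := 𝟙 Y, hom₂ := 𝟙 Z, hom₃ := c
      comm₁ := (Category.comp_id _).trans (Category.id_comp _).symm
      comm₂ := hc₁
      comm₃ := hc₂ }
  have hc : IsIso c := isIso₃_of_isIso₁₂ φ h₁ h₂' (inferInstanceAs (IsIso (𝟙 Y)))
    (inferInstanceAs (IsIso (𝟙 Z)))
  have h₃ : h = -c ≫ i⟦(1 : ℤ)⟧' := by
    rwa [CategoryTheory.Functor.map_id, Category.comp_id, Preadditive.comp_neg] at hc₂
  have h₄ : h ≫ ρ⟦(1 : ℤ)⟧' = -c := by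
    rw [h₃, Preadditive.neg_comp, Category.assoc, ← Functor.map_comp, hρ,
      CategoryTheory.Functor.map_id,
      Category.comp_id]
  rw [h₄]
  exact ⟨-inv c, by simp, by simp⟩

/-- The previous statement in the derived category, for the triangle of the short exact sequence. It
identifies the cone of `g` with the shift of its kernel `X`, through a map that is visible on
complexes. -/
theorem quasiIso_connecting_comp_shift {X Y Z : CochainComplex C ℤ} {i : X ⟶ Y} {g : Y ⟶ Z}
    {w : i ≫ g = 0} (hS : (ShortComplex.mk i g w).ShortExact) (ρ : Y ⟶ X) (hρ : i ≫ ρ = 𝟙 _) :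
    QuasiIso ((mappingCone.triangle g).mor₃ ≫ ρ⟦(1 : ℤ)⟧') := by
  let := HasDerivedCategory.standard C
  rw [← DerivedCategory.isIso_Q_map_iff_quasiIso]
  have h₁ := DerivedCategory.mappingCone_triangle_distinguished g
  have h₂ := DerivedCategory.triangleOfSES_distinguished hS
  have hρ' : DerivedCategory.Q.map i ≫ DerivedCategory.Q.map ρ = 𝟙 _ := by
    rw [← Functor.map_comp, hρ, CategoryTheory.Functor.map_id]
  have h₃ := isIso_connecting_comp_shift h₁ h₂ (DerivedCategory.Q.map ρ) hρ'
  have h₄ := (DerivedCategory.Q.commShiftIso (1 : ℤ)).hom.naturality ρ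
  rw [Category.assoc] at h₃
  have h₅ : (DerivedCategory.Q.commShiftIso (1 : ℤ)).hom.app Y ≫ (DerivedCategory.Q.map ρ)⟦(1 : ℤ)⟧'
    = DerivedCategory.Q.map (ρ⟦(1 : ℤ)⟧') ≫ (DerivedCategory.Q.commShiftIso (1 : ℤ)).hom.app X :=
    h₄.symm
  have h₆ : IsIso ((DerivedCategory.Q.map (mappingCone.triangle g).mor₃ ≫
      DerivedCategory.Q.map (ρ⟦(1 : ℤ)⟧')) ≫
        (DerivedCategory.Q.commShiftIso (1 : ℤ)).hom.app X) := by
    rw [Category.assoc]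
    exact (congrArg (fun t => IsIso (DerivedCategory.Q.map (mappingCone.triangle g).mor₃ ≫ t))
      h₅).mp h₃
  rw [Functor.map_comp]
  exact IsIso.of_isIso_comp_right _ ((DerivedCategory.Q.commShiftIso (1 : ℤ)).hom.app X)

/-- The extension of a functor to complexes. -/
abbrev mapE (G : C ⥤ C) [G.PreservesZeroMorphisms] :
    CochainComplex C ℤ ⥤ CochainComplex C ℤ :=
  G.mapHomologicalComplex (ComplexShape.up ℤ)

variable {Θ : C ⥤ C} [Θ.Additive]

theorem descends_mapE [Θ.PreservesHomology] : Descends (mapE Θ) :=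
  ⟨fun K hK => ((mapCb Θ).obj ⟨K, hK⟩).property,
    fun f _ => HomologicalComplex.quasiIso_map_of_preservesHomology f Θ⟩

/-- The extension of a coaugmentation to complexes. -/
@[simps]
def unitE {G : C ⥤ C} [G.PreservesZeroMorphisms] (η : 𝟭 C ⟶ G) :
    𝟭 (CochainComplex C ℤ) ⟶ mapE G where
  app K :=
    { f := fun i => η.app (K.X i)
      comm' := fun i j _ => (η.naturality (K.d i j)).symm }
  naturality K L f := by
    ext i
    exact η.naturality (f.f i)

/-- The extension of an augmentation to complexes. -/
@[simps]
def counitE {G : C ⥤ C} [G.PreservesZeroMorphisms] (ε : G ⟶ 𝟭 C) :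
    mapE G ⟶ 𝟭 (CochainComplex C ℤ) where
  app K :=
    { f := fun i => ε.app (K.X i)
      comm' := fun i j _ => (ε.naturality (K.d i j)).symm }
  naturality K L f := by
    ext i
    exact ε.naturality (f.f i)

/-- The extension of a natural transformation `Θ ⟶ Θ ⋙ Θ` to complexes. -/
@[simps]
def comulE (σ : Θ ⟶ Θ ⋙ Θ) : mapE Θ ⟶ mapE Θ ⋙ mapE Θ where
  app K :=
    { f := fun i => σ.app (K.X i)
      comm' := fun i j _ => (σ.naturality (K.d i j)).symm }
  naturality K L f := by
    ext i
    exact σ.naturality (f.f i)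

/-- The extension of a natural transformation `Θ ⋙ Θ ⟶ Θ` to complexes. -/
@[simps]
def mulE (ρ : Θ ⋙ Θ ⟶ Θ) : mapE Θ ⋙ mapE Θ ⟶ mapE Θ where
  app K :=
    { f := fun i => ρ.app (K.X i)
      comm' := fun i j _ => (ρ.naturality (K.d i j)).symm }
  naturality K L f := by
    ext i
    exact ρ.naturality (f.f i)

/-- The functor sending a complex to the cone of the coaugmentation. -/
abbrev unitCone (η : 𝟭 C ⟶ Θ) : CochainComplex C ℤ ⥤ CochainComplex C ℤ := coneFunctor (unitE η)

/-- The functor sending a complex to the cone of the augmentation. -/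
abbrev counitCone (ε : Θ ⟶ 𝟭 C) : CochainComplex C ℤ ⥤ CochainComplex C ℤ :=
  coneFunctor (counitE ε)

theorem descends_unitCone [Θ.PreservesHomology] (η : 𝟭 C ⟶ Θ) : Descends (unitCone η) :=
  descends_coneFunctor _ .id descends_mapE

theorem descends_counitCone [Θ.PreservesHomology] (ε : Θ ⟶ 𝟭 C) : Descends (counitCone ε) :=
  descends_coneFunctor _ descends_mapE .id

/-- `Θ` commutes with cones, and the cone of the degreewise monomorphism `Θ(φ)` is quasi-isomorphic
to its cokernel `Z`. In these terms the inclusion of `Θ(L)` becomes `q`, so the map in question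
becomes the isomorphism `σ ≫ q`. -/
theorem quasiIso_comp_map_inr {K L Y Z : CochainComplex C ℤ} (φ : K ⟶ L)
    (σ : Y ⟶ (mapE Θ).obj L) (q : (mapE Θ).obj L ⟶ Z) (w : (mapE Θ).map φ ≫ q = 0)
    (hS : ∀ i, (ShortComplex.mk (((mapE Θ).map φ).f i) (q.f i)
      (by rw [← HomologicalComplex.comp_f, w]; rfl)).ShortExact) (hσ : IsIso (σ ≫ q)) :
    QuasiIso (σ ≫ (mapE Θ).map (mappingCone.inr φ)) := by
  let S : ShortComplex (CochainComplex C ℤ) := ShortComplex.mk ((mapE Θ).map φ) q w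
  have h₁ : QuasiIso (mappingCone.descShortComplex S) := mappingCone.quasiIso_descShortComplex
    (HomologicalComplex.shortExact_of_degreewise_shortExact S hS)
  have h₂ : (mapE Θ).map (mappingCone.inr φ) ≫ (mappingCone.mapHomologicalComplexIso φ Θ).hom ≫
      mappingCone.descShortComplex S = q := by
    rw [← Category.assoc, mappingCone.map_inr]
    exact mappingCone.inr_descShortComplex S
  have h₃ : QuasiIso ((σ ≫ (mapE Θ).map (mappingCone.inr φ)) ≫
      (mappingCone.mapHomologicalComplexIso φ Θ).hom ≫ mappingCone.descShortComplex S) := by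
    rw [Category.assoc, h₂]
    infer_instance
  exact quasiIso_of_comp_right _
    ((mappingCone.mapHomologicalComplexIso φ Θ).hom ≫ mappingCone.descShortComplex S)

/-- Let C be the cone of `η` at K. The section `σ` followed by the inclusion identifies ΘK with ΘC
up to quasi-isomorphism. Under this identification `ε` at C becomes the inclusion of ΘK in C, whose
cone is K[1]. -/
theorem nonempty_onDb_unitCone_counitCone [Θ.PreservesHomology] (η : 𝟭 C ⟶ Θ)
    (ε : Θ ⟶ 𝟭 C) (σ : Θ ⟶ Θ ⋙ Θ) (q : Θ ⋙ Θ ⟶ Θ)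
    (hε : ∀ M, σ.app M ≫ ε.app (Θ.obj M) = 𝟙 _)
    (hq : ∀ M, σ.app M ≫ q.app M = 𝟙 _)
    (w : ∀ M, Θ.map (η.app M) ≫ q.app M = 0)
    (hS : ∀ M, (ShortComplex.mk (Θ.map (η.app M)) (q.app M) (w M)).ShortExact) :
    Nonempty (onDb (unitCone η) (descends_unitCone η) ⋙ onDb (counitCone ε) (descends_counitCone ε)
      ≅ onDb (CategoryTheory.shiftFunctor (CochainComplex C ℤ) (1 : ℤ)) (descends_shift 1)) := by
  let j : mapE Θ ⟶ unitCone η ⋙ mapE Θ :=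
    comulE σ ≫ Functor.whiskerRight (coneInr (unitE η)) (mapE Θ)
  have hj : ∀ K, QuasiIso (j.app K) := fun K =>
    quasiIso_comp_map_inr ((unitE η).app K) ((comulE σ).app K) ((mulE q).app K)
      (by ext i; exact w (K.X i)) (fun i => hS (K.X i)) (by
        have h : (comulE σ).app K ≫ (mulE q).app K = 𝟙 _ := by ext i; exact hq (K.X i)
        rw [h]; infer_instance)
  -- By naturality of `ε`, the counit can be moved before the inclusion in the cone, where it
  -- cancels against `σ`.
  have comm : coneInr (unitE η) ≫ 𝟙 (unitCone η)
      = j ≫ (Functor.whiskerLeft (unitCone η) (counitE ε) : unitCone η ⋙ mapE Θ ⟶ unitCone η) := by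
    ext1; ext1 K
    have h₁ := (counitE ε).naturality ((coneInr (unitE η)).app K)
    have h₂ : (comulE σ).app K ≫ (counitE ε).app ((mapE Θ).obj K) = 𝟙 _ := by
      ext i
      exact hε (K.X i)
    have h₃ : (j ≫ (Functor.whiskerLeft (unitCone η) (counitE ε) :
        unitCone η ⋙ mapE Θ ⟶ unitCone η)).app K
        = (comulE σ).app K ≫ (mapE Θ).map ((coneInr (unitE η)).app K) ≫
          (counitE ε).app ((unitCone η).obj K) := Category.assoc _ _ _
    rw [h₃, h₁, reassoc_of% h₂, Category.comp_id]
    rfl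
  let Z := coneFunctor (coneInr (unitE η))
  have hZ : Descends Z := descends_coneFunctor _ descends_mapE (descends_unitCone η)
  obtain ⟨i₁⟩ := nonempty_onDb_iso hZ ((descends_unitCone η).comp (descends_counitCone ε))
    (coneMap (coneInr (unitE η))
      (Functor.whiskerLeft (unitCone η) (counitE ε) : unitCone η ⋙ mapE Θ ⟶ unitCone η)
      j (𝟙 _) comm)
    (fun K => quasiIso_coneMap_app _ _ _ _ _ K (hj K) (inferInstanceAs (QuasiIso (𝟙 _))))
  obtain ⟨i₂⟩ := nonempty_onDb_iso hZ (descends_shift 1)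
    (coneDesc (coneInr (unitE η)) (coneδ (unitE η)) (coneInr_coneδ _))
    (fun K => quasiIso_coneDesc_coneδ_app _ K)
  obtain ⟨i₃⟩ := nonempty_onDb_comp (descends_unitCone η) (descends_counitCone ε)
  exact ⟨i₃.symm ≪≫ i₁.symm ≪≫ i₂⟩

end

end BoundedDerived

namespace BoundedDerived

open CochainComplex hiding shiftFunctor

noncomputable section

variable {C : Type*} [Category* C] [Abelian C]

theorem coneInr_coneDesc {𝒦 : Type*} [Category* 𝒦] {F G H : 𝒦 ⥤ CochainComplex C ℤ} (τ : F ⟶ G)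
    (π : G ⟶ H) (w : τ ≫ π = 0) : coneInr τ ≫ coneDesc τ π w = π := by
  ext1; ext1 K
  exact mappingCone.inr_descShortComplex
    (ShortComplex.mk (τ.app K) (π.app K) (congr_app w K))

variable {Θ : C ⥤ C} [Θ.Additive]

theorem quasiIso_map_connecting_comp {K L Y : CochainComplex C ℤ} (φ : K ⟶ L)
    (i : Y ⟶ (mapE Θ).obj K) (ρ : (mapE Θ).obj K ⟶ Y) (w : i ≫ (mapE Θ).map φ = 0)
    (hS : ∀ n, (ShortComplex.mk (i.f n) (((mapE Θ).map φ).f n)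
      (by rw [← HomologicalComplex.comp_f, w]; rfl)).ShortExact) (hρ : i ≫ ρ = 𝟙 _) :
    QuasiIso ((mapE Θ).map (mappingCone.triangle φ).mor₃ ≫
      ((mapE Θ).commShiftIso (1 : ℤ)).hom.app K ≫ ρ⟦(1 : ℤ)⟧') := by
  have h₁ := quasiIso_connecting_comp_shift (g := (mapE Θ).map φ) (w := w)
    (HomologicalComplex.shortExact_of_degreewise_shortExact _ hS) ρ hρ
  have h₂ := mappingCone.map_δ φ Θ
  have h₃ : (mapE Θ).map (mappingCone.triangle φ).mor₃ ≫
      ((mapE Θ).commShiftIso (1 : ℤ)).hom.app K ≫ ρ⟦(1 : ℤ)⟧'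
      = (mappingCone.mapHomologicalComplexIso φ Θ).hom ≫
        (mappingCone.triangle ((mapE Θ).map φ)).mor₃ ≫ ρ⟦(1 : ℤ)⟧' :=
    ((Category.assoc _ _ _).symm.trans (congrArg (· ≫ ρ⟦(1 : ℤ)⟧') h₂)).trans
      (Category.assoc _ _ _)
  rw [h₃]
  exact quasiIso_comp (hφ' := h₁) (mappingCone.mapHomologicalComplexIso φ Θ).hom _

/-- Let C be the cone of `ε` at K. The connecting map followed by the multiplication `ρ` identifies
ΘC with ΘK[1] up to quasi-isomorphism. Under this identification `η` at C becomes the connecting map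
from C to ΘK[1], whose cone is again K[1]. -/
theorem nonempty_onDb_counitCone_unitCone [Θ.PreservesHomology] (η : 𝟭 C ⟶ Θ)
    (ε : Θ ⟶ 𝟭 C) (ρ : Θ ⋙ Θ ⟶ Θ) (i : Θ ⟶ Θ ⋙ Θ)
    (hη : ∀ M, η.app (Θ.obj M) ≫ ρ.app M = 𝟙 _)
    (hi : ∀ M, i.app M ≫ ρ.app M = 𝟙 _)
    (w : ∀ M, i.app M ≫ Θ.map (ε.app M) = 0)
    (hS : ∀ M, (ShortComplex.mk (i.app M) (Θ.map (ε.app M)) (w M)).ShortExact) :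
    Nonempty (onDb (counitCone ε) (descends_counitCone ε) ⋙ onDb (unitCone η) (descends_unitCone η)
      ≅ onDb (CategoryTheory.shiftFunctor (CochainComplex C ℤ) (1 : ℤ)) (descends_shift 1)) := by
  let sh := CategoryTheory.shiftFunctor (CochainComplex C ℤ) (1 : ℤ)
  let k : counitCone ε ⋙ mapE Θ ⟶ mapE Θ ⋙ sh :=
    Functor.whiskerRight (coneδ (counitE ε)) (mapE Θ) ≫
      Functor.whiskerLeft (mapE Θ) ((mapE Θ).commShiftIso (1 : ℤ)).hom ≫
        Functor.whiskerRight (mulE ρ) sh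
  have hk : ∀ K, QuasiIso (k.app K) := fun K =>
    quasiIso_map_connecting_comp ((counitE ε).app K) ((comulE i).app K) ((mulE ρ).app K)
      (by ext n; exact w (K.X n)) (fun n => hS (K.X n)) (by ext n; exact hi (K.X n))
  have comm : (Functor.whiskerLeft (counitCone ε) (unitE η) :
      counitCone ε ⟶ counitCone ε ⋙ mapE Θ) ≫ k = 𝟙 _ ≫ coneδ (counitE ε) := by
    ext1; ext1 K
    have h₁ := (unitE η).naturality ((coneδ (counitE ε)).app K)
    have h₂ : (unitE η).app (((mapE Θ).obj K)⟦(1 : ℤ)⟧) ≫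
        ((mapE Θ).commShiftIso (1 : ℤ)).hom.app ((mapE Θ).obj K) ≫ ((mulE ρ).app K)⟦(1 : ℤ)⟧'
        = 𝟙 _ := by
      ext n
      exact (congrArg (_ ≫ ·) (Category.id_comp _)).trans (hη (K.X (n + 1)))
    have h₃ : ((Functor.whiskerLeft (counitCone ε) (unitE η) :
        counitCone ε ⟶ counitCone ε ⋙ mapE Θ) ≫ k).app K
        = ((unitE η).app ((counitCone ε).obj K) ≫ (mapE Θ).map ((coneδ (counitE ε)).app K)) ≫
          ((mapE Θ).commShiftIso (1 : ℤ)).hom.app ((mapE Θ).obj K) ≫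
            ((mulE ρ).app K)⟦(1 : ℤ)⟧' := (Category.assoc _ _ _).symm
    rw [h₃, ← h₁, Category.assoc]
    exact (congrArg (_ ≫ ·) h₂).trans
      ((Category.comp_id _).trans (Category.id_comp ((coneδ (counitE ε)).app K)).symm)
  -- The cone of the connecting map is found by two rotations: ΘK[1] is replaced by the cone of the
  -- inclusion of K in C, and the cone of the inclusion of C in that cone is K[1].
  let τ := coneInr (counitE ε)
  let Z₁ := coneFunctor (coneδ (counitE ε))
  have hZ₁ : Descends Z₁ :=
    descends_coneFunctor _ (descends_counitCone ε) (descends_mapE.comp (descends_shift 1))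
  let Z₂ := coneFunctor (coneInr τ)
  have hτ : Descends (coneFunctor τ) := descends_coneFunctor _ .id (descends_counitCone ε)
  have hZ₂ : Descends Z₂ := descends_coneFunctor _ (descends_counitCone ε) hτ
  let d : coneFunctor τ ⟶ mapE Θ ⋙ sh := coneDesc τ (coneδ (counitE ε)) (coneInr_coneδ _)
  obtain ⟨i₁⟩ := nonempty_onDb_iso ((descends_counitCone ε).comp (descends_unitCone η)) hZ₁
    (coneMap (Functor.whiskerLeft (counitCone ε) (unitE η) :
      counitCone ε ⟶ counitCone ε ⋙ mapE Θ) (coneδ (counitE ε)) (𝟙 _) k comm)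
    (fun K => quasiIso_coneMap_app _ _ _ _ _ K (inferInstanceAs (QuasiIso (𝟙 _))) (hk K))
  obtain ⟨i₂⟩ := nonempty_onDb_iso hZ₂ hZ₁
    (coneMap (coneInr τ) (coneδ (counitE ε)) (𝟙 _) d
      ((coneInr_coneDesc _ _ _).trans (Category.id_comp _).symm))
    (fun K => quasiIso_coneMap_app _ _ _ _ _ K (inferInstanceAs (QuasiIso (𝟙 _)))
      (quasiIso_coneDesc_coneδ_app (counitE ε) K))
  obtain ⟨i₃⟩ := nonempty_onDb_iso hZ₂ (descends_shift 1)
    (coneDesc (coneInr τ) (coneδ τ) (coneInr_coneδ _))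
    (fun K => quasiIso_coneDesc_coneδ_app _ K)
  obtain ⟨i₄⟩ := nonempty_onDb_comp (descends_counitCone ε) (descends_unitCone η)
  exact ⟨i₄.symm ≪≫ i₁ ≪≫ i₂.symm ≪≫ i₃⟩

end

end BoundedDerived

/-! ### The derived functor of the cokernel of a coaugmentation. -/

namespace BoundedDerived

open CochainComplex hiding shiftFunctor

noncomputable section

variable {C : Type*} [Category* C] [Abelian C]

/-- The extension of a natural transformation to complexes. -/
@[simps]
def transE {F G : C ⥤ C} [F.PreservesZeroMorphisms] [G.PreservesZeroMorphisms] (τ : F ⟶ G) :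
    mapE F ⟶ mapE G where
  app K :=
    { f := fun i => τ.app (K.X i)
      comm' := fun i j _ => (τ.naturality (K.d i j)).symm }
  naturality K L f := by
    ext i
    exact τ.naturality (f.f i)

/-- The kernel of a natural transformation to the identity. -/
def kernelFunctor {P : C ⥤ C} (p : P ⟶ 𝟭 C) : C ⥤ C where
  obj M := kernel (p.app M)
  map f := kernel.map _ _ (P.map f) f (p.naturality f).symm
  map_id M := by
    rw [← cancel_mono (kernel.ι (p.app M))]
    simp
  map_comp f g := by
    rw [← cancel_mono (kernel.ι (p.app _))]
    simp

/-- The inclusion of the kernel of a natural transformation. -/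
def kernelFunctorι {P : C ⥤ C} (p : P ⟶ 𝟭 C) : kernelFunctor p ⟶ P where
  app M := kernel.ι (p.app M)
  naturality M N f := by simp [kernelFunctor]

instance {P : C ⥤ C} [P.PreservesZeroMorphisms] (p : P ⟶ 𝟭 C) :
    (kernelFunctor p).PreservesZeroMorphisms where
  map_zero M N := by
    change kernel.map (p.app M) (p.app N) (P.map 0) 0 (p.naturality 0).symm = 0
    rw [← cancel_mono (kernel.ι (p.app N))]
    simp

variable {P : C ⥤ C} [P.PreservesZeroMorphisms] (p : P ⟶ 𝟭 C)

/-- Two-term functorial resolutions, as a functor on complexes. -/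
def resolution : CochainComplex C ℤ ⥤ CochainComplex C ℤ := coneFunctor (transE (kernelFunctorι p))

theorem transE_kernelFunctorι_counitE : transE (kernelFunctorι p) ≫ counitE p = 0 := by
  ext K i
  exact kernel.condition (p.app (K.X i))

/-- The augmentation of the functorial resolutions. -/
def resolutionπ : resolution p ⟶ 𝟭 (CochainComplex C ℤ) :=
  coneDesc _ (counitE p) (transE_kernelFunctorι_counitE p)

theorem quasiIso_resolutionπ_app (hp : ∀ M, Epi (p.app M)) (K : CochainComplex C ℤ) :
    QuasiIso ((resolutionπ p).app K) := by
  refine quasiIso_coneDesc_app _ _ _ K fun i => ?_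
  have := hp (K.X i)
  exact { exact := ShortComplex.exact_kernel (p.app (K.X i))
          mono_f := inferInstanceAs (Mono (kernel.ι (p.app (K.X i))))
          epi_g := hp (K.X i) }

theorem bounded_mapE (G : C ⥤ C) [G.PreservesZeroMorphisms] (K : CochainComplex C ℤ)
    (hK : bounded C K) : bounded C ((mapE G).obj K) :=
  ((mapCb G).obj ⟨K, hK⟩).property

theorem bounded_resolution (K : CochainComplex C ℤ) (hK : bounded C K) :
    bounded C ((resolution p).obj K) :=
  bounded_mappingCone _ (bounded_mapE _ K hK) (bounded_mapE _ K hK)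

omit [Abelian C] in
theorem mono_app_of_mono {Θ : C ⥤ C} (η : 𝟭 C ⟶ Θ) {M N : C} (f : M ⟶ N) [Mono f]
    [Mono (η.app N)] : Mono (η.app M) := by
  have h := η.naturality f
  have : Mono (η.app M ≫ Θ.map f) := by
    rw [← h]
    exact mono_comp f (η.app N)
  exact mono_of_mono _ (Θ.map f)

/-- A term of the resolution is a sum of some `P.obj M` and a kernel that embeds in some `P.obj M'`.
By naturality, a map killed by `η` is killed by both projections. -/
theorem mono_app_resolution {Θ : C ⥤ C} (η : 𝟭 C ⟶ Θ) (hη : ∀ M, Mono (η.app (P.obj M)))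
    (K : CochainComplex C ℤ) (i : ℤ) : Mono (η.app (((resolution p).obj K).X i)) := by
  have h₁ (M : C) : Mono (η.app ((kernelFunctor p).obj M)) :=
    have := hη M
    have : Mono ((kernelFunctorι p).app M) := inferInstanceAs (Mono (kernel.ι (p.app M)))
    mono_app_of_mono η ((kernelFunctorι p).app M)
  refine Preadditive.mono_of_cancel_zero _ fun {Z} t ht => ?_
  have h₂ : ∀ {N : C} (_ : Mono (η.app N)) (f : ((resolution p).obj K).X i ⟶ N), t ≫ f = 0 := by
    intro N hN f
    have h₃ := η.naturality f
    rw [← cancel_mono (η.app N), zero_comp, Category.assoc]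
    exact (congrArg (t ≫ ·) h₃).trans
      ((Category.assoc _ _ _).symm.trans ((congrArg (· ≫ Θ.map f) ht).trans zero_comp))
  exact mappingCone.ext_to _ i (i + 1) rfl ((h₂ (h₁ _) _).trans zero_comp.symm)
    ((h₂ (hη _) _).trans zero_comp.symm)

variable {Θ : C ⥤ C} [Θ.Additive] [Θ.PreservesHomology] (η : 𝟭 C ⟶ Θ)
  {Sh : C ⥤ C} [Sh.PreservesZeroMorphisms] (π : Θ ⟶ Sh)

omit [Θ.PreservesHomology] in
theorem unitE_transE (w : ∀ M, η.app M ≫ π.app M = 0) : unitE η ≫ transE π = 0 := by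
  ext K i
  exact w (K.X i)

variable (w : ∀ M, η.app M ≫ π.app M = 0)

/-- The comparison of the cone of `η` with its cokernel. -/
def coneToCoker : onCb (unitCone η) (descends_unitCone η).bounded ⟶ mapCb Sh where
  app K := ObjectProperty.homMk ((coneDesc (unitE η) (transE π) (unitE_transE η π w)).app K.obj)
  naturality _ _ f := InducedCategory.hom_ext
    ((coneDesc (unitE η) (transE π) (unitE_transE η π w)).naturality f.hom)

/-- The comparison of the derived shuffling functor with the shuffling functor. -/
def derivedToCoker : Q C ⋙ onDb (unitCone η) (descends_unitCone η) ⟶ mapCb Sh ⋙ Q C :=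
  (onDbFac _ _).hom ≫ Functor.whiskerRight (coneToCoker η π w) (Q C)

/-- The cone of a degreewise monomorphism is quasi-isomorphic to its cokernel. Complexes with this
property therefore need no resolution, which will allow the complexes of projectives to be shuffled
term by term. -/
theorem isIso_derivedToCoker_app
    (hπ : ∀ M, Mono (η.app M) → (ShortComplex.mk _ _ (w M)).ShortExact) (K : Cb C)
    (hK : ∀ i, Mono (η.app (K.obj.X i))) : IsIso ((derivedToCoker η π w).app K) := by
  have h : QuasiIso ((coneDesc (unitE η) (transE π) (unitE_transE η π w)).app K.obj) :=
    quasiIso_coneDesc_app _ _ _ _ fun i => hπ _ (hK i)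
  have := isIso_Q_map ((coneToCoker η π w).app K) h
  exact inferInstanceAs (IsIso ((onDbFac _ _).hom.app K ≫ (Q C).map ((coneToCoker η π w).app K)))

/-- The functorial resolutions, on bounded complexes. -/
def resolutionCb : Cb C ⥤ Cb C := onCb (resolution p) (bounded_resolution p)

/-- The augmentation of the functorial resolutions, on bounded complexes. -/
def resolutionCbπ : resolutionCb p ⟶ 𝟭 (Cb C) where
  app K := ObjectProperty.homMk ((resolutionπ p).app K.obj)
  naturality _ _ f := InducedCategory.hom_ext ((resolutionπ p).naturality f.hom)

theorem isLeftDerivedFunctor_onDb_unitCone (hp : ∀ M, Epi (p.app M))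
    (hη : ∀ M, Mono (η.app (P.obj M)))
    (hπ : ∀ M, Mono (η.app M) → (ShortComplex.mk _ _ (w M)).ShortExact) :
    (onDb (unitCone η) (descends_unitCone η)).IsLeftDerivedFunctor (derivedToCoker η π w)
      (quasiIso C) :=
  ⟨isRightKanExtension_of_resolution (quasiIso C) _ (resolutionCb p) (resolutionCbπ p)
    (fun K => isIso_Q_map _ (quasiIso_resolutionπ_app p hp K.obj))
    (fun K => isIso_derivedToCoker_app η π w hπ _ fun i => mono_app_resolution p η hη K.obj i)⟩

/-- An adjunction, extended to bounded complexes. -/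
def mapCbAdjunction {F G : C ⥤ C} [F.PreservesZeroMorphisms] [G.PreservesZeroMorphisms]
    (adj : F ⊣ G) : mapCb F ⊣ mapCb G :=
  Adjunction.mkOfUnitCounit
    { unit :=
        { app := fun K => ObjectProperty.homMk
            { f := fun i => adj.unit.app (K.obj.X i)
              comm' := fun i j _ => (adj.unit.naturality (K.obj.d i j)).symm }
          naturality := fun K L f => by
            ext i
            exact adj.unit.naturality (f.hom.f i) }
      counit :=
        { app := fun K => ObjectProperty.homMk
            { f := fun i => adj.counit.app (K.obj.X i)
              comm' := fun i j _ => (adj.counit.naturality (K.obj.d i j)).symm }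
          naturality := fun K L f => by
            ext i
            exact adj.counit.naturality (f.hom.f i) }
      left_triangle := by
        ext K i
        exact (congrArg (_ ≫ ·) (Category.id_comp _)).trans
          (adj.left_triangle_components (K.obj.X i))
      right_triangle := by
        ext K i
        exact (congrArg (_ ≫ ·) (Category.id_comp _)).trans
          (adj.right_triangle_components (K.obj.X i)) }

theorem isRightDerived_inverse (hp : ∀ M, Epi (p.app M))
    (hη : ∀ M, Mono (η.app (P.obj M)))
    (hπ : ∀ M, Mono (η.app M) → (ShortComplex.mk _ _ (w M)).ShortExact)
    {Csh : C ⥤ C} [Csh.PreservesZeroMorphisms] (adj : Sh ⊣ Csh)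
    [(onDb (unitCone η) (descends_unitCone η)).IsEquivalence] :
    IsRightDerived Csh (onDb (unitCone η) (descends_unitCone η)).asEquivalence.inverse :=
  exists_isRightDerivedFunctor_inverse (quasiIso C) (mapCbAdjunction adj)
    (onDb (unitCone η) (descends_unitCone η)).asEquivalence (derivedToCoker η π w)
    (resolutionCb p) (resolutionCbπ p)
    (fun K => isIso_Q_map _ (quasiIso_resolutionπ_app p hp K.obj))
    (fun K => isIso_derivedToCoker_app η π w hπ _ fun i => mono_app_resolution p η hη K.obj i)

end

end BoundedDerived

/-! ### Biadjoint functors to a semisimple category. -/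

namespace BoundedDerived

noncomputable section

/-- An additive dimension function on an abelian category all of whose objects are built from the
simple object `X`, which is both a generator and a cogenerator. -/
structure IsSemisimpleDim {D : Type*} [Category* D] [Abelian D] (X : D) (d : D → ℕ) : Prop where
  simple : Simple X
  generates (N : D) : (∀ f : X ⟶ N, f = 0) → IsZero N
  cogenerates (N : D) : (∀ f : N ⟶ X, f = 0) → IsZero N
  dim_simple : d X = 1
  dim_biprod (A B : D) : d (A ⊞ B) = d A + d B
  le_of_mono {A B : D} (f : A ⟶ B) : Mono f → d A ≤ d B
  le_of_epi {A B : D} (f : A ⟶ B) : Epi f → d B ≤ d A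
  isIso_of_mono {A B : D} (f : A ⟶ B) : Mono f → d B ≤ d A → IsIso f
  isIso_of_epi {A B : D} (f : A ⟶ B) : Epi f → d B = d A → IsIso f

variable {C D : Type*} [Category* C] [Abelian C] [Category* D] [Abelian D]
  {T : C ⥤ D} {T' : D ⥤ C} (adj : T ⊣ T') (adj' : T' ⊣ T)

include adj adj' in
theorem additive_of_biadjoint : T.Additive :=
  have : PreservesLimitsOfSize.{0, 0} T := adj'.rightAdjoint_preservesLimits
  have := adj.isLeftAdjoint
  have : T.PreservesZeroMorphisms := Functor.preservesZeroMorphisms_of_isLeftAdjoint T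
  Functor.additive_of_preserves_binary_products T

include adj adj' in
theorem preservesHomology_of_biadjoint [T.PreservesZeroMorphisms] : T.PreservesHomology :=
  have : PreservesColimitsOfSize.{0, 0} T := adj.leftAdjoint_preservesColimits
  have : PreservesLimitsOfSize.{0, 0} T := adj'.rightAdjoint_preservesLimits
  inferInstance

instance [T.PreservesZeroMorphisms] [T'.PreservesZeroMorphisms] [T.PreservesHomology]
    [T'.PreservesHomology] : (T ⋙ T').PreservesHomology :=
  Functor.preservesHomology_of_map_exact _ fun _ hS => (hS.map T).map T'

variable {X : D} {d : D → ℕ} (hX : IsSemisimpleDim X d) (hd : ∀ N, d (T.obj (T'.obj N)) = 2 * d N)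
  [T.Additive] [T'.Additive] [T.PreservesHomology] [T'.PreservesHomology]

-- A nonzero `x` is a monomorphism, as `X` is simple. Transposing `h` gives `T'(x) = z ≫ η`, so `z`
-- is a monomorphism; transposing back, `T(z)` is the counit at `X` followed by `x`. Since `T` is
-- exact, the counit `TT'X ⟶ X` would be a monomorphism from dimension two to dimension one.
include hX hd in
theorem eq_zero_of_unit_comp {M : C} (x y : X ⟶ T.obj M)
    (h : x ≫ adj'.unit.app (T.obj M) = y ≫ T.map (adj.unit.app M)) : x = 0 := by
  by_contra hx
  have := hX.simple
  have : Mono x := mono_of_nonzero_from_simple hx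
  let z := T'.map y ≫ adj'.counit.app M
  have hz : T'.map x = z ≫ adj.unit.app M := by
    have h₁ := congrArg (fun t => T'.map t ≫ adj'.counit.app (T'.obj (T.obj M))) h
    simpa [z] using h₁
  have : Mono (z ≫ adj.unit.app M) := hz ▸ inferInstance
  have : Mono z := mono_of_mono z (adj.unit.app M)
  have h₂ : T.map z = adj.counit.app X ≫ x := by
    have h₁ := congrArg (fun t => T.map t ≫ adj.counit.app (T.obj M)) hz
    simpa using h₁.symm
  have : Mono (adj.counit.app X ≫ x) := h₂ ▸ inferInstance
  have h₃ := hX.le_of_mono _ (mono_of_mono (adj.counit.app X) x)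
  have h₄ : d (T.obj (T'.obj X)) = 2 * d X := hd X
  have h₅ := hX.dim_simple
  have h₆ : d (T.obj (T'.obj X)) ≤ d X := h₃
  omega

-- Dual to `eq_zero_of_unit_comp`: a nonzero `x` would make the unit `X ⟶ TT'X` an epimorphism.
include hX hd in
theorem eq_zero_of_comp_counit {M : C} (x y : T.obj M ⟶ X)
    (h : adj.counit.app (T.obj M) ≫ x = T.map (adj'.counit.app M) ≫ y) : x = 0 := by
  by_contra hx
  have := hX.simple
  have : Epi x := epi_of_nonzero_to_simple hx
  let z := adj.unit.app M ≫ T'.map y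
  have hz : T'.map x = adj'.counit.app M ≫ z := by
    have h₁ := congrArg (fun t => adj.unit.app (T'.obj (T.obj M)) ≫ T'.map t) h
    simpa [z] using h₁
  have : Epi (adj'.counit.app M ≫ z) := hz ▸ inferInstance
  have : Epi z := epi_of_epi (adj'.counit.app M) z
  have h₂ : T.map z = x ≫ adj'.unit.app X := by
    have h₁ := congrArg (fun t => adj'.unit.app (T.obj M) ≫ T.map t) hz
    simpa using h₁.symm
  have : Epi (x ≫ adj'.unit.app X) := h₂ ▸ inferInstance
  have h₃ := hX.le_of_epi _ (epi_of_epi x (adj'.unit.app X))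
  have h₄ : d (T.obj (T'.obj X)) = 2 * d X := hd X
  have h₅ := hX.dim_simple
  have h₆ : d (T.obj (T'.obj X)) ≤ d X := h₃
  omega

-- The hypothesis `h` says that the images of `p` and `q` have no common copy of the generator `X`,
-- which kills the kernel. Equality of dimensions does the rest.
omit [T.Additive] [T'.Additive] [T.PreservesHomology] [T'.PreservesHomology] in
include hX in
theorem IsSemisimpleDim.isIso_desc {A B : D} (p q : A ⟶ B) (hp : Mono p)
    (h : ∀ x y : X ⟶ A, x ≫ q = y ≫ p → x = 0) (hAB : d B = 2 * d A) :
    IsIso (biprod.desc p q) := by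
  have hj : Mono (biprod.desc p q) := by
    refine Preadditive.mono_of_isZero_kernel _ (hX.generates _ fun f => ?_)
    have h₀ : (f ≫ kernel.ι (biprod.desc p q) ≫ biprod.fst) ≫ p +
        (f ≫ kernel.ι (biprod.desc p q) ≫ biprod.snd) ≫ q = 0 := by
      have h := congrArg (f ≫ ·) (kernel.condition (biprod.desc p q))
      simpa [biprod.desc_eq] using h
    have h₁ : f ≫ kernel.ι (biprod.desc p q) ≫ biprod.snd = 0 :=
      h _ (-(f ≫ kernel.ι (biprod.desc p q) ≫ biprod.fst)) (by
        rw [Preadditive.neg_comp]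
        exact eq_neg_of_add_eq_zero_right h₀)
    have h₂ : f ≫ kernel.ι (biprod.desc p q) ≫ biprod.fst = 0 := by
      rw [h₁, zero_comp, add_zero] at h₀
      rwa [← cancel_mono p, zero_comp]
    rw [← cancel_mono (kernel.ι (biprod.desc p q))]
    refine biprod.hom_ext _ _ ?_ ?_ <;> simp [h₁, h₂]
  exact hX.isIso_of_mono _ hj (by rw [hX.dim_biprod]; omega)

omit [T.Additive] [T'.Additive] [T.PreservesHomology] [T'.PreservesHomology] in
include hX in
theorem IsSemisimpleDim.isIso_lift {A B : D} (p q : A ⟶ B) (hp : Epi p)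
    (h : ∀ x y : B ⟶ X, q ≫ x = p ≫ y → x = 0) (hAB : d A = 2 * d B) :
    IsIso (biprod.lift p q) := by
  have hj : Epi (biprod.lift p q) := by
    refine Preadditive.epi_of_isZero_cokernel _ (hX.cogenerates _ fun f => ?_)
    have h₀ : p ≫ biprod.inl ≫ cokernel.π (biprod.lift p q) ≫ f +
        q ≫ biprod.inr ≫ cokernel.π (biprod.lift p q) ≫ f = 0 := by
      have h := congrArg (· ≫ f) (cokernel.condition (biprod.lift p q))
      simpa [biprod.lift_eq] using h
    have h₁ : biprod.inr ≫ cokernel.π (biprod.lift p q) ≫ f = 0 :=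
      h _ (-(biprod.inl ≫ cokernel.π (biprod.lift p q) ≫ f)) (by
        rw [Preadditive.comp_neg]
        exact eq_neg_of_add_eq_zero_right h₀)
    have h₂ : biprod.inl ≫ cokernel.π (biprod.lift p q) ≫ f = 0 := by
      rw [h₁, comp_zero, add_zero] at h₀
      rwa [← cancel_epi p, comp_zero]
    rw [← cancel_epi (cokernel.π (biprod.lift p q))]
    refine biprod.hom_ext' _ _ ?_ ?_ <;> simp [h₁, h₂]
  exact hX.isIso_of_epi _ hj (by rw [hX.dim_biprod]; omega)

/-- The image of the unit under the left adjoint. -/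
abbrev mapUnit (M : C) : T.obj M ⟶ T.obj (T'.obj (T.obj M)) := T.map (adj.unit.app M)

/-- The unit of the second adjunction on the image of the first functor. -/
abbrev unitMap (M : C) : T.obj M ⟶ T.obj (T'.obj (T.obj M)) := adj'.unit.app (T.obj M)

/-- The image of the counit under the right adjoint. -/
abbrev mapCounit (M : C) : T.obj (T'.obj (T.obj M)) ⟶ T.obj M := T.map (adj'.counit.app M)

/-- The counit of the first adjunction on the image of the first functor. -/
abbrev counitMap (M : C) : T.obj (T'.obj (T.obj M)) ⟶ T.obj M := adj.counit.app (T.obj M)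

-- By `eq_zero_of_unit_comp` and the doubling of dimension, `TΘM` is the sum of the images of `T(η)`
-- and of the second unit. The inclusion of the second summand gives the section `σ` and the
-- projection onto it gives `q`, both after applying `T'`.
include hX hd in
theorem nonempty_unitCone_comp_counitCone :
    Nonempty (onDb (unitCone adj.unit) (descends_unitCone adj.unit) ⋙
        onDb (counitCone adj'.counit) (descends_counitCone adj'.counit)
      ≅ onDb (CategoryTheory.shiftFunctor (CochainComplex C ℤ) (1 : ℤ)) (descends_shift 1)) := by
  let j (M : C) : T.obj M ⊞ T.obj M ≅ T.obj (T'.obj (T.obj M)) :=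
    @asIso _ _ _ _ (biprod.desc (mapUnit adj M) (unitMap adj' M)) (hX.isIso_desc _ _
      (SplitMono.mono ⟨adj.counit.app (T.obj M), adj.left_triangle_components M⟩)
      (eq_zero_of_unit_comp adj adj' hX hd) (hd _))
  have hj (M : C) : (j M).hom = biprod.desc (mapUnit adj M) (unitMap adj' M) :=
    rfl
  have hl (M : C) : mapUnit adj M ≫ (j M).inv = biprod.inl := by
    rw [Iso.comp_inv_eq, hj, biprod.inl_desc]
  have hr (M : C) : unitMap adj' M ≫ (j M).inv = biprod.inr := by
    rw [Iso.comp_inv_eq, hj, biprod.inr_desc]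
  -- The projection onto the second summand is natural because both summand inclusions are.
  have nat {M N : C} (f : M ⟶ N) : T.map (T'.map (T.map f)) ≫ (j N).inv ≫ biprod.snd
      = ((j M).inv ≫ biprod.snd) ≫ T.map f := by
    rw [← cancel_epi (j M).hom, Category.assoc, Iso.hom_inv_id_assoc, hj]
    refine biprod.hom_ext' _ _ ?_ ?_
    · have h := adj.unit.naturality f
      rw [biprod.inl_desc_assoc, ← Functor.map_comp_assoc, biprod.inl_snd_assoc, zero_comp]
      have h' : T.map (adj.unit.app M ≫ T'.map (T.map f)) = T.map (f ≫ adj.unit.app N) :=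
        congrArg T.map h.symm
      rw [h', Functor.map_comp, Category.assoc, reassoc_of% (hl N)]
      simp
    · have h := adj'.unit.naturality (T.map f)
      have h' : unitMap adj' M ≫ T.map (T'.map (T.map f)) =
        T.map f ≫ unitMap adj' N := h.symm
      rw [biprod.inr_desc_assoc, reassoc_of% h', reassoc_of% (hr N)]
      simp
  let s (M : C) : (ShortComplex.mk (mapUnit adj M) ((j M).inv ≫ biprod.snd)
      (by rw [reassoc_of% (hl M), biprod.inl_snd])).Splitting :=
    { r := (j M).inv ≫ biprod.fst
      s := unitMap adj' M
      f_r := by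
        change mapUnit adj M ≫ (j M).inv ≫ biprod.fst = _
        rw [reassoc_of% (hl M), biprod.inl_fst]
      s_g := by
        change unitMap adj' M ≫ (j M).inv ≫ biprod.snd = _
        rw [reassoc_of% (hr M), biprod.inr_snd]
      id := by
        change ((j M).inv ≫ biprod.fst) ≫ mapUnit adj M +
          ((j M).inv ≫ biprod.snd) ≫ unitMap adj' M = 𝟙 _
        rw [Category.assoc, Category.assoc, ← Preadditive.comp_add, ← biprod.desc_eq, ← hj,
          Iso.inv_hom_id] }
  let σ : T ⋙ T' ⟶ (T ⋙ T') ⋙ (T ⋙ T') :=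
    { app := fun M => T'.map (unitMap adj' M)
      naturality := fun M N f => by
        have h := adj'.unit.naturality (T.map f)
        have h' := congrArg T'.map h
        rw [Functor.map_comp, Functor.map_comp] at h'
        exact h' }
  let q : (T ⋙ T') ⋙ (T ⋙ T') ⟶ T ⋙ T' :=
    { app := fun M => T'.map ((j M).inv ≫ biprod.snd)
      naturality := fun M N f => by
        have h' := congrArg T'.map (nat f)
        rw [Functor.map_comp, Functor.map_comp T' (_ ≫ _)] at h'
        exact h' }
  refine nonempty_onDb_unitCone_counitCone adj.unit adj'.counit σ q (fun M => ?_) (fun M => ?_)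
    (fun M => ?_) (fun M => ?_)
  · exact adj'.left_triangle_components (T.obj M)
  · refine (T'.map_comp _ _).symm.trans ?_
    rw [reassoc_of% (hr M), biprod.inr_snd]
    exact T'.map_id _
  · refine (T'.map_comp _ _).symm.trans ?_
    rw [reassoc_of% (hl M), biprod.inl_snd]
    exact T'.map_zero _ _
  · exact ((s M).map T').shortExact

-- The same argument with the two counits: they exhibit `TΘM` as a product of two copies of `TM`,
-- and the kernel of `T(ε)` is the second factor.
include hX hd in
theorem nonempty_counitCone_comp_unitCone :
    Nonempty (onDb (counitCone adj'.counit) (descends_counitCone adj'.counit) ⋙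
        onDb (unitCone adj.unit) (descends_unitCone adj.unit)
      ≅ onDb (CategoryTheory.shiftFunctor (CochainComplex C ℤ) (1 : ℤ)) (descends_shift 1)) := by
  let j (M : C) : T.obj (T'.obj (T.obj M)) ≅ T.obj M ⊞ T.obj M :=
    @asIso _ _ _ _ (biprod.lift (mapCounit adj' M) (counitMap adj M)) (hX.isIso_lift _ _
      (SplitEpi.epi ⟨adj'.unit.app (T.obj M), adj'.right_triangle_components M⟩)
      (eq_zero_of_comp_counit adj adj' hX hd) (hd _))
  have hj (M : C) : (j M).hom = biprod.lift (mapCounit adj' M) (counitMap adj M) :=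
    rfl
  have hl (M : C) : (j M).inv ≫ mapCounit adj' M = biprod.fst := by
    rw [Iso.inv_comp_eq, hj, biprod.lift_fst]
  have hr (M : C) : (j M).inv ≫ counitMap adj M = biprod.snd := by
    rw [Iso.inv_comp_eq, hj, biprod.lift_snd]
  have nat {M N : C} (f : M ⟶ N) : T.map f ≫ biprod.inr ≫ (j N).inv
      = (biprod.inr ≫ (j M).inv) ≫ T.map (T'.map (T.map f)) := by
    rw [← cancel_mono (j N).hom, Category.assoc, Category.assoc, Iso.inv_hom_id, Category.comp_id,
      hj]
    refine biprod.hom_ext _ _ ?_ ?_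
    · have h := adj'.counit.naturality f
      have h' : T.map (T'.map (T.map f) ≫ adj'.counit.app N) = T.map (adj'.counit.app M ≫ f) :=
        congrArg T.map h
      simp only [Category.assoc, biprod.lift_fst, biprod.inr_fst, comp_zero]
      rw [← Functor.map_comp, h', Functor.map_comp, reassoc_of% (hl M)]
      simp
    · have h := adj.counit.naturality (T.map f)
      have h' : T.map (T'.map (T.map f)) ≫ counitMap adj N =
        counitMap adj M ≫ T.map f := h
      simp only [Category.assoc, biprod.lift_snd, biprod.inr_snd]
      rw [h', reassoc_of% (hr M)]
      simp
  let s (M : C) : (ShortComplex.mk (biprod.inr ≫ (j M).inv) (mapCounit adj' M)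
      (by rw [Category.assoc, hl M, biprod.inr_fst])).Splitting :=
    { r := counitMap adj M
      s := biprod.inl ≫ (j M).inv
      f_r := by
        change (biprod.inr ≫ (j M).inv) ≫ counitMap adj M = _
        rw [Category.assoc, hr M, biprod.inr_snd]
      s_g := by
        change (biprod.inl ≫ (j M).inv) ≫ mapCounit adj' M = 𝟙 (T.obj M)
        exact (Category.assoc _ _ _).trans ((congrArg _ (hl M)).trans biprod.inl_fst)
      id := by
        change counitMap adj M ≫ biprod.inr ≫ (j M).inv +
          mapCounit adj' M ≫ biprod.inl ≫ (j M).inv = 𝟙 _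
        rw [← Category.assoc, ← Category.assoc, ← Preadditive.add_comp, add_comm, ← biprod.lift_eq,
          ← hj, Iso.hom_inv_id] }
  let ρ : (T ⋙ T') ⋙ (T ⋙ T') ⟶ T ⋙ T' :=
    { app := fun M => T'.map (counitMap adj M)
      naturality := fun M N f => by
        have h := adj.counit.naturality (T.map f)
        have h' := congrArg T'.map h
        rw [Functor.map_comp, Functor.map_comp] at h'
        exact h' }
  let i : T ⋙ T' ⟶ (T ⋙ T') ⋙ (T ⋙ T') :=
    { app := fun M => T'.map (biprod.inr ≫ (j M).inv)
      naturality := fun M N f => by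
        have h' := congrArg T'.map (nat f)
        rw [Functor.map_comp, Functor.map_comp T' (_ ≫ _)] at h'
        exact h' }
  refine nonempty_onDb_counitCone_unitCone adj.unit adj'.counit ρ i (fun M => ?_) (fun M => ?_)
    (fun M => ?_) (fun M => ?_)
  · exact adj.right_triangle_components (T.obj M)
  · refine (T'.map_comp _ _).symm.trans ?_
    rw [Category.assoc, hr M, biprod.inr_snd]
    exact T'.map_id _
  · refine (T'.map_comp _ _).symm.trans ?_
    rw [Category.assoc, hl M]
    exact (congrArg T'.map biprod.inr_fst).trans (T'.map_zero _ _)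
  · exact ((s M).map T').shortExact

include hX hd adj' in
theorem isEquivalence_onDb_unitCone :
    (onDb (unitCone adj.unit) (descends_unitCone adj.unit)).IsEquivalence :=
  have := isEquivalence_onDb_shift (C := C)
  isEquivalence_of_comp (nonempty_unitCone_comp_counitCone adj adj' hX hd)
    (nonempty_counitCone_comp_unitCone adj adj' hX hd)

end

end BoundedDerived

/-! ### The adjunction between the cokernel of the unit and the kernel of the counit. -/

namespace BoundedDerived

noncomputable section

/-- The cokernel of a natural transformation from the identity. -/
def cokernelFunctor {C : Type*} [Category* C] [Abelian C] {P : C ⥤ C} (η : 𝟭 C ⟶ P) : C ⥤ C where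
  obj M := cokernel (η.app M)
  map f := cokernel.map _ _ f (P.map f) (η.naturality f).symm
  map_id M := by
    rw [← cancel_epi (cokernel.π (η.app M))]
    simp
  map_comp f g := by
    rw [← cancel_epi (cokernel.π (η.app _))]
    simp

section Adjunction

variable {C D : Type*} [Category* C] [Abelian C] [Category* D]
  {T : C ⥤ D} {T' : D ⥤ C} (adj : T ⊣ T') (adj' : T' ⊣ T)

/-- The map `M ⟶ Θ N` corresponding to a map from the cokernel of the unit to `N`. -/
def cokernelToKernel {M N : C} (f : cokernel (adj.unit.app M) ⟶ N) :
    M ⟶ kernel (adj'.counit.app N) :=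
  -- If ΘM → N and M → ΘN are both transposes of one map TM → TN, then `η` followed by the former
  -- equals the latter followed by `ε`. So vanishing on the image of `η` means landing in the kernel
  -- of `ε`.
  kernel.lift _ (adj.unit.app M ≫ T'.map (adj'.homEquiv _ _ (cokernel.π (adj.unit.app M) ≫ f))) (by
    have h := (adj'.homEquiv _ _).symm_apply_apply (cokernel.π (adj.unit.app M) ≫ f)
    rw [Adjunction.homEquiv_counit] at h
    rw [Category.assoc]
    refine (congrArg (adj.unit.app M ≫ ·) h).trans ?_
    rw [cokernel.condition_assoc, zero_comp])

/-- The map from the cokernel of the unit to `N` corresponding to a map `M ⟶ Θ N`. -/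
def kernelToCokernel {M N : C} (g : M ⟶ kernel (adj'.counit.app N)) :
    cokernel (adj.unit.app M) ⟶ N :=
  cokernel.desc _ (T'.map ((adj.homEquiv _ _).symm (g ≫ kernel.ι (adj'.counit.app N))) ≫
      adj'.counit.app N) (by
    have h := (adj.homEquiv _ _).apply_symm_apply (g ≫ kernel.ι (adj'.counit.app N))
    rw [Adjunction.homEquiv_unit] at h
    rw [← Category.assoc]
    refine (congrArg (· ≫ adj'.counit.app N) h).trans ?_
    rw [Category.assoc, kernel.condition, comp_zero])

theorem cokernelToKernel_ι {M N : C} (f : cokernel (adj.unit.app M) ⟶ N) :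
    cokernelToKernel adj adj' f ≫ kernel.ι (adj'.counit.app N)
      = adj.homEquiv _ _ (adj'.homEquiv _ _ (cokernel.π (adj.unit.app M) ≫ f)) := by
  rw [Adjunction.homEquiv_unit adj]
  exact kernel.lift_ι _ _ _

theorem π_kernelToCokernel {M N : C} (g : M ⟶ kernel (adj'.counit.app N)) :
    cokernel.π (adj.unit.app M) ≫ kernelToCokernel adj adj' g
      = (adj'.homEquiv _ _).symm ((adj.homEquiv _ _).symm (g ≫ kernel.ι (adj'.counit.app N))) := by
  rw [Adjunction.homEquiv_counit adj']
  exact cokernel.π_desc _ _ _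

theorem kernelToCokernel_cokernelToKernel {M N : C} (f : cokernel (adj.unit.app M) ⟶ N) :
    kernelToCokernel adj adj' (cokernelToKernel adj adj' f) = f := by
  refine (cancel_epi (cokernel.π (adj.unit.app M))).1 ?_
  rw [π_kernelToCokernel, cokernelToKernel_ι]
  simp only [Equiv.symm_apply_apply]

theorem cokernelToKernel_kernelToCokernel {M N : C} (g : M ⟶ kernel (adj'.counit.app N)) :
    cokernelToKernel adj adj' (kernelToCokernel adj adj' g) = g := by
  refine (cancel_mono (kernel.ι (adj'.counit.app N))).1 ?_
  rw [cokernelToKernel_ι, π_kernelToCokernel]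
  simp only [Equiv.apply_symm_apply]

theorem kernelToCokernel_comp {M' M N : C} (f : M' ⟶ M) (g : M ⟶ kernel (adj'.counit.app N))
    (f' : cokernel (adj.unit.app M') ⟶ cokernel (adj.unit.app M))
    (h : cokernel.π (adj.unit.app M') ≫ f' = T'.map (T.map f) ≫ cokernel.π (adj.unit.app M)) :
    kernelToCokernel adj adj' (f ≫ g) = f' ≫ kernelToCokernel adj adj' g := by
  refine (cancel_epi (cokernel.π (adj.unit.app M'))).1 ?_
  rw [reassoc_of% h, π_kernelToCokernel, π_kernelToCokernel, Category.assoc,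
    Adjunction.homEquiv_naturality_left_symm, Adjunction.homEquiv_naturality_left_symm]

theorem cokernelToKernel_comp {M N N' : C} (f : cokernel (adj.unit.app M) ⟶ N) (g : N ⟶ N')
    (g' : kernel (adj'.counit.app N) ⟶ kernel (adj'.counit.app N'))
    (h : g' ≫ kernel.ι (adj'.counit.app N') = kernel.ι (adj'.counit.app N) ≫ T'.map (T.map g)) :
    cokernelToKernel adj adj' (f ≫ g) = cokernelToKernel adj adj' f ≫ g' := by
  refine (cancel_mono (kernel.ι (adj'.counit.app N'))).1 ?_
  rw [Category.assoc, h, ← Category.assoc, cokernelToKernel_ι, cokernelToKernel_ι,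
    ← Category.assoc, Adjunction.homEquiv_naturality_right,
    Adjunction.homEquiv_naturality_right]

/-- The cokernel of the unit is left adjoint to the kernel of the counit. -/
def cokernelKernelAdjunction : cokernelFunctor adj.unit ⊣ kernelFunctor adj'.counit :=
  Adjunction.mkOfHomEquiv
    { homEquiv := fun _ _ =>
        { toFun := fun f => cokernelToKernel adj adj' f
          invFun := fun g => kernelToCokernel adj adj' g
          left_inv := fun f => kernelToCokernel_cokernelToKernel adj adj' f
          right_inv := fun g => cokernelToKernel_kernelToCokernel adj adj' g }
      homEquiv_naturality_left_symm := fun f g =>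
        kernelToCokernel_comp adj adj' f g _ (cokernel.π_desc _ _ _)
      homEquiv_naturality_right := fun f g =>
        cokernelToKernel_comp adj adj' f g _ (kernel.lift_ι _ _ _) }

end Adjunction

section Biprod

variable {C : Type*} [Category* C] [Abelian C]

/-- The biproduct of two functors. -/
def biprodFunctor (F G : C ⥤ C) : C ⥤ C where
  obj M := F.obj M ⊞ G.obj M
  map f := biprod.map (F.map f) (G.map f)

instance (F G : C ⥤ C) [F.PreservesZeroMorphisms] [G.PreservesZeroMorphisms] :
    (biprodFunctor F G).PreservesZeroMorphisms where
  map_zero M N := by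
    change biprod.map (F.map 0) (G.map 0) = 0
    ext <;> simp

/-- The transformation from a biproduct to the identity. -/
def biprodDesc {F G : C ⥤ C} (p : F ⟶ 𝟭 C) (q : G ⟶ 𝟭 C) : biprodFunctor F G ⟶ 𝟭 C where
  app M := biprod.desc (p.app M) (q.app M)
  naturality M N f := by
    have h₁ := p.naturality f
    have h₂ := q.naturality f
    change biprod.map (F.map f) (G.map f) ≫ biprod.desc (p.app N) (q.app N)
      = biprod.desc (p.app M) (q.app M) ≫ f
    refine biprod.hom_ext' _ _ ?_ ?_
    · rw [biprod.inl_map_assoc, biprod.inl_desc, biprod.inl_desc_assoc]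
      exact h₁
    · rw [biprod.inr_map_assoc, biprod.inr_desc, biprod.inr_desc_assoc]
      exact h₂

theorem mono_app_biprod {Θ : C ⥤ C} (η : 𝟭 C ⟶ Θ) {M N : C} (hM : Mono (η.app M))
    (hN : Mono (η.app N)) : Mono (η.app (M ⊞ N)) := by
  refine Preadditive.mono_of_cancel_zero _ fun {Z} t ht => ?_
  have h : ∀ {K : C} (_ : Mono (η.app K)) (f : M ⊞ N ⟶ K), t ≫ f = 0 := by
    intro K hK f
    have h₃ := η.naturality f
    rw [← cancel_mono (η.app K), zero_comp, Category.assoc]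
    exact (congrArg (t ≫ ·) h₃).trans
      ((Category.assoc _ _ _).symm.trans ((congrArg (· ≫ Θ.map f) ht).trans zero_comp))
  exact biprod.hom_ext _ _ ((h hM biprod.fst).trans zero_comp.symm)
    ((h hN biprod.snd).trans zero_comp.symm)

end Biprod

end

end BoundedDerived

/-! ### Comparison of string complexes. -/

namespace BoundedDerived

noncomputable section

open scoped ZeroObject

section Criterion

variable {C : Type*} [Category* C] [Abelian C]

/-- The mapping cone of `f` is exact in the degree determined by `i`. -/
def ConeExactAt {K L : CochainComplex C ℤ} (f : K ⟶ L) (i : ℤ) : Prop :=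
  ∀ ⦃A : C⦄ (x : A ⟶ K.X (i + 1)) (y : A ⟶ L.X i), x ≫ K.d (i + 1) (i + 2) = 0 →
    x ≫ f.f (i + 1) = y ≫ L.d i (i + 1) →
    ∃ (A' : C) (π : A' ⟶ A) (_ : Epi π) (x' : A' ⟶ K.X i) (y' : A' ⟶ L.X (i - 1)),
      π ≫ x = x' ≫ K.d i (i + 1) ∧ π ≫ y = x' ≫ f.f i + y' ≫ L.d (i - 1) i

/-- Exactness of the cone in degree `i` says that `f` is injective on cohomology in degree `i + 1`,
and, for `x = 0`, that it is surjective in degree `i`. Working with generalized elements allows the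
degrees to be treated one at a time. -/
theorem quasiIso_of_coneExactAt {K L : CochainComplex C ℤ} (f : K ⟶ L)
    (h : ∀ i, ConeExactAt f i) : QuasiIso f := by
  rw [quasiIso_iff]
  intro j
  rw [quasiIsoAt_iff_isIso_homologyMap]
  have : Mono (HomologicalComplex.homologyMap f j) := by
    obtain ⟨i, rfl⟩ : ∃ i, j = i + 1 := ⟨j - 1, by ring⟩
    rw [HomologicalComplex.mono_homologyMap_iff_up_to_refinements f i (i + 1) (i + 2)
      (by simp) (by simp; ring)]
    intro A x hx y hy
    obtain ⟨A', π, hπ, x', -, h₁, -⟩ := h i x y hx hy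
    exact ⟨A', π, hπ, x', h₁⟩
  have : Epi (HomologicalComplex.homologyMap f j) := by
    rw [HomologicalComplex.epi_homologyMap_iff_up_to_refinements f (j - 1) j (j + 1)
      (by simp) (by simp)]
    intro A y hy
    obtain ⟨A', π, hπ, x', y', h₁, h₂⟩ := h j 0 y zero_comp (by rw [zero_comp, hy])
    exact ⟨A', π, hπ, x', by rw [← h₁, comp_zero], y', h₂⟩
  exact isIso_of_mono_of_epi _

/-- After a cover, `y` lifts through the epimorphism in degree `i`, and the monomorphism in degree
`i + 1` shows that the differential of this lift is `x`. -/
theorem coneExactAt_of_epi_of_mono {K L : CochainComplex C ℤ} (f : K ⟶ L) (i : ℤ)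
    (h₁ : Epi (f.f i)) (h₂ : Mono (f.f (i + 1))) : ConeExactAt f i := by
  intro A x y _ hxy
  obtain ⟨A', π, hπ, x', hx'⟩ := surjective_up_to_refinements_of_epi (f.f i) y
  refine ⟨A', π, hπ, x', 0, ?_, by rw [hx', zero_comp, add_zero]⟩
  rw [← cancel_mono (f.f (i + 1)), Category.assoc, hxy, Category.assoc, ← f.comm,
    ← Category.assoc, hx', Category.assoc]

end Criterion

section String

variable {C : Type*} [Category* C] [Abelian C] {Pe Ps : C} (a : Pe ⟶ Ps) (b : Ps ⟶ Pe)
  (G : C ⥤ C) [G.PreservesZeroMorphisms] (φ : ℤ → (Ps ≅ G.obj Ps))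

/-- The components of the comparison of string complexes. -/
def spotMap (i : ℤ) : (x y : Spot) → (spotObj Pe Ps x ⟶ G.obj (spotObj Pe Ps y))
  -- For `0 ≤ n` the mixed position is degree `-n`, with `Ps` over `G.obj Pe`; for `n < 0` it is
  -- degree `-n - 1`, with `Pe` over `G.obj Ps`. The composites used there are the two maps of the
  -- sequence 0 → Pe → Ps → G Pe → 0, up to `φ`.
  | .s, .s => (φ i).hom
  | .s, .e => (φ i).hom ≫ G.map b
  | .e, .s => a ≫ (φ i).hom
  | _, _ => 0

/-- The configurations of neighbouring spots that occur in the comparison of string complexes. -/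
def SpotStep (x x' y y' : Spot) : Prop :=
  x = .zero ∨ y' = .zero ∨ (x = .e ∧ x' = .s ∧ y = .zero ∧ y' = .e) ∨
    (x = .s ∧ x' = .s ∧ y = .e ∧ y' = .s) ∨ (x = .s ∧ x' = .s ∧ y = .s ∧ y' = .s) ∨
    (x = .s ∧ x' = .e ∧ y = .s ∧ y' = .s) ∨ (x = .e ∧ x' = .zero ∧ y = .s ∧ y' = .e)

theorem spot_eq_e {n i : ℤ} (h : i = -n) : spot n i = .e := if_pos h

theorem spot_eq_s {n i : ℤ} (h : (-n < i ∧ i ≤ 0) ∨ (0 ≤ i ∧ i < -n)) : spot n i = .s := by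
  rw [spot, if_neg (by omega), if_pos h]

theorem spot_eq_zero {n i : ℤ} (h : (0 < i ∨ i < -n) ∧ (i < 0 ∨ -n < i)) : spot n i = .zero := by
  rw [spot, if_neg (by omega), if_neg (by omega)]

theorem spotStep (n i : ℤ) :
    SpotStep (spot (n + 1) i) (spot (n + 1) (i + 1)) (spot n i) (spot n (i + 1)) := by
  by_cases h₁ : (0 < i ∨ i < -(n + 1)) ∧ (i < 0 ∨ -(n + 1) < i)
  · exact Or.inl (spot_eq_zero h₁)
  by_cases h₂ : (0 < i + 1 ∨ i + 1 < -n) ∧ (i + 1 < 0 ∨ -n < i + 1)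
  · exact Or.inr (Or.inl (spot_eq_zero h₂))
  refine Or.inr (Or.inr ?_)
  by_cases h₃ : 0 ≤ n
  · by_cases h₄ : i = -(n + 1)
    · exact Or.inl ⟨spot_eq_e h₄, spot_eq_s (by omega), spot_eq_zero (by omega),
        spot_eq_e (by omega)⟩
    · by_cases h₅ : i = -n
      · exact Or.inr (Or.inl ⟨spot_eq_s (by omega), spot_eq_s (by omega), spot_eq_e h₅,
          spot_eq_s (by omega)⟩)
      · exact Or.inr (Or.inr (Or.inl ⟨spot_eq_s (by omega), spot_eq_s (by omega),
          spot_eq_s (by omega), spot_eq_s (by omega)⟩))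
  · by_cases h₄ : i = -(n + 1)
    · exact Or.inr (Or.inr (Or.inr (Or.inr ⟨spot_eq_e h₄, spot_eq_zero (by omega),
        spot_eq_s (by omega), spot_eq_e (by omega)⟩)))
    · by_cases h₅ : i + 1 = -(n + 1)
      · exact Or.inr (Or.inr (Or.inr (Or.inl ⟨spot_eq_s (by omega), spot_eq_e h₅,
          spot_eq_s (by omega), spot_eq_s (by omega)⟩)))
      · exact Or.inr (Or.inr (Or.inl ⟨spot_eq_s (by omega), spot_eq_s (by omega),
          spot_eq_s (by omega), spot_eq_s (by omega)⟩))

theorem isZero_spotObj_zero : IsZero (spotObj Pe Ps .zero) := isZero_zero C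

variable (hφ : ∀ i, (φ i).hom ≫ G.map (b ≫ a) = (b ≫ a) ≫ (φ (i + 1)).hom)
  (hb : ∀ i, a ≫ (φ i).hom ≫ G.map b = 0)

include hφ hb in
theorem spotMap_comm (i : ℤ) {x x' y y' : Spot} (h : SpotStep x x' y y') :
    spotMap a b G φ i x y ≫ G.map (spotHom a b y y') =
      spotHom a b x x' ≫ spotMap a b G φ (i + 1) x' y' := by
  rcases h with rfl | rfl | ⟨rfl, rfl, rfl, rfl⟩ | ⟨rfl, rfl, rfl, rfl⟩ | ⟨rfl, rfl, rfl, rfl⟩ |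
    ⟨rfl, rfl, rfl, rfl⟩ | ⟨rfl, rfl, rfl, rfl⟩
  · exact isZero_spotObj_zero.eq_of_src _ _
  · exact (G.map_isZero isZero_spotObj_zero).eq_of_tgt _ _
  · exact zero_comp.trans (hb (i + 1)).symm
  · change ((φ i).hom ≫ G.map b) ≫ G.map a = (b ≫ a) ≫ (φ (i + 1)).hom
    rw [← hφ, G.map_comp, Category.assoc]
  · exact hφ i
  · change (φ i).hom ≫ G.map (b ≫ a) = b ≫ a ≫ (φ (i + 1)).hom
    rw [hφ, Category.assoc]
  · exact (Category.assoc _ _ _).trans ((hb i).trans zero_comp.symm)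

variable (w : a ≫ b = 0)

theorem stringComplex_d (n : ℤ) {i j : ℤ} (h : i + 1 = j) :
    (stringComplex a b w n).d i j = spotHom a b (spot n i) (spot n j) := if_pos h

/-- The comparison of a string complex with the image of the preceding one. -/
def stringMap (n : ℤ) : stringComplex a b w (n + 1) ⟶
    (G.mapHomologicalComplex (ComplexShape.up ℤ)).obj (stringComplex a b w n) where
  f i := spotMap a b G φ i (spot (n + 1) i) (spot n i)
  comm' i j hij := by
    have hij' : i + 1 = j := hij
    subst hij'
    exact (congrArg (spotMap a b G φ i (spot (n + 1) i) (spot n i) ≫ G.map ·)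
      (stringComplex_d a b w n rfl)).trans ((spotMap_comm a b G φ hφ hb i (spotStep n i)).trans
        (congrArg (· ≫ spotMap a b G φ (i + 1) (spot (n + 1) (i + 1)) (spot n (i + 1)))
          (stringComplex_d a b w (n + 1) rfl)).symm)

theorem epi_spotMap (he : ∀ i, Epi ((φ i).hom ≫ G.map b)) (i : ℤ) {x y : Spot}
    (h : y = .zero ∨ (x = .s ∧ y ≠ .zero)) : Epi (spotMap a b G φ i x y) := by
  rcases h with rfl | ⟨rfl, h⟩
  · exact ⟨fun _ _ _ => (G.map_isZero isZero_spotObj_zero).eq_of_src _ _⟩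
  · match y, h with
    | .s, _ => exact inferInstanceAs (Epi (φ i).hom)
    | .e, _ => exact he i

omit [G.PreservesZeroMorphisms] in
theorem mono_spotMap [Mono a] (i : ℤ) {x y : Spot} (h : x = .zero ∨ (y = .s ∧ x ≠ .zero)) :
    Mono (spotMap a b G φ i x y) := by
  rcases h with rfl | ⟨rfl, h⟩
  · exact ⟨fun _ _ _ => isZero_spotObj_zero.eq_of_tgt _ _⟩
  · match x, h with
    | .s, _ => exact inferInstanceAs (Mono (φ i).hom)
    | .e, _ => exact inferInstanceAs (Mono (a ≫ (φ i).hom))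

/-- The configurations of neighbouring spots at which the comparison of string complexes is not an
epimorphism followed by a monomorphism. -/
def SpotCone (x x' x'' y₀ y y' : Spot) : Prop :=
  (x = .e ∧ x' = .s ∧ y = .zero ∧ y' = .e) ∨ (x' = .e ∧ x'' = .s ∧ y = .zero) ∨
    (x = .e ∧ x' = .zero ∧ y = .s ∧ y' = .e) ∨ (x' = .zero ∧ y₀ = .s ∧ y = .e)

theorem spot_ne_zero {n i : ℤ} (h : (0 ≤ i ∧ i ≤ -n) ∨ (i ≤ 0 ∧ -n ≤ i)) : spot n i ≠ .zero := by
  by_cases h₁ : i = -n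
  · rw [spot_eq_e h₁]
    exact Spot.noConfusion
  · rw [spot_eq_s (by omega)]
    exact Spot.noConfusion

/-- Only the degrees `-n - 1`, `-n - 2` for `0 ≤ n`, and `-n` for `n < 0` are exceptional.
Everywhere else the comparison is an isomorphism, a map from or to zero, or one of the two mixed
maps on its harmless side. -/
theorem epi_mono_of_not_spotCone {n i : ℤ} (h : ¬SpotCone (spot (n + 1) i) (spot (n + 1) (i + 1))
      (spot (n + 1) (i + 2)) (spot n (i - 1)) (spot n i) (spot n (i + 1))) :
    (spot n i = .zero ∨ (spot (n + 1) i = .s ∧ spot n i ≠ .zero)) ∧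
      (spot (n + 1) (i + 1) = .zero ∨
        (spot n (i + 1) = .s ∧ spot (n + 1) (i + 1) ≠ .zero)) := by
  have h₁ : i ≠ -n - 1 := fun hi => h (by
    by_cases hn : 0 ≤ n
    · exact Or.inl ⟨spot_eq_e (by omega), spot_eq_s (by omega), spot_eq_zero (by omega),
        spot_eq_e (by omega)⟩
    · exact Or.inr (Or.inr (Or.inl ⟨spot_eq_e (by omega), spot_eq_zero (by omega),
        spot_eq_s (by omega), spot_eq_e (by omega)⟩)))
  have h₂ : ¬(0 ≤ n ∧ i = -n - 2) := fun hi => h (Or.inr (Or.inl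
    ⟨spot_eq_e (by omega), spot_eq_s (by omega), spot_eq_zero (by omega)⟩))
  have h₃ : ¬(n < 0 ∧ i = -n) := fun hi => h (Or.inr (Or.inr (Or.inr
    ⟨spot_eq_zero (by omega), spot_eq_s (by omega), spot_eq_e (by omega)⟩)))
  constructor
  · by_cases h₄ : (0 < i ∨ i < -n) ∧ (i < 0 ∨ -n < i)
    · exact Or.inl (spot_eq_zero h₄)
    · exact Or.inr ⟨spot_eq_s (by omega), spot_ne_zero (by omega)⟩
  · by_cases h₄ : (0 < i + 1 ∨ i + 1 < -(n + 1)) ∧ (i + 1 < 0 ∨ -(n + 1) < i + 1)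
    · exact Or.inl (spot_eq_zero h₄)
    · exact Or.inr ⟨spot_eq_s (by omega), spot_ne_zero (by omega)⟩

variable (hS : ∀ i, (ShortComplex.mk a ((φ i).hom ≫ G.map b) (hb i)).ShortExact)

-- At the end carrying `Pe`, exactness of the cone reduces to that of 0 → Pe → Ps → G Pe → 0. The
-- four cases use, in turn, exactness in the middle, injectivity of `a`, exactness in the middle
-- again, and surjectivity of `G.map b`.
include hS in
theorem exists_of_spotCone (i : ℤ) {x x' x'' y₀ y y' : Spot} (h : SpotCone x x' x'' y₀ y y')
    {A : C} (u : A ⟶ spotObj Pe Ps x') (v : A ⟶ G.obj (spotObj Pe Ps y))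
    (hu : u ≫ spotHom a b x' x'' = 0)
    (huv : u ≫ spotMap a b G φ (i + 1) x' y' = v ≫ G.map (spotHom a b y y')) :
    ∃ (A' : C) (π : A' ⟶ A) (_ : Epi π) (u' : A' ⟶ spotObj Pe Ps x)
      (v' : A' ⟶ G.obj (spotObj Pe Ps y₀)),
      π ≫ u = u' ≫ spotHom a b x x' ∧
        π ≫ v = u' ≫ spotMap a b G φ i x y + v' ≫ G.map (spotHom a b y₀ y) := by
  have hz : IsZero (G.obj (spotObj Pe Ps .zero)) := G.map_isZero isZero_spotObj_zero
  have := (hS 0).mono_f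
  have key (i : ℤ) (v : A ⟶ G.obj Ps) (hv : v ≫ G.map b = 0) :
      ∃ u' : A ⟶ Pe, u' ≫ a ≫ (φ i).hom = v := by
    have h₂ : (v ≫ (φ i).inv) ≫ (φ i).hom ≫ G.map b = 0 := by
      rw [Category.assoc, Iso.inv_hom_id_assoc, hv]
    have h₃ : (hS i).exact.lift (v ≫ (φ i).inv) h₂ ≫ a = v ≫ (φ i).inv :=
      (hS i).exact.lift_f _ h₂
    exact ⟨_, by rw [reassoc_of% h₃, Iso.inv_hom_id, Category.comp_id]⟩
  rcases h with ⟨rfl, rfl, rfl, rfl⟩ | ⟨rfl, rfl, rfl⟩ | ⟨rfl, rfl, rfl, rfl⟩ | ⟨rfl, rfl, rfl⟩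
  · have h₁ : u ≫ (φ (i + 1)).hom ≫ G.map b = 0 :=
      huv.trans ((congrArg (· ≫ _) (hz.eq_of_tgt v 0)).trans zero_comp)
    exact ⟨A, 𝟙 A, inferInstance, (hS (i + 1)).exact.lift u h₁, 0,
      (Category.id_comp u).trans ((hS (i + 1)).exact.lift_f u h₁).symm, hz.eq_of_tgt _ _⟩
  · have h₁ : u = 0 := (cancel_mono a).1 (hu.trans zero_comp.symm)
    exact ⟨A, 𝟙 A, inferInstance, 0, 0, (by rw [h₁, comp_zero]; exact zero_comp.symm),
      hz.eq_of_tgt _ _⟩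
  · have h₁ : v ≫ G.map b = 0 :=
      huv.symm.trans ((congrArg (· ≫ _) (isZero_spotObj_zero.eq_of_tgt u 0)).trans zero_comp)
    obtain ⟨u', hu'⟩ := key i v h₁
    exact ⟨A, 𝟙 A, inferInstance, u', 0, isZero_spotObj_zero.eq_of_tgt _ _,
      (Category.id_comp v).trans (hu'.symm.trans ((congrArg (_ + ·) zero_comp).trans
        (add_zero _)).symm)⟩
  · have : Epi ((φ i).hom ≫ G.map b) := (hS i).epi_g
    have : Epi (G.map b) := epi_of_epi (φ i).hom (G.map b)
    obtain ⟨A', π, hπ, v', hv'⟩ := surjective_up_to_refinements_of_epi (G.map b) v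
    exact ⟨A', π, hπ, 0, v', isZero_spotObj_zero.eq_of_tgt _ _,
      hv'.trans (((congrArg (· + _) zero_comp).trans (zero_add _)).symm)⟩

include hS in
theorem coneExactAt_stringMap (n i : ℤ) :
    ConeExactAt (stringMap a b G φ hφ hb w n) i := by
  have := (hS 0).mono_f
  have he (i) : Epi ((φ i).hom ≫ G.map b) := (hS i).epi_g
  by_cases h : SpotCone (spot (n + 1) i) (spot (n + 1) (i + 1)) (spot (n + 1) (i + 2))
      (spot n (i - 1)) (spot n i) (spot n (i + 1))
  · intro A u v hu huv
    obtain ⟨A', π, hπ, u', v', h₁, h₂⟩ := exists_of_spotCone a b G φ hb hS i h u v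
      ((congrArg (u ≫ ·) (stringComplex_d a b w (n + 1) (by ring))).symm.trans hu)
      (huv.trans (congrArg (v ≫ G.map ·) (stringComplex_d a b w n rfl)))
    exact ⟨A', π, hπ, u', v',
      h₁.trans (congrArg (u' ≫ ·) (stringComplex_d a b w (n + 1) rfl)).symm,
      h₂.trans (congrArg (_ + v' ≫ G.map ·) (stringComplex_d a b w n (by ring))).symm⟩
  · have h' := epi_mono_of_not_spotCone h
    exact coneExactAt_of_epi_of_mono _ i (epi_spotMap a b G φ he i h'.1)
      (mono_spotMap a b G φ (i + 1) h'.2)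

include hS in
theorem quasiIso_stringMap (n : ℤ) : QuasiIso (stringMap a b G φ hφ hb w n) :=
  quasiIso_of_coneExactAt _ (coneExactAt_stringMap a b G φ hφ hb w hS n)

/-- The string complex of length zero. -/
theorem nonempty_stringObject_zero : Nonempty (stringObject a b w 0 ≅ single Pe) := by
  have hz (i : ℤ) (hi : i ≠ 0) : IsZero ((stringComplex a b w 0).X i) := by
    change IsZero (spotObj Pe Ps (spot 0 i))
    rw [spot_eq_zero (by omega)]
    exact isZero_spotObj_zero
  have : (stringComplex a b w 0).IsStrictlyGE 0 :=
    (CochainComplex.isStrictlyGE_iff _ _).2 fun i hi => hz i hi.ne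
  have : (stringComplex a b w 0).IsStrictlyLE 0 :=
    (CochainComplex.isStrictlyLE_iff _ _).2 fun i hi => hz i hi.ne'
  obtain ⟨M, ⟨e⟩⟩ := CochainComplex.exists_iso_single (stringComplex a b w 0) 0
  have e₀ : (stringComplex a b w 0).X 0 ≅
      ((HomologicalComplex.single C (ComplexShape.up ℤ) 0).obj M).X 0 :=
    HomologicalComplex.Hom.isoApp e 0
  let e' : Pe ≅ M := e₀.trans (HomologicalComplex.singleObjXSelf (ComplexShape.up ℤ) 0 M)
  let e'' := e.trans ((HomologicalComplex.single C (ComplexShape.up ℤ) 0).mapIso e').symm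
  exact ⟨(Q C).mapIso (ObjectProperty.isoMk _ e'')⟩

end String

section Mono

variable {C : Type*} [Category* C] [Abelian C]

/-- A map on cokernels of a transformation `η` is a monomorphism if `η` is a monomorphism on the
cokernel of the given map. -/
theorem mono_of_mono_unit {Θ : C ⥤ C} (η : 𝟭 C ⟶ Θ) {X Y Z : C} (f : X ⟶ Y) (g : Y ⟶ Z)
    (w : f ≫ g = 0) (hf : (ShortComplex.mk f g w).Exact) [Mono f] [Mono (Θ.map f)]
    [Mono (η.app Z)] [Θ.PreservesZeroMorphisms]
    (f' : cokernel (η.app X) ⟶ cokernel (η.app Y))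
    (h : cokernel.π (η.app X) ≫ f' = Θ.map f ≫ cokernel.π (η.app Y)) : Mono f' := by
  refine Preadditive.mono_of_cancel_zero _ fun {A} z hz => ?_
  obtain ⟨A', p, hp, t, ht⟩ := surjective_up_to_refinements_of_epi (cokernel.π (η.app X)) z
  have h₁ : (t ≫ Θ.map f) ≫ cokernel.π (η.app Y) = 0 := by
    rw [Category.assoc, ← h, ← reassoc_of% ht, hz, comp_zero]
  obtain ⟨A'', p', hp', u, hu⟩ :=
    (ShortComplex.exact_cokernel (η.app Y)).exact_up_to_refinements _ h₁
  -- The image of `u` under `η` comes from `Θ(X)`, so it dies in `Θ(Z)`; there `η` is a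
  -- monomorphism.
  have h₂ : u ≫ g = 0 := by
    have h₃ := η.naturality g
    have h₄ : p' ≫ (t ≫ Θ.map f) = u ≫ η.app Y := hu
    rw [← cancel_mono (η.app Z), zero_comp, Category.assoc]
    refine (congrArg (u ≫ ·) h₃).trans ((Category.assoc _ _ _).symm.trans ?_)
    refine (congrArg (· ≫ Θ.map g) h₄.symm).trans ?_
    rw [Category.assoc, Category.assoc, ← Θ.map_comp, w, Θ.map_zero, comp_zero, comp_zero]
  have h₃ : hf.lift u h₂ ≫ f = u := hf.lift_f u h₂
  have h₄ : p' ≫ t = hf.lift u h₂ ≫ η.app X := by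
    rw [← cancel_mono (Θ.map f), Category.assoc, Category.assoc]
    refine Eq.trans hu ((congrArg (· ≫ η.app Y) h₃.symm).trans ((Category.assoc _ _ _).trans ?_))
    exact congrArg (hf.lift u h₂ ≫ ·) (η.naturality f)
  rw [← cancel_epi p, ← cancel_epi p', ht, ← Category.assoc, h₄, Category.assoc,
    cokernel.condition, comp_zero, comp_zero, comp_zero]

end Mono

end

end BoundedDerived

/-! ### Generalized eigenspaces of the Casimir element and the block decomposition. -/

namespace SL2

noncomputable section

attribute [local instance 100] LieRing.ofAssociativeRing

/-! ### The Casimir element -/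

/-- The Casimir element of `U(𝔰𝔩₂)`. -/
def casimir : U := H * H + (2 : ℂ) • H + (4 : ℂ) • (F * E)

theorem casimir_commute (u : U) : casimir * u = u * casimir := by
  have hS : Subalgebra.centralizer ℂ {casimir} = ⊤ := by
    refine adjoin_eq_top _ ?_ ?_ ?_ <;> rw [Subalgebra.mem_centralizer_iff] <;>
      rintro _ rfl <;> rw [casimir]
    · have h₁ : H * H * E = E * H * H + (4 : ℂ) • (E * H) + (4 : ℂ) • E := by
        rw [mul_assoc, HE, mul_add, ← mul_assoc, HE, mul_smul_comm, HE]
        simp only [add_mul, smul_mul_assoc]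
        module
      have h₂ : F * E * E = E * F * E - E * H - (2 : ℂ) • E := by
        have h := congrArg (· * E) EF
        simp only [add_mul, HE] at h
        rw [h]
        module
      simp only [add_mul, mul_add, smul_mul_assoc, mul_smul_comm, h₁, h₂, HE]
      simp only [← mul_assoc]
      module
    · have h₁ : H * H * F = F * H * H - (4 : ℂ) • (F * H) + (4 : ℂ) • F := by
        rw [mul_assoc, HF, mul_add, ← mul_assoc, HF, mul_smul_comm, HF]
        simp only [add_mul, smul_mul_assoc]
        module
      have h₂ : F * E * F = F * F * E + F * H := by
        rw [mul_assoc, EF, mul_add, ← mul_assoc]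
      simp only [add_mul, mul_add, smul_mul_assoc, mul_smul_comm, h₁, h₂, HF]
      simp only [← mul_assoc]
      module
    · have h₂ : F * E * H = H * F * E := by
        have h := congrArg (F * ·) HE
        simp only [mul_add, ← mul_assoc] at h
        rw [HF, add_mul, smul_mul_assoc, h]
        simp only [mul_smul_comm]
        module
      simp only [add_mul, mul_add, smul_mul_assoc, mul_smul_comm, h₂]
      simp only [← mul_assoc]
  have hu : u ∈ Subalgebra.centralizer ℂ {casimir} := hS ▸ Algebra.mem_top
  exact (Subalgebra.mem_centralizer_iff ℂ).1 hu _ rfl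

section Modules

variable {M : Type*} [AddCommGroup M] [Module ℂ M] [Module U M] [IsScalarTower ℂ U M]
variable {N : Type*} [AddCommGroup N] [Module ℂ N] [Module U N] [IsScalarTower ℂ U N]

/-- A linear map commuting with `E`, `F` and `H` is `U(𝔰𝔩₂)`-linear. -/
def linearMapOfCommute (f : M →ₗ[ℂ] N) (hE : ∀ m, f (E • m) = E • f m)
    (hF : ∀ m, f (F • m) = F • f m) (hH : ∀ m, f (H • m) = H • f m) : M →ₗ[U] N where
  toFun := f
  map_add' := f.map_add
  map_smul' := by
    let S : Subalgebra ℂ U :=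
      { carrier := {u | ∀ m, f (u • m) = u • f m}
        mul_mem' := fun {a b} ha hb t => by rw [mul_smul, ha, hb, mul_smul]
        add_mem' := fun {a b} ha hb t => by rw [add_smul, map_add, ha, hb, add_smul]
        algebraMap_mem' := fun c t => by rw [algebraMap_smul, algebraMap_smul, map_smul] }
    intro u t
    have hu : u ∈ S := (adjoin_eq_top S hE hF hH) ▸ Algebra.mem_top
    exact hu t

/-- The eigenvalue of the Casimir element on highest weight vectors of weight `c`. -/
def infChar (c : ℂ) : ℂ := c * c + 2 * c

theorem infChar_eq_iff {c lam : ℂ} : infChar c = infChar lam ↔ c ∈ dotOrbit lam := by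
  have h : infChar c - infChar lam = (c - lam) * (c - (-lam - 2)) := by
    rw [infChar, infChar]; ring
  rw [← sub_eq_zero, h, mul_eq_zero, sub_eq_zero, sub_eq_zero]
  rfl

theorem casimir_smul (m : M) :
    casimir • m = H • H • m + (2 : ℂ) • H • m + (4 : ℂ) • F • E • m := by
  rw [casimir, add_smul, add_smul, mul_smul, smul_assoc, smul_assoc, mul_smul]

omit [Module ℂ M] [IsScalarTower ℂ U M] in
theorem casimir_smul_comm (u : U) (m : M) : casimir • u • m = u • casimir • m := by
  rw [← mul_smul, casimir_commute, mul_smul]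

theorem casimir_highest {c : ℂ} {m : M} (hE : E • m = 0) (hH : H • m = c • m) :
    casimir • m = infChar c • m := by
  rw [casimir_smul, hE, smul_zero, smul_zero, hH, smul_comm H, hH, infChar]
  module

variable (M) in
/-- The generalized eigenspace of the Casimir element. -/
def casimirPart (χ : ℂ) : Submodule U M where
  carrier := {m | ∃ k : ℕ, (casimir - algebraMap ℂ U χ) ^ k • m = 0}
  add_mem' := by
    rintro a b ⟨k, hk⟩ ⟨l, hl⟩
    exact ⟨k + l, by rw [smul_add, pow_add, mul_smul _ _ b, hl, (Commute.pow_pow_self _ k l).eq,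
      mul_smul, hk, smul_zero, smul_zero, add_zero]⟩
  zero_mem' := ⟨0, smul_zero _⟩
  smul_mem' u m := by
    rintro ⟨k, hk⟩
    have h : Commute ((casimir - algebraMap ℂ U χ) ^ k) u :=
      (Commute.sub_left (casimir_commute u) (Algebra.commutes χ u)).pow_left k
    exact ⟨k, by rw [← mul_smul, h.eq, mul_smul, hk, smul_zero]⟩

omit [Module ℂ M] [IsScalarTower ℂ U M] in
theorem mem_casimirPart {χ : ℂ} {m : M} :
    m ∈ casimirPart M χ ↔ ∃ k : ℕ, (casimir - algebraMap ℂ U χ) ^ k • m = 0 := Iff.rfl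

theorem mem_casimirPart_iff {χ : ℂ} {m : M} :
    m ∈ casimirPart M χ ↔ m ∈ Module.End.maxGenEigenspace (Algebra.lsmul ℂ ℂ M casimir) χ := by
  rw [mem_casimirPart, Module.End.mem_maxGenEigenspace]
  have h : Algebra.lsmul ℂ ℂ M casimir - χ • 1
      = Algebra.lsmul ℂ ℂ M (casimir - algebraMap ℂ U χ) := by
    rw [map_sub, AlgHom.commutes, Algebra.algebraMap_eq_smul_one]
  simp only [h, ← map_pow]
  rfl

omit [Module ℂ M] [IsScalarTower ℂ U M] [Module ℂ N] [IsScalarTower ℂ U N] in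
theorem map_casimirPart (χ : ℂ) (f : M →ₗ[U] N) {m : M} (hm : m ∈ casimirPart M χ) :
    f m ∈ casimirPart N χ := by
  obtain ⟨k, hk⟩ := hm
  exact ⟨k, by rw [← map_smul, hk, map_zero]⟩

theorem eq_zero_of_mem_casimirPart {χ χ' : ℂ} (h : χ ≠ χ') {m : M} (h₁ : m ∈ casimirPart M χ)
    (h₂ : m ∈ casimirPart M χ') : m = 0 :=
  Submodule.disjoint_def.1 ((Module.End.independent_maxGenEigenspace
    (Algebra.lsmul ℂ ℂ M casimir)).pairwiseDisjoint h) m (mem_casimirPart_iff.1 h₁)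
    (mem_casimirPart_iff.1 h₂)

theorem mem_casimirPart_of_eigen {χ : ℂ} {m : M} (h : casimir • m = χ • m) :
    m ∈ casimirPart M χ :=
  ⟨1, by rw [pow_one, sub_smul, h, algebraMap_smul, sub_self]⟩

/-- A highest weight vector of weight `c` in a quotient is a Casimir eigenvector with eigenvalue
`infChar c`, and generalized eigenspaces for different eigenvalues meet in zero. The weights with
the same `infChar` as `lam` form its dot-orbit. -/
theorem highestWeightsIn_casimirPart (lam : ℂ) :
    HighestWeightsIn (dotOrbit lam) (casimirPart M (infChar lam)) := by
  rintro Q v c ⟨k, hk⟩ hvQ hE hH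
  let π := Q.mkQ
  have hv : π v ≠ 0 := fun h => hvQ ((Submodule.Quotient.mk_eq_zero Q).1 h)
  have h₁ : casimir • π v = infChar c • π v := casimir_highest
    ((Submodule.Quotient.mk_eq_zero Q).2 hE)
    (sub_eq_zero.1 ((Submodule.Quotient.mk_eq_zero Q).2 hH))
  by_contra hc
  exact hv (eq_zero_of_mem_casimirPart (fun h => hc (infChar_eq_iff.1 h))
    (mem_casimirPart_of_eigen h₁) ⟨k, by rw [← map_smul, hk, map_zero]⟩)

/-- The Casimir element commutes with `H`, so it acts on each weight space, which is
finite-dimensional over ℂ and hence the sum of its generalized eigenspaces. -/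
theorem iSup_casimirPart (h : ⨆ c : ℂ, weightSpace M c = ⊤)
    (hfd : ∀ c : ℂ, FiniteDimensional ℂ (weightSpace M c)) :
    ⨆ χ, Module.End.maxGenEigenspace (Algebra.lsmul ℂ ℂ M casimir) χ = ⊤ := by
  rw [← top_le_iff, ← h, iSup_le_iff]
  intro c m hm
  have := hfd c
  have hst : ∀ x ∈ weightSpace M c, Algebra.lsmul ℂ ℂ M casimir x ∈ weightSpace M c := by
    intro x hx
    rw [mem_weightSpace] at hx ⊢
    change H • casimir • x = c • casimir • x
    rw [← casimir_smul_comm, hx, smul_comm]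
  have htop := Module.End.iSup_maxGenEigenspace_eq_top ((Algebra.lsmul ℂ ℂ M casimir).restrict hst)
  have hmem : (⟨m, hm⟩ : weightSpace M c) ∈ ⨆ χ, Module.End.maxGenEigenspace
    ((Algebra.lsmul ℂ ℂ M casimir).restrict hst) χ := htop ▸ Submodule.mem_top
  have hmap := Submodule.mem_map_of_mem (f := (weightSpace M c).subtype) hmem
  rw [Submodule.map_iSup] at hmap
  suffices hle : ∀ χ, (Module.End.maxGenEigenspace
      ((Algebra.lsmul ℂ ℂ M casimir).restrict hst) χ).map (weightSpace M c).subtype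
      ≤ Module.End.maxGenEigenspace (Algebra.lsmul ℂ ℂ M casimir) χ from iSup_mono hle hmap
  intro χ
  rw [Submodule.map_le_iff_le_comap]
  exact (Module.End.genEigenspace_restrict _ _ _ _ hst).le

theorem exists_highest_of_ne_zero {c : ℂ} {m : M} (hnil : ∃ k : ℕ, E ^ k • m = 0) (hm : m ≠ 0)
    (hc : H • m = c • m) : ∃ k : ℕ, E ^ k • m ≠ 0 ∧ E • E ^ k • m = 0 ∧
      H • E ^ k • m = (c + 2 * k) • E ^ k • m := by
  classical
  let k := Nat.find hnil
  have hk : E ^ k • m = 0 := Nat.find_spec hnil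
  have hk0 : k ≠ 0 := fun h0 => hm (by rw [h0] at hk; simpa using hk)
  obtain ⟨l, hl⟩ := Nat.exists_eq_succ_of_ne_zero hk0
  refine ⟨l, Nat.find_min hnil (show l < k by omega), ?_, E_weight hc l⟩
  rw [← mul_smul, ← pow_succ']
  rwa [hl] at hk

/-- A nonzero generalized eigenspace contains an eigenvector, whose weight components are
eigenvectors as well. The last nonzero vector obtained from such a component by powers of `E` is a
highest weight vector with the same eigenvalue, and `hw` determines that eigenvalue. -/
theorem casimirPart_eq_top {lam : ℂ} (h : ⨆ c : ℂ, weightSpace M c = ⊤)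
    (hnil : ∀ m : M, ∃ k : ℕ, E ^ k • m = 0)
    (hfd : ∀ c : ℂ, FiniteDimensional ℂ (weightSpace M c))
    (hw : ∀ (m : M) (c : ℂ), m ≠ 0 → E • m = 0 → H • m = c • m → c ∈ dotOrbit lam) :
    casimirPart M (infChar lam) = ⊤ := by
  have hbot : ∀ χ, χ ≠ infChar lam →
      Module.End.maxGenEigenspace (Algebra.lsmul ℂ ℂ M casimir) χ = ⊥ := by
    intro χ hχ
    refine (Submodule.eq_bot_iff _).2 fun x hx => ?_
    by_contra hx0
    classical
    have hex := mem_casimirPart_iff.2 hx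
    let k := Nat.find hex
    have hk : (casimir - algebraMap ℂ U χ) ^ k • x = 0 := Nat.find_spec hex
    have hk0 : k ≠ 0 := fun h0 => hx0 (by rw [h0] at hk; simpa using hk)
    obtain ⟨l, hl⟩ := Nat.exists_eq_succ_of_ne_zero hk0
    have hy0 := Nat.find_min hex (show l < k by omega)
    rw [hl, pow_succ', mul_smul] at hk
    obtain ⟨s, y, hy, hsum⟩ := weight_sum h ((casimir - algebraMap ℂ U χ) ^ l • x)
    let P : Submodule ℂ M := LinearMap.ker (Algebra.lsmul ℂ ℂ M (casimir - algebraMap ℂ U χ))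
    have hP : ∀ z ∈ P, H • z ∈ P := by
      intro z hz
      change (casimir - algebraMap ℂ U χ) • H • z = 0
      have hz' : (casimir - algebraMap ℂ U χ) • z = 0 := hz
      rw [← mul_smul, (Commute.sub_left (casimir_commute H) (Algebra.commutes χ H)).eq, mul_smul,
        hz', smul_zero]
    have hyP := comp_mem P hP s y (fun c _ => hy c) (hsum ▸ hk)
    obtain ⟨c, hc, hyc⟩ : ∃ c ∈ s, y c ≠ 0 := by
      by_contra! hall
      exact hy0 (hsum ▸ Finset.sum_eq_zero hall)
    obtain ⟨j, hj0, hjE, hjH⟩ := exists_highest_of_ne_zero (hnil _) hyc (hy c)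
    have h₁ := hw _ _ hj0 hjE hjH
    have h₂ : casimir • y c = χ • y c := by
      have h₃ : (casimir - algebraMap ℂ U χ) • y c = 0 := hyP c hc
      rwa [sub_smul, algebraMap_smul, sub_eq_zero] at h₃
    have h₃ : casimir • E ^ j • y c = χ • E ^ j • y c := by
      rw [casimir_smul_comm, h₂, smul_comm]
    rw [casimir_highest hjE hjH, infChar_eq_iff.2 h₁] at h₃
    exact hχ (smul_left_injective ℂ hj0 h₃).symm
  refine eq_top_iff.2 fun m _ => mem_casimirPart_iff.2 ?_
  have hm : m ∈ ⨆ χ, Module.End.maxGenEigenspace (Algebra.lsmul ℂ ℂ M casimir) χ :=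
    iSup_casimirPart h hfd ▸ Submodule.mem_top
  suffices hle : ∀ χ, Module.End.maxGenEigenspace (Algebra.lsmul ℂ ℂ M casimir) χ
      ≤ Module.End.maxGenEigenspace (Algebra.lsmul ℂ ℂ M casimir) (infChar lam) from
    iSup_le hle hm
  intro χ
  by_cases hχ : χ = infChar lam
  · rw [hχ]
  · rw [hbot χ hχ]
    exact bot_le

theorem IsInBlock.casimirPart_eq_top {lam : ℂ} (h : IsInBlock M lam) :
    casimirPart M (infChar lam) = ⊤ :=
  SL2.casimirPart_eq_top h.isCatO.weight h.isCatO.nil h.isCatO.finite_weightSpace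
    fun m c hm hE hH => h.highestWeights ⊥ m c Submodule.mem_top hm ((Submodule.mem_bot U).2 hE)
      ((Submodule.mem_bot U).2 (sub_eq_zero.2 hH))

theorem IsInBlock.mem_dotOrbit {lam : ℂ} (h : IsInBlock M lam) {c : ℂ} {m : M} (hm : m ≠ 0)
    (hE : E • m = 0) (hH : H • m = c • m) : c ∈ dotOrbit lam :=
  h.highestWeights ⊥ m c Submodule.mem_top hm ((Submodule.mem_bot U).2 hE)
    ((Submodule.mem_bot U).2 (sub_eq_zero.2 hH))

theorem blockPart_eq_top {lam : ℂ} (h : casimirPart M (infChar lam) = ⊤) :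
    blockPart M lam = ⊤ :=
  top_le_iff.1 (h ▸ le_blockPart (highestWeightsIn_casimirPart lam))

/-- Trades the description by composition factors for one that has a canonical complement, which is
what makes translation a direct summand and not only a submodule. -/
theorem blockPart_eq_casimirPart (lam : ℂ) (h : ⨆ c : ℂ, weightSpace M c = ⊤)
    (hnil : ∀ m : M, ∃ k : ℕ, E ^ k • m = 0)
    (hfd : ∀ c : ℂ, FiniteDimensional ℂ (weightSpace M c)) :
    blockPart M lam = casimirPart M (infChar lam) := by
  refine le_antisymm (fun m hm => ?_) (le_blockPart (highestWeightsIn_casimirPart lam))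
  have hB : IsInBlock (blockPart M lam) lam := isInBlock_of_injective (blockPart M lam).subtype
    Subtype.val_injective h hnil hfd
    (by rw [Submodule.range_subtype]; exact highestWeightsIn_blockPart lam)
  have hmem : (⟨m, hm⟩ : blockPart M lam) ∈ casimirPart (blockPart M lam) (infChar lam) :=
    hB.casimirPart_eq_top ▸ Submodule.mem_top
  exact map_casimirPart _ (blockPart M lam).subtype hmem

variable (M) in
/-- The sum of the generalized eigenspaces of the Casimir element for the other eigenvalues. -/
def casimirCompl (χ : ℂ) : Submodule U M := ⨆ χ' : {χ' : ℂ // χ' ≠ χ}, casimirPart M χ'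

theorem isCompl_casimirCompl (h : ⨆ c : ℂ, weightSpace M c = ⊤)
    (hfd : ∀ c : ℂ, FiniteDimensional ℂ (weightSpace M c)) (χ : ℂ) :
    IsCompl (casimirPart M χ) (casimirCompl M χ) where
  disjoint := by
    rw [Submodule.disjoint_def]
    intro m hm hm'
    have hind := Module.End.independent_maxGenEigenspace (Algebra.lsmul ℂ ℂ M casimir) χ
    refine Submodule.disjoint_def.1 hind m (mem_casimirPart_iff.1 hm) ?_
    refine Submodule.iSup_induction _ (motive := fun x => x ∈ ⨆ (χ' : ℂ) (_ : χ' ≠ χ),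
      Module.End.maxGenEigenspace (Algebra.lsmul ℂ ℂ M casimir) χ') hm' (fun χ' x hx => ?_)
      (Submodule.zero_mem _) (fun _ _ => Submodule.add_mem _)
    exact Submodule.mem_iSup_of_mem χ'.1
      (Submodule.mem_iSup_of_mem χ'.2 (mem_casimirPart_iff.1 hx))
  codisjoint := by
    rw [codisjoint_iff, eq_top_iff]
    intro m _
    have hm : m ∈ ⨆ χ, Module.End.maxGenEigenspace (Algebra.lsmul ℂ ℂ M casimir) χ :=
      iSup_casimirPart h hfd ▸ Submodule.mem_top
    have hle : ⨆ χ, Module.End.maxGenEigenspace (Algebra.lsmul ℂ ℂ M casimir) χ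
        ≤ (casimirPart M χ ⊔ casimirCompl M χ).restrictScalars ℂ := iSup_le fun χ' x hx => ?_
    · exact hle hm
    by_cases hχ : χ' = χ
    · exact Submodule.mem_sup_left (mem_casimirPart_iff.2 (hχ ▸ hx))
    · exact Submodule.mem_sup_right (Submodule.mem_iSup_of_mem ⟨χ', hχ⟩
        (mem_casimirPart_iff.2 hx))

omit [Module ℂ M] [IsScalarTower ℂ U M] in
theorem map_casimirCompl {χ : ℂ} (f : M →ₗ[U] N) (hN : casimirPart N χ = ⊤) {m : M}
    (hm : m ∈ casimirCompl M χ) : f m = 0 := by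
  have hle : casimirCompl M χ ≤ LinearMap.ker f := iSup_le fun χ' x hx =>
    eq_zero_of_mem_casimirPart χ'.2 (map_casimirPart χ' f hx) (hN ▸ Submodule.mem_top)
  exact hle hm

end Modules

end

end SL2

/-! ### Self-duality of L(1) and the biadjunction of translation functors. -/

namespace SL2

noncomputable section

attribute [local instance 100] LieRing.ofAssociativeRing
attribute [local instance] ModuleCat.moduleOfAlgebraModule
attribute [local instance] ModuleCat.isScalarTower_of_algebra_moduleCat

open scoped TensorProduct

/-! ### Coordinates on `M ⊗ L(1)` -/

section Coord

variable {M : Type} [AddCommGroup M] [Module ℂ M]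

/-- The coordinates of an element of `M ⊗ L(1)` with respect to the standard basis of `L(1)`. -/
def coord (i : Fin 2) : TensorV M →ₗ[ℂ] M :=
  (TensorProduct.rid ℂ M).toLinearMap ∘ₗ (LinearMap.proj i : (Fin 2 → ℂ) →ₗ[ℂ] ℂ).lTensor M

theorem coord_tens (i : Fin 2) (m : M) (v : Fin 2 → ℂ) : coord i (tens m v) = v i • m :=
  TensorProduct.rid_tmul _ _

theorem tens_add (m m' : M) (v : Fin 2 → ℂ) : tens (m + m') v = tens m v + tens m' v :=
  TensorProduct.add_tmul _ _ _

theorem tens_smul (c : ℂ) (m : M) (v : Fin 2 → ℂ) : tens (c • m) v = c • tens m v :=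
  TensorProduct.smul_tmul' _ _ _

theorem eq_tens_coord (t : TensorV M) :
    t = tens (coord 0 t) (Pi.single 0 1) + tens (coord 1 t) (Pi.single 1 1) := by
  refine tens_induction (p := fun t => t = tens (coord 0 t) (Pi.single 0 1) +
    tens (coord 1 t) (Pi.single 1 1)) ?_ (fun m v => ?_) (fun a b ha hb => ?_) t
  · simp [zero_tens]
  · rw [coord_tens, coord_tens, tens_smul, tens_smul]
    exact tens_eq m v
  · rw [map_add, map_add, tens_add, tens_add, add_add_add_comm, ← ha, ← hb]

theorem coord_ext {t t' : TensorV M} (h₀ : coord 0 t = coord 0 t') (h₁ : coord 1 t = coord 1 t') :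
    t = t' := by
  rw [eq_tens_coord t, eq_tens_coord t', h₀, h₁]

variable [Module U M] [IsScalarTower ℂ U M]

theorem naturalRep_E₀ (v : Fin 2 → ℂ) : naturalRep E₀ v = ![v 1, 0] := by
  ext i; fin_cases i <;>
    simp [naturalRep, E₀, Matrix.single, Matrix.mulVec, dotProduct]

theorem naturalRep_F₀ (v : Fin 2 → ℂ) : naturalRep F₀ v = ![0, v 0] := by
  ext i; fin_cases i <;>
    simp [naturalRep, F₀, Matrix.single, Matrix.mulVec, dotProduct]

theorem naturalRep_H₀ (v : Fin 2 → ℂ) : naturalRep H₀ v = ![v 0, - v 1] := by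
  ext i; fin_cases i <;>
    simp [naturalRep, H₀, Matrix.single, Matrix.mulVec, dotProduct]

theorem E_tens (m : M) (v : Fin 2 → ℂ) : E • tens m v = tens (E • m) v + tens m ![v 1, 0] := by
  rw [E, ι_tens, naturalRep_E₀]

theorem F_tens (m : M) (v : Fin 2 → ℂ) : F • tens m v = tens (F • m) v + tens m ![0, v 0] := by
  rw [F, ι_tens, naturalRep_F₀]

theorem H_tens (m : M) (v : Fin 2 → ℂ) : H • tens m v = tens (H • m) v + tens m ![v 0, - v 1] := by
  rw [H, ι_tens, naturalRep_H₀]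

theorem coord_smul_of_tens (u : U) (i : Fin 2) (g : TensorV M →ₗ[ℂ] M)
    (h : ∀ m v, coord i (u • tens m v) = g (tens m v)) (t : TensorV M) :
    coord i (u • t) = g t := by
  refine tens_induction (p := fun t => coord i (u • t) = g t) (by simp) h
    (fun a b ha hb => by rw [smul_add, map_add, map_add, ha, hb]) t

theorem coord_zero_E (t : TensorV M) : coord 0 (E • t) = E • coord 0 t + coord 1 t :=
  coord_smul_of_tens E 0 (Algebra.lsmul ℂ ℂ M E ∘ₗ coord 0 + coord 1) (fun m v => by
    rw [E_tens]
    simp [coord_tens, smul_comm E]) t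

theorem coord_one_E (t : TensorV M) : coord 1 (E • t) = E • coord 1 t :=
  coord_smul_of_tens E 1 (Algebra.lsmul ℂ ℂ M E ∘ₗ coord 1) (fun m v => by
    rw [E_tens]
    simp [coord_tens, smul_comm E]) t

theorem coord_zero_F (t : TensorV M) : coord 0 (F • t) = F • coord 0 t :=
  coord_smul_of_tens F 0 (Algebra.lsmul ℂ ℂ M F ∘ₗ coord 0) (fun m v => by
    rw [F_tens]
    simp [coord_tens, smul_comm F]) t

theorem coord_one_F (t : TensorV M) : coord 1 (F • t) = F • coord 1 t + coord 0 t :=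
  coord_smul_of_tens F 1 (Algebra.lsmul ℂ ℂ M F ∘ₗ coord 1 + coord 0) (fun m v => by
    rw [F_tens]
    simp [coord_tens, smul_comm F]) t

theorem coord_zero_H (t : TensorV M) : coord 0 (H • t) = H • coord 0 t + coord 0 t :=
  coord_smul_of_tens H 0 (Algebra.lsmul ℂ ℂ M H ∘ₗ coord 0 + coord 0) (fun m v => by
    rw [H_tens]
    simp [coord_tens, smul_comm H]) t

theorem coord_one_H (t : TensorV M) : coord 1 (H • t) = H • coord 1 t - coord 1 t :=
  coord_smul_of_tens H 1 (Algebra.lsmul ℂ ℂ M H ∘ₗ coord 1 - coord 1) (fun m v => by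
    rw [H_tens]
    simp [coord_tens, smul_comm H, sub_eq_add_neg]) t

theorem coord_tensorMap {N : Type} [AddCommGroup N] [Module ℂ N] [Module U N] [IsScalarTower ℂ U N]
    (f : M →ₗ[U] N) (i : Fin 2) (t : TensorV M) : coord i (tensorMap f t) = f (coord i t) := by
  refine tens_induction (p := fun t => coord i (tensorMap f t) = f (coord i t)) (by simp)
    (fun m v => ?_) (fun a b ha hb => by rw [map_add, map_add, ha, hb, map_add, map_add]) t
  rw [show tensorMap f (tens m v) = tens (f m) v from rfl, coord_tens, coord_tens,
    LinearMap.map_smul_of_tower]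

/-- The copairing `M → M ⊗ L(1) ⊗ L(1)`. -/
def coev : M →ₗ[U] TensorV (TensorV M) :=
  let f : M →ₗ[ℂ] TensorV (TensorV M) :=
    -- The antisymmetric tensor of the two basis vectors is the invariant of L(1) ⊗ L(1).
    { toFun := fun m => tens (tens m (Pi.single 0 1)) (Pi.single 1 1) -
        tens (tens m (Pi.single 1 1)) (Pi.single 0 1)
      map_add' := fun m m' => by simp only [tens_add]; abel
      map_smul' := fun c m => by simp only [tens_smul, smul_sub, RingHom.id_apply] }
  have hf (m : M) : f m = tens (tens m (Pi.single 0 1)) (Pi.single 1 1) -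
        tens (tens m (Pi.single 1 1)) (Pi.single 0 1) := rfl
  linearMapOfCommute f
    (fun m => by
      refine coord_ext (coord_ext ?_ ?_) (coord_ext ?_ ?_) <;>
        simp [hf, coord_zero_E, coord_one_E, coord_tens])
    (fun m => by
      refine coord_ext (coord_ext ?_ ?_) (coord_ext ?_ ?_) <;>
        simp [hf, coord_zero_F, coord_one_F, coord_tens])
    (fun m => by
      refine coord_ext (coord_ext ?_ ?_) (coord_ext ?_ ?_) <;>
        simp [hf, coord_zero_H, coord_one_H, coord_tens]
      abel)

theorem coord_zero_coev (m : M) : coord 0 (coev m) = - tens m (Pi.single 1 1) := by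
  change coord 0 (tens (tens m (Pi.single 0 1)) (Pi.single 1 1) -
        tens (tens m (Pi.single 1 1)) (Pi.single 0 1)) = _
  simp [coord_tens]

theorem coord_one_coev (m : M) : coord 1 (coev m) = tens m (Pi.single 0 1) := by
  change coord 1 (tens (tens m (Pi.single 0 1)) (Pi.single 1 1) -
        tens (tens m (Pi.single 1 1)) (Pi.single 0 1)) = _
  simp [coord_tens]

/-- The pairing `M ⊗ L(1) ⊗ L(1) → M`. -/
def ev : TensorV (TensorV M) →ₗ[U] M :=
  -- The invariant symplectic form of L(1), with the sign that makes the triangle identity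
  -- `ev_tensorMap_coev` hold.
  linearMapOfCommute (coord 1 ∘ₗ coord 0 - coord 0 ∘ₗ coord 1)
    (fun t => by simp [coord_zero_E, coord_one_E, smul_sub])
    (fun t => by simp [coord_zero_F, coord_one_F, smul_sub])
    (fun t => by simp [coord_zero_H, coord_one_H, smul_sub])

theorem ev_apply (t : TensorV (TensorV M)) :
    ev t = coord 1 (coord 0 t) - coord 0 (coord 1 t) := rfl

/-- A triangle identity for the self-adjunction of tensoring with L(1), before projecting to blocks.
-/
theorem ev_tensorMap_coev (t : TensorV M) : ev (tensorMap coev t) = t := by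
  rw [ev_apply, coord_tensorMap, coord_tensorMap, coord_zero_coev, coord_one_coev, sub_neg_eq_add]
  exact (eq_tens_coord t).symm

end Coord

/-! ### Biadjointness of translation functors -/

section Adjunction

variable {lam mu : ℂ}

theorem casimirPart_obj (N : Block lam) : casimirPart N.obj (infChar lam) = ⊤ :=
  IsInBlock.casimirPart_eq_top N.property

theorem blockPart_obj (N : Block lam) : blockPart N.obj lam = ⊤ :=
  blockPart_eq_top (casimirPart_obj N)

theorem isCompl_blockPart (mu : ℂ) (M : Block lam) :
    IsCompl (blockPart (TensorV M.obj) mu) (casimirCompl (TensorV M.obj) (infChar mu)) := by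
  have h₁ := tensorV_weight M.property.isCatO.weight
  have h₂ := tensorV_finite M.property.isCatO.weight M.property.isCatO.finite_weightSpace
  rw [blockPart_eq_casimirPart mu h₁
    (tensorV_nil M.property.isCatO.weight M.property.isCatO.nil) h₂]
  exact isCompl_casimirCompl h₁ h₂ _

/-- The inclusion of a translation into the tensor product. -/
def translationIncl (mu : ℂ) (M : Block lam) :
    ((translation lam mu).obj M).obj →ₗ[U] TensorV M.obj :=
  (blockPart (TensorV M.obj) mu).subtype

/-- The projection of the tensor product onto a translation. -/
def translationProj (mu : ℂ) (M : Block lam) :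
    TensorV M.obj →ₗ[U] ((translation lam mu).obj M).obj :=
  Submodule.projectionOnto _ _ (isCompl_blockPart mu M)

theorem translationIncl_injective (mu : ℂ) (M : Block lam) :
    Function.Injective (translationIncl mu M) := Subtype.val_injective

theorem translationProj_incl (M : Block lam) (t : ((translation lam mu).obj M).obj) :
    translationProj mu M (translationIncl mu M t) = t :=
  Submodule.projectionOnto_apply_left (isCompl_blockPart mu M) t

/-- A map into the block of `mu` kills the complementary summand, where the Casimir element has
other eigenvalues. This makes the projections in the unit invisible in the triangle identities. -/
theorem apply_translationIncl_proj (M : Block lam) (N : Block mu) (f : TensorV M.obj →ₗ[U] N.obj)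
    (t : TensorV M.obj) : f (translationIncl mu M (translationProj mu M t)) = f t := by
  have h := Submodule.mem_sup.1 ((isCompl_blockPart mu M).sup_eq_top ▸ Submodule.mem_top (x := t))
  obtain ⟨a, ha, b, hb, rfl⟩ := h
  have hb' : translationProj mu M b = 0 :=
    Submodule.projectionOnto_apply_right (isCompl_blockPart mu M) ⟨b, hb⟩
  have ha' : translationProj mu M a = ⟨a, ha⟩ := translationProj_incl M ⟨a, ha⟩
  have h₁ : translationProj mu M (a + b) = ⟨a, ha⟩ :=
    (map_add _ a b).trans ((congrArg₂ _ ha' hb').trans (add_zero _))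
  rw [h₁, map_add, map_casimirCompl f (casimirPart_obj N) hb, add_zero]
  rfl

theorem translationIncl_map {M N : Block lam} (f : M ⟶ N) (t : ((translation lam mu).obj M).obj) :
    translationIncl mu N (((translation lam mu).map f).hom.hom t)
      = tensorMap f.hom.hom (translationIncl mu M t) := rfl

theorem translationProj_tensorMap {M N : Block lam} (f : M ⟶ N) (t : TensorV M.obj) :
    translationProj mu N (tensorMap f.hom.hom t)
      = ((translation lam mu).map f).hom.hom (translationProj mu M t) := by
  have h := apply_translationIncl_proj M ((translation lam mu).obj N)
    ((translationProj mu N).comp (tensorMap f.hom.hom)) t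
  rw [LinearMap.comp_apply, LinearMap.comp_apply, ← translationIncl_map] at h
  exact h.symm.trans (translationProj_incl _ _)

variable (lam mu) in
/-- The unit of the adjunction between translation functors. -/
def translationUnit : 𝟭 (Block lam) ⟶ translation lam mu ⋙ translation mu lam where
  app M := ObjectProperty.homMk (ModuleCat.ofHom
    (((tensorMap (translationProj mu M)).comp (coev (M := M.obj))).codRestrict
      (blockPart (TensorV ((translation lam mu).obj M).obj) lam)
      fun m => map_blockPart lam _ (blockPart_obj M ▸ Submodule.mem_top)))
  naturality M N f := by
    ext m
    refine translationIncl_injective _ _ ?_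
    change tensorMap (translationProj mu N) (coev (f.hom.hom m))
      = tensorMap ((translation lam mu).map f).hom.hom
        (tensorMap (translationProj mu M) (coev (M := M.obj) m))
    refine coord_ext ?_ ?_ <;>
      rw [coord_tensorMap, coord_tensorMap, coord_tensorMap, ← translationProj_tensorMap]
    · rw [coord_zero_coev, coord_zero_coev, map_neg (tensorMap f.hom.hom)]
      rfl
    · rw [coord_one_coev, coord_one_coev]
      rfl

variable (lam mu) in
/-- The counit of the adjunction between translation functors. -/
def translationCounit : translation mu lam ⋙ translation lam mu ⟶ 𝟭 (Block mu) where
  app N := ObjectProperty.homMk (ModuleCat.ofHom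
    ((ev (M := N.obj)).comp ((tensorMap (translationIncl lam N)).comp
      (translationIncl mu ((translation mu lam).obj N)))))
  naturality M N f := by
    ext t
    change ev (tensorMap (translationIncl lam N) (tensorMap ((translation mu lam).map f).hom.hom
        (translationIncl mu ((translation mu lam).obj M) t)))
      = f.hom.hom (ev (tensorMap (translationIncl lam M)
        (translationIncl mu ((translation mu lam).obj M) t)))
    simp only [ev_apply, coord_tensorMap, translationIncl_map, map_sub]

theorem translationIncl_unit (M : Block lam) (m : M.obj) :
    translationIncl lam ((translation lam mu).obj M) (((translationUnit lam mu).app M).hom.hom m)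
      = tensorMap (translationProj mu M) (coev m) := rfl

variable (lam mu) in
/-- Translation functors between two blocks are adjoint to each other. -/
def translationAdjunction : translation lam mu ⊣ translation mu lam :=
  Adjunction.mkOfUnitCounit
    { unit := translationUnit lam mu
      counit := translationCounit lam mu
      left_triangle := by
        ext M t
        change ev (tensorMap (translationIncl lam ((translation lam mu).obj M))
          (tensorMap ((translationUnit lam mu).app M).hom.hom (translationIncl mu M t))) = t
        have h := congrArg (translationProj mu M) (ev_tensorMap_coev (translationIncl mu M t))
        rw [translationProj_incl] at h
        refine Eq.trans ?_ h
        simp only [ev_apply, coord_tensorMap, map_sub]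
        exact congrArg₂ _
          ((congrArg (coord 1) (translationIncl_unit M _)).trans (coord_tensorMap _ _ _))
          ((congrArg (coord 0) (translationIncl_unit M _)).trans (coord_tensorMap _ _ _))
      right_triangle := by
        ext N t
        refine translationIncl_injective _ _ ?_
        change tensorMap ((translationCounit lam mu).app N).hom.hom
          (tensorMap (translationProj mu ((translation mu lam).obj N)) (coev t))
          = translationIncl lam N t
        have h (x : TensorV ((translation mu lam).obj N).obj) :
            ((translationCounit lam mu).app N).hom.hom
              (translationProj mu ((translation mu lam).obj N) x)
            = ev (tensorMap (translationIncl lam N) x) :=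
          apply_translationIncl_proj _ N (ev.comp (tensorMap (translationIncl lam N))) x
        refine coord_ext ?_ ?_ <;> rw [coord_tensorMap, coord_tensorMap, h, ev_apply,
          coord_tensorMap, coord_tensorMap]
        · rw [coord_zero_coev]
          simp [coord_tens]
        · rw [coord_one_coev]
          simp [coord_tens] }

end Adjunction

end

end SL2

/-! ### Weight spaces under module maps, and Verma modules. -/

namespace SL2

noncomputable section

attribute [local instance 100] LieRing.ofAssociativeRing

/-! ### Weight spaces and module maps -/

section Weights

variable {M : Type*} [AddCommGroup M] [Module ℂ M] [Module U M] [IsScalarTower ℂ U M]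
variable {N : Type*} [AddCommGroup N] [Module ℂ N] [Module U N] [IsScalarTower ℂ U N]

/-- The map on weight spaces induced by a module map. -/
def weightMap (f : M →ₗ[U] N) (c : ℂ) : weightSpace M c →ₗ[ℂ] weightSpace N c :=
  (f.restrictScalars ℂ).restrict fun m hm => by
    rw [mem_weightSpace] at hm ⊢
    change H • f m = c • f m
    rw [← map_smul, hm, LinearMap.map_smul_of_tower]

@[simp]
theorem coe_weightMap (f : M →ₗ[U] N) (c : ℂ) (m : weightSpace M c) :
    (weightMap f c m : N) = f m := rfl

theorem weightMap_injective {f : M →ₗ[U] N} (hf : Function.Injective f) (c : ℂ) :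
    Function.Injective (weightMap f c) := fun _ _ h => Subtype.ext (hf (congrArg Subtype.val h))

/-- Lift the vector arbitrarily and split the lift into weight vectors. By independence of weight
spaces, the component of weight `c` already maps to the given vector. -/
theorem weightMap_surjective {f : M →ₗ[U] N} (hf : Function.Surjective f)
    (h : ⨆ c : ℂ, weightSpace M c = ⊤) (c : ℂ) : Function.Surjective (weightMap f c) := by
  classical
  rintro ⟨n, hn⟩
  rw [mem_weightSpace] at hn
  obtain ⟨m, rfl⟩ := hf n
  obtain ⟨s, y, hy, rfl⟩ := weight_sum h m
  -- `z d` is the component of weight `d` of the difference between the image of the lift and the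
  -- given vector, so the sum of all `z d` is zero.
  let z : ℂ → N := fun d => (if d ∈ s then f (y d) else 0) -
    (if d = c then f (∑ d ∈ s, y d) else 0)
  have hz : ∀ d ∈ insert c s, H • z d = d • z d := by
    intro d _
    have h₁ : H • f (y d) = d • f (y d) := by rw [← map_smul, hy, LinearMap.map_smul_of_tower]
    by_cases hd : d = c
    · subst hd
      by_cases hs : d ∈ s <;> simp [z, hs, smul_sub, h₁, hn, -map_sum]
    · by_cases hs : d ∈ s <;> simp [z, hs, hd, h₁]
  have hsum : ∑ d ∈ insert c s, z d ∈ (⊥ : Submodule ℂ N) := by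
    rw [Submodule.mem_bot, Finset.sum_sub_distrib, Finset.sum_ite_eq' (insert c s) c,
      if_pos (Finset.mem_insert_self c s), ← Finset.sum_filter, map_sum, sub_eq_zero]
    refine Finset.sum_congr ?_ fun _ _ => rfl
    ext d
    simp +contextual
  have hc := comp_mem ⊥ (fun x hx => by
    rw [(Submodule.mem_bot ℂ).1 hx, smul_zero]; exact Submodule.zero_mem _) _ z hz hsum c
    (Finset.mem_insert_self c s)
  rw [Submodule.mem_bot] at hc
  simp only [z, if_true, sub_eq_zero] at hc
  by_cases hs : c ∈ s
  · rw [if_pos hs] at hc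
    exact ⟨⟨y c, mem_weightSpace.2 (hy c)⟩, Subtype.ext hc⟩
  · rw [if_neg hs] at hc
    exact ⟨0, Subtype.ext ((map_zero f).trans hc)⟩

/-- A nonzero kernel is a sum of weight spaces on which `E` is locally nilpotent, so it contains a
highest weight vector. Its weight lies in the dot-orbit, where `f` is injective. -/
theorem IsInBlock.injective_of_weight {lam : ℂ} (hM : IsInBlock M lam) {f : M →ₗ[U] N}
    (h : ∀ c ∈ dotOrbit lam, Function.Injective (weightMap f c)) : Function.Injective f := by
  rw [injective_iff_map_eq_zero]
  intro m hm
  obtain ⟨s, y, hy, rfl⟩ := weight_sum hM.isCatO.weight m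
  have hker := comp_mem ((LinearMap.ker f).restrictScalars ℂ)
    (fun x hx => (LinearMap.ker f).smul_mem H hx) s y (fun c _ => hy c) hm
  refine Finset.sum_eq_zero fun c hc => ?_
  by_contra hne
  obtain ⟨k, hk0, hkE, hkH⟩ := exists_highest_of_ne_zero (hM.isCatO.nil _) hne (hy c)
  refine hk0 (congrArg Subtype.val (@h _ (hM.mem_dotOrbit hk0 hkE hkH)
    ⟨_, mem_weightSpace.2 hkH⟩ 0 (Subtype.ext ?_)))
  rw [coe_weightMap, map_smul, show f (y c) = 0 from hker c hc, smul_zero, map_zero]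
  rfl

/-- A nonzero cokernel has a highest weight vector that lifts to a weight vector of `N`. Its weight
lies in the dot-orbit, where `f` is surjective. -/
theorem IsInBlock.surjective_of_weight {lam : ℂ} (hN : IsInBlock N lam) {f : M →ₗ[U] N}
    (h : ∀ c ∈ dotOrbit lam, Function.Surjective (weightMap f c)) : Function.Surjective f := by
  classical
  intro n
  change n ∈ LinearMap.range f
  obtain ⟨s, y, hy, rfl⟩ := weight_sum hN.isCatO.weight n
  refine Submodule.sum_mem _ fun c _ => ?_
  by_contra hne
  let π := (LinearMap.range f).mkQ
  have hπ (x : N) : π x = 0 ↔ x ∈ LinearMap.range f := Submodule.Quotient.mk_eq_zero _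
  have hc : H • π (y c) = c • π (y c) := by
    rw [← map_smul, hy, LinearMap.map_smul_of_tower]
  obtain ⟨k, hk0, hkE, hkH⟩ := exists_highest_of_ne_zero
    (m := π (y c)) (by
      obtain ⟨k, hk⟩ := hN.isCatO.nil (y c)
      exact ⟨k, by rw [← map_smul, hk, map_zero]⟩) (fun h0 => hne ((hπ _).1 h0)) hc
  rw [← map_smul] at hk0 hkE
  rw [← map_smul, hπ] at hkE
  have hw := E_weight (hy c) k
  obtain ⟨m, hm⟩ := h _ (hN.highestWeights (LinearMap.range f) (E ^ k • y c) (c + 2 * k)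
    Submodule.mem_top (fun h0 => hk0 ((hπ _).2 h0)) hkE
    (by rw [hw, sub_self]; exact Submodule.zero_mem _)) ⟨_, mem_weightSpace.2 hw⟩
  exact hk0 ((hπ _).2 ⟨m, congrArg Subtype.val hm⟩)

/-- The weights of a module in a block lie below the dot-orbit. -/
theorem IsInBlock.exists_add_mem {lam : ℂ} (hM : IsInBlock M lam) {c : ℂ} {m : M} (hm : m ≠ 0)
    (hc : H • m = c • m) : ∃ k : ℕ, c + 2 * k ∈ dotOrbit lam := by
  obtain ⟨k, hk0, hkE, hkH⟩ := exists_highest_of_ne_zero (hM.isCatO.nil _) hm hc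
  exact ⟨k, hM.mem_dotOrbit hk0 hkE hkH⟩

theorem E_mem_weightSpace {c : ℂ} {m : M} (hc : H • m = c • m) :
    H • E • m = (c + 2) • E • m := by
  simpa using E_weight hc 1

theorem F_mem_weightSpace {c : ℂ} {m : M} (hc : H • m = c • m) :
    H • F • m = (c - 2) • F • m := by
  simpa using F_weight hc 1

end Weights

/-! ### Verma modules -/

/-- The Lie algebra representation given by an `𝔰𝔩₂`-triple of operators. -/
def repOfTriple {A : Type*} [AddCommGroup A] [Module ℂ A] (e f h : Module.End ℂ A)
    (he : h * e = e * h + (2 : ℂ) • e) (hf : h * f = f * h + (-2 : ℂ) • f)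
    (ef : e * f = f * e + h) : 𝔤 →ₗ⁅ℂ⁆ Module.End ℂ A where
  toFun x := x.1 0 1 • e + x.1 1 0 • f + x.1 0 0 • h
  map_add' x y := by
    have h (i j : Fin 2) : (x + y).1 i j = x.1 i j + y.1 i j := rfl
    simp only [h]
    module
  map_smul' c x := by
    have h (i j : Fin 2) : (c • x).1 i j = c * x.1 i j := rfl
    simp only [h, RingHom.id_apply]
    module
  map_lie' := by
    intro x y
    have htr (x : 𝔤) : x.1 1 1 = - x.1 0 0 := by
      have h := x.2
      change Matrix.trace x.1 = 0 at h
      rw [Matrix.trace_fin_two] at h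
      linear_combination h
    have hxy (i j : Fin 2) : (⁅x, y⁆ : 𝔤).1 i j
        = (x.1 * y.1 - y.1 * x.1) i j := rfl
    simp only [hxy, Matrix.sub_apply, Matrix.mul_apply, Fin.sum_univ_two, htr,
      LieRing.of_associative_ring_bracket, add_mul, mul_add, smul_mul_assoc, mul_smul_comm, he, hf,
      ef]
    module

/-- The underlying space of the direct sum of copies, indexed by `W`, of the Verma module of
highest weight `c`. -/
def Verma (_c : ℂ) (W : Type) [AddCommGroup W] [Module ℂ W] : Type := ℕ →₀ W

namespace Verma

variable (c : ℂ) (W : Type) [AddCommGroup W] [Module ℂ W]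

instance : AddCommGroup (Verma c W) := inferInstanceAs (AddCommGroup (ℕ →₀ W))

instance : Module ℂ (Verma c W) := inferInstanceAs (Module ℂ (ℕ →₀ W))

variable {W} in
/-- The element `Fᵏ w` of a Verma module. -/
def basis (k : ℕ) : W →ₗ[ℂ] Verma c W := Finsupp.lsingle k

variable {c W} in
/-- Linear maps out of a Verma module. -/
def desc {A : Type*} [AddCommGroup A] [Module ℂ A] (g : ℕ → W →ₗ[ℂ] A) : Verma c W →ₗ[ℂ] A :=
  Finsupp.lsum ℂ g

variable {c W} in
@[simp]
theorem desc_basis {A : Type*} [AddCommGroup A] [Module ℂ A] (g : ℕ → W →ₗ[ℂ] A) (k : ℕ) (w : W) :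
    (desc g : Verma c W →ₗ[ℂ] A) (basis c k w) = g k w :=
  Finsupp.lsum_single ℂ g k w

variable {c W} in
theorem hom_ext {A : Type*} [AddCommGroup A] [Module ℂ A] {f g : Verma c W →ₗ[ℂ] A}
    (h : ∀ k w, f (basis c k w) = g (basis c k w)) : f = g :=
  Finsupp.lhom_ext h

/-- The action of `H`. -/
def opH : Module.End ℂ (Verma c W) := desc fun k => (c - 2 * k) • basis c k

/-- The action of `F`. -/
def opF : Module.End ℂ (Verma c W) := desc fun k => basis c (k + 1)

/-- The action of `E`. -/
def opE : Module.End ℂ (Verma c W) := desc fun k => (k * (c - k + 1)) • basis c (k - 1)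

/-- The action of `𝔰𝔩₂` on a Verma module. -/
def rep : 𝔤 →ₗ⁅ℂ⁆ Module.End ℂ (Verma c W) :=
  repOfTriple (opE c W) (opF c W) (opH c W)
    (hom_ext fun k w => by
      rcases k with _ | k <;> simp [opE, opH, smul_smul, ← add_smul]
      congr 1
      ring)
    (hom_ext fun k w => by
      simp [opF, opH]
      module)
    (hom_ext fun k w => by
      rcases k with _ | k <;> simp [opE, opF, opH, ← add_smul]
      congr 1
      ring)

instance : Module U (Verma c W) :=
  Module.compHom (Verma c W) (UniversalEnvelopingAlgebra.lift ℂ (rep c W)).toRingHom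

theorem smul_def (u : U) (x : Verma c W) :
    u • x = UniversalEnvelopingAlgebra.lift ℂ (rep c W) u x := rfl

instance : IsScalarTower ℂ U (Verma c W) where
  smul_assoc z u t := by
    rw [smul_def, smul_def, map_smul]
    rfl

variable {c W}

theorem ι_smul (x : 𝔤) (t : Verma c W) :
    UniversalEnvelopingAlgebra.ι ℂ x • t = rep c W x t := by
  rw [smul_def, UniversalEnvelopingAlgebra.lift_ι_apply]

theorem E_basis (k : ℕ) (w : W) :
    E • basis c k w = ((k : ℂ) * (c - k + 1)) • basis c (k - 1) w := by
  have h : rep c W E₀ = opE c W := by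
    change E₀.1 0 1 • opE c W + E₀.1 1 0 • opF c W + E₀.1 0 0 • opH c W = _
    simp [E₀, Matrix.single]
  rw [E, ι_smul, h, opE, desc_basis]
  rfl

theorem F_basis (k : ℕ) (w : W) : F • basis c k w = basis c (k + 1) w := by
  have h : rep c W F₀ = opF c W := by
    change F₀.1 0 1 • opE c W + F₀.1 1 0 • opF c W + F₀.1 0 0 • opH c W = _
    simp [F₀, Matrix.single]
  rw [F, ι_smul, h, opF, desc_basis]

theorem H_basis (k : ℕ) (w : W) : H • basis c k w = (c - 2 * k) • basis c k w := by
  have h : rep c W H₀ = opH c W := by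
    change H₀.1 0 1 • opE c W + H₀.1 1 0 • opF c W + H₀.1 0 0 • opH c W = _
    simp [H₀, Matrix.single]
  rw [H, ι_smul, h, opH, desc_basis]
  rfl

theorem F_pow_basis (k : ℕ) (w : W) : F ^ k • basis c 0 w = basis c k w := by
  induction k with
  | zero => simp
  | succ k ih => rw [pow_succ', mul_smul, ih, F_basis]

variable (c W) in
theorem induction {p : Verma c W → Prop} (zero : p 0) (add : ∀ a b, p a → p b → p (a + b))
    (basis : ∀ k w, p (basis c k w)) (x : Verma c W) : p x :=
  Finsupp.induction_linear x zero add basis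

theorem span_basis : Submodule.span ℂ (Set.range fun p : ℕ × W => basis c p.1 p.2) = ⊤ := by
  refine eq_top_iff.2 fun x _ => ?_
  exact induction c W
    (p := fun x => x ∈ Submodule.span ℂ (Set.range fun p : ℕ × W => basis c p.1 p.2))
    (Submodule.zero_mem _) (fun _ _ => Submodule.add_mem _)
    (fun k w => Submodule.subset_span ⟨(k, w), rfl⟩) x

/-- The universal property of Verma modules. -/
def lift {M : Type*} [AddCommGroup M] [Module ℂ M] [Module U M] [IsScalarTower ℂ U M]
    (φ : W →ₗ[ℂ] M) (hE : ∀ w, E • φ w = 0) (hH : ∀ w, H • φ w = c • φ w) :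
    Verma c W →ₗ[U] M :=
  let g : Verma c W →ₗ[ℂ] M := desc fun k => Algebra.lsmul ℂ ℂ M (F ^ k) ∘ₗ φ
  have hg (k : ℕ) (w : W) : g (basis c k w) = F ^ k • φ w := desc_basis _ _ _
  have hcomm (u : U) (h : ∀ k w, g (u • basis c k w) = u • g (basis c k w)) (x : Verma c W) :
      g (u • x) = u • g x :=
    LinearMap.congr_fun (hom_ext (f := g ∘ₗ Algebra.lsmul ℂ ℂ _ u)
      (g := Algebra.lsmul ℂ ℂ M u ∘ₗ g) h) x
  linearMapOfCommute g
    (hcomm E fun k w => by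
      rcases k with _ | k
      · simp [E_basis, hg, hE]
      · rw [E_basis, map_smul, Nat.add_sub_cancel, hg, hg, EF_pow (hH w), hE, smul_zero, zero_add]
        congr 1
        push_cast
        ring)
    (hcomm F fun k w => by rw [F_basis, hg, hg, pow_succ', mul_smul])
    (hcomm H fun k w => by rw [H_basis, map_smul, hg, F_weight (hH w)])

theorem lift_basis_zero {M : Type*} [AddCommGroup M] [Module ℂ M] [Module U M] [IsScalarTower ℂ U M]
    (φ : W →ₗ[ℂ] M) (hE : ∀ w, E • φ w = 0) (hH : ∀ w, H • φ w = c • φ w) (w : W) :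
    lift φ hE hH (basis c 0 w) = φ w := by
  refine (desc_basis (fun k => Algebra.lsmul ℂ ℂ M (F ^ k) ∘ₗ φ) 0 w).trans ?_
  simp

theorem linearMap_ext {M : Type*} [AddCommGroup M] [Module ℂ M] [Module U M] [IsScalarTower ℂ U M]
    {f g : Verma c W →ₗ[U] M} (h : ∀ w, f (basis c 0 w) = g (basis c 0 w)) : f = g := by
  have h' : f.restrictScalars ℂ = g.restrictScalars ℂ := hom_ext fun k w => by
    rw [← F_pow_basis]
    change f _ = g _
    rw [map_smul, map_smul, h]
  exact LinearMap.ext fun x => LinearMap.congr_fun h' x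

theorem highest_basis_zero (w : W) : E • basis c 0 w = 0 ∧ H • basis c 0 w = c • basis c 0 w := by
  constructor
  · simp [E_basis]
  · simp [H_basis]

theorem weight : ⨆ d : ℂ, weightSpace (Verma c W) d = ⊤ :=
  weight_of_span _ span_basis (by
    rintro _ ⟨⟨k, w⟩, rfl⟩
    exact ⟨_, H_basis k w⟩)

theorem basis_injective (k : ℕ) : Function.Injective (basis c k : W → Verma c W) :=
  Finsupp.single_injective k

/-- The weight spaces of a Verma module. -/
def weightEquiv (k : ℕ) : W ≃ₗ[ℂ] weightSpace (Verma c W) (c - 2 * k) :=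
  LinearEquiv.ofBijective
    ((basis c k).codRestrict _ fun w => mem_weightSpace.2 (H_basis k w))
    ⟨fun _ _ h => basis_injective k (congrArg Subtype.val h), by
      rintro ⟨x, hx⟩
      have h := weightSpace_le (fun p : ℕ × W => basis c p.1 p.2) (fun p => c - 2 * p.1)
        (fun p => H_basis p.1 p.2) span_basis _ hx
      have hle : Submodule.span ℂ ((fun p : ℕ × W => basis c p.1 p.2) ''
          {p | c - 2 * (p.1 : ℂ) = c - 2 * k}) ≤ LinearMap.range (basis c k) := by
        rw [Submodule.span_le]
        rintro _ ⟨⟨l, w⟩, hl, rfl⟩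
        have hl' : c - 2 * (l : ℂ) = c - 2 * k := hl
        have : (l : ℂ) = k := by linear_combination -hl' / 2
        obtain rfl : l = k := Nat.cast_injective this
        exact ⟨w, rfl⟩
      obtain ⟨w, hw⟩ := hle h
      exact ⟨w, Subtype.ext hw⟩⟩

theorem isInBlock {lam : ℂ} (hc : c ∈ dotOrbit lam) [FiniteDimensional ℂ W] :
    IsInBlock (Verma c W) lam where
  isCatO :=
    { finite := by
        obtain ⟨G, hG⟩ := (inferInstance : Module.Finite ℂ W)
        classical
        refine ⟨G.image (basis c 0 : W →ₗ[ℂ] Verma c W), ?_⟩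
        have hW : ∀ w : W, basis c 0 w ∈
            Submodule.span U (G.image (basis c 0 : W →ₗ[ℂ] Verma c W) : Set (Verma c W)) := by
          intro w
          have hw : w ∈ Submodule.span ℂ (G : Set W) := hG ▸ Submodule.mem_top
          induction hw using Submodule.span_induction with
          | mem w hw =>
            exact Submodule.subset_span (Finset.mem_coe.2 (Finset.mem_image_of_mem (basis c 0) hw))
          | zero => rw [map_zero]; exact Submodule.zero_mem _
          | add a b _ _ ha hb => rw [map_add]; exact Submodule.add_mem _ ha hb
          | smul z a _ ha => rw [map_smul]; exact Submodule.smul_of_tower_mem _ z ha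
        refine eq_top_iff.2 fun x _ => ?_
        refine induction c W (p := fun x => x ∈ Submodule.span U
          (G.image (basis c 0 : W →ₗ[ℂ] Verma c W) : Set (Verma c W)))
          (Submodule.zero_mem _) (fun _ _ => Submodule.add_mem _) (fun k w => ?_) x
        rw [← F_pow_basis]
        exact Submodule.smul_mem _ _ (hW w)
      weight := weight
      locallyFinite := fun x => finite_of_nil x (by
        have hb : ∀ (k : ℕ) (w : W), E ^ (k + 1) • basis c k w = 0 := by
          intro k
          induction k with
          | zero => intro w; simp [E_basis]
          | succ k ih =>
            intro w
            rw [pow_succ, mul_smul, E_basis, Nat.add_sub_cancel, smul_comm, ih, smul_zero]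
        refine induction c W (p := fun x => ∃ k : ℕ, E ^ k • x = 0) ⟨0, smul_zero _⟩ ?_
          (fun k w => ⟨k + 1, hb k w⟩) x
        rintro a b ⟨k, hk⟩ ⟨l, hl⟩
        exact ⟨k + l, by
          rw [smul_add, pow_add, mul_smul _ _ b, hl, (Commute.pow_pow_self E k l).eq,
            mul_smul, hk, smul_zero, smul_zero, add_zero]⟩) }
  highestWeights := by
    -- The Casimir element commutes with `F`, so it acts on all `Fᵏ w` by the scalar by which it
    -- acts on `w`.
    have htop : casimirPart (Verma c W) (infChar lam) = ⊤ := by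
      refine eq_top_iff.2 fun x _ => ?_
      refine mem_casimirPart_of_eigen ?_
      rw [← infChar_eq_iff.2 hc]
      refine LinearMap.congr_fun (hom_ext (f := Algebra.lsmul ℂ ℂ _ casimir)
        (g := infChar c • LinearMap.id) fun k w => ?_) x
      change casimir • basis c k w = infChar c • basis c k w
      rw [← F_pow_basis, casimir_smul_comm, casimir_highest (highest_basis_zero w).1
        (highest_basis_zero w).2, smul_comm]
    rw [← htop]
    exact highestWeightsIn_casimirPart lam

end Verma

end

end SL2

/-! ### Dimensions of weight spaces, and objects representing them. -/

namespace SL2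

noncomputable section

attribute [local instance 100] LieRing.ofAssociativeRing
attribute [local instance] ModuleCat.moduleOfAlgebraModule
attribute [local instance] ModuleCat.isScalarTower_of_algebra_moduleCat

variable {lam : ℂ}

/-! ### Weight spaces in blocks -/

theorem isInBlock (M : Block lam) : IsInBlock M.obj lam := M.property

instance (M : Block lam) (c : ℂ) : FiniteDimensional ℂ (weightSpace M.obj c) :=
  (isInBlock M).isCatO.finite_weightSpace c

/-- The dimension of the weight space `M_c`. -/
def dim (c : ℂ) (M : Block lam) : ℕ := Module.finrank ℂ (weightSpace M.obj c)

/-- The morphism given by a linear map. -/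
def ofLinear {M N : Block lam} (f : M.obj →ₗ[U] N.obj) : M ⟶ N :=
  ObjectProperty.homMk (ModuleCat.ofHom f)

theorem hom_ext' {M N : Block lam} {f g : M ⟶ N} (h : f.hom.hom = g.hom.hom) : f = g := by
  ext x
  exact LinearMap.congr_fun h x

theorem injective_of_mono {M N : Block lam} (f : M ⟶ N) [Mono f] :
    Function.Injective f.hom.hom := by
  let K : Block lam := ⟨ModuleCat.of U (LinearMap.ker f.hom.hom),
    IsInBlock.of_injective (N := M.obj) (M := ModuleCat.of U (LinearMap.ker f.hom.hom))
      (LinearMap.ker f.hom.hom).subtype Subtype.val_injective M.property⟩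
  let k : K ⟶ M := ofLinear (LinearMap.ker f.hom.hom).subtype
  have hk : k ≫ f = 0 := hom_ext' (LinearMap.ext fun x => x.2)
  have hk0 : k = 0 := (cancel_mono f).1 (hk.trans zero_comp.symm)
  rw [← LinearMap.ker_eq_bot, eq_bot_iff]
  intro x hx
  exact LinearMap.congr_fun (congrArg (fun g => g.hom.hom) hk0) ⟨x, hx⟩

theorem surjective_of_epi {M N : Block lam} (f : M ⟶ N) [Epi f] :
    Function.Surjective f.hom.hom := by
  let K : Block lam := ⟨ModuleCat.of U (N.obj ⧸ LinearMap.range f.hom.hom),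
    IsInBlock.of_surjective (M := N.obj)
      (N := ModuleCat.of U (N.obj ⧸ LinearMap.range f.hom.hom))
      (LinearMap.range f.hom.hom).mkQ (Submodule.mkQ_surjective _) N.property⟩
  let k : N ⟶ K := ofLinear (LinearMap.range f.hom.hom).mkQ
  have hk : f ≫ k = 0 := hom_ext' (LinearMap.ext fun x =>
    (Submodule.Quotient.mk_eq_zero _).2 ⟨x, rfl⟩)
  have hk0 : k = 0 := (cancel_epi f).1 (hk.trans comp_zero.symm)
  intro x
  exact (Submodule.Quotient.mk_eq_zero _).1
    (LinearMap.congr_fun (congrArg (fun g => g.hom.hom) hk0) x)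

theorem mono_of_injective {M N : Block lam} (f : M ⟶ N) (h : Function.Injective f.hom.hom) :
    Mono f where
  right_cancellation _ _ hg := hom_ext' (LinearMap.ext fun x => h
    (LinearMap.congr_fun (congrArg (fun g => g.hom.hom) hg) x))

theorem epi_of_surjective {M N : Block lam} (f : M ⟶ N) (h : Function.Surjective f.hom.hom) :
    Epi f where
  left_cancellation g g' hg := hom_ext' (LinearMap.ext fun x => by
    obtain ⟨y, rfl⟩ := h x
    exact LinearMap.congr_fun (congrArg (fun g => g.hom.hom) hg) y)

theorem weightMap_injective_of_mono {M N : Block lam} (f : M ⟶ N) [Mono f] (c : ℂ) :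
    Function.Injective (weightMap f.hom.hom c) := weightMap_injective (injective_of_mono f) c

theorem weightMap_surjective_of_epi {M N : Block lam} (f : M ⟶ N) [Epi f] (c : ℂ) :
    Function.Surjective (weightMap f.hom.hom c) :=
  weightMap_surjective (surjective_of_epi f) (isInBlock M).isCatO.weight c

theorem mono_of_weight {M N : Block lam} (f : M ⟶ N)
    (h : ∀ c ∈ dotOrbit lam, Function.Injective (weightMap f.hom.hom c)) : Mono f :=
  mono_of_injective f ((isInBlock M).injective_of_weight h)

theorem epi_of_weight {M N : Block lam} (f : M ⟶ N)
    (h : ∀ c ∈ dotOrbit lam, Function.Surjective (weightMap f.hom.hom c)) : Epi f :=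
  epi_of_surjective f ((isInBlock N).surjective_of_weight h)

theorem dim_le_of_mono {M N : Block lam} (f : M ⟶ N) [Mono f] (c : ℂ) : dim c M ≤ dim c N :=
  LinearMap.finrank_le_finrank_of_injective (weightMap_injective_of_mono f c)

theorem dim_le_of_epi {M N : Block lam} (f : M ⟶ N) [Epi f] (c : ℂ) : dim c N ≤ dim c M :=
  LinearMap.finrank_le_finrank_of_surjective (weightMap_surjective_of_epi f c)

theorem dim_eq_of_iso {M N : Block lam} (e : M ≅ N) (c : ℂ) : dim c M = dim c N :=
  le_antisymm (dim_le_of_mono e.hom c) (dim_le_of_epi e.hom c)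

/-- An injection of finite-dimensional weight spaces of the same dimension is bijective, and
surjectivity need only be tested on the dot-orbit. -/
theorem isIso_of_mono_of_dim {M N : Block lam} (f : M ⟶ N) [Mono f]
    (h : ∀ c ∈ dotOrbit lam, dim c N ≤ dim c M) : IsIso f := by
  have : Epi f := epi_of_weight f fun c hc =>
    (LinearMap.injective_iff_surjective_of_finrank_eq_finrank
      (le_antisymm (dim_le_of_mono f c) (h c hc))).1 (weightMap_injective_of_mono f c)
  exact isIso_of_mono_of_epi f

theorem isIso_of_epi_of_dim {M N : Block lam} (f : M ⟶ N) [Epi f]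
    (h : ∀ c ∈ dotOrbit lam, dim c M ≤ dim c N) : IsIso f := by
  have : Mono f := mono_of_weight f fun c hc =>
    (LinearMap.injective_iff_surjective_of_finrank_eq_finrank
      (le_antisymm (h c hc) (dim_le_of_epi f c))).2 (weightMap_surjective_of_epi f c)
  exact isIso_of_mono_of_epi f

theorem eq_zero_of_dim {M : Block lam} {c : ℂ} (h : dim c M = 0) (m : weightSpace M.obj c) :
    m = 0 :=
  have := Module.finrank_zero_iff.1 h
  Subsingleton.elim _ _

theorem isZero_of_dim {M : Block lam} (h : ∀ c ∈ dotOrbit lam, dim c M = 0) : IsZero M := by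
  have : Mono (0 : M ⟶ M) := mono_of_weight _ fun c hc x y _ =>
    (eq_zero_of_dim (h c hc) x).trans (eq_zero_of_dim (h c hc) y).symm
  rw [IsZero.iff_id_eq_zero, ← cancel_mono (0 : M ⟶ M), comp_zero, comp_zero]

theorem weightMap_comp {M N K : Block lam} (f : M ⟶ N) (g : N ⟶ K) (c : ℂ)
    (x : weightSpace M.obj c) :
    weightMap (f ≫ g).hom.hom c x = weightMap g.hom.hom c (weightMap f.hom.hom c x) := rfl

theorem dim_eq_zero_of_isZero {M : Block lam} (h : IsZero M) (c : ℂ) : dim c M = 0 := by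
  refine Module.finrank_zero_iff.2 ⟨fun x y => ?_⟩
  have h₁ (x : weightSpace M.obj c) : x = 0 := by
    have h₂ : weightMap (𝟙 M : M ⟶ M).hom.hom c x = weightMap (0 : M ⟶ M).hom.hom c x := by
      rw [h.eq_of_src (𝟙 M) 0]
    exact h₂
  rw [h₁ x, h₁ y]

theorem exact_weightMap {S : ShortComplex (Block lam)} (hS : S.ShortExact) (c : ℂ) :
    Function.Exact (weightMap S.f.hom.hom c) (weightMap S.g.hom.hom c) := by
  have := hS.mono_f
  intro x
  constructor
  · intro hx
    let K : Block lam := ⟨ModuleCat.of U (LinearMap.ker S.g.hom.hom),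
      IsInBlock.of_injective (N := S.X₂.obj) (M := ModuleCat.of U (LinearMap.ker S.g.hom.hom))
        (LinearMap.ker S.g.hom.hom).subtype Subtype.val_injective S.X₂.property⟩
    let k : K ⟶ S.X₂ := ofLinear (LinearMap.ker S.g.hom.hom).subtype
    have hk : k ≫ S.g = 0 := hom_ext' (LinearMap.ext fun x => x.2)
    have hl := hS.exact.lift_f k hk
    let y : K.obj := ⟨x, congrArg Subtype.val hx⟩
    have hy : S.f.hom.hom ((hS.exact.lift k hk).hom.hom y) = x :=
      LinearMap.congr_fun (congrArg (fun g => g.hom.hom) hl) y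
    obtain ⟨z, hz⟩ : ∃ z : S.X₁.obj, S.f.hom.hom z = x := ⟨_, hy⟩
    refine ⟨⟨z, mem_weightSpace.2 (injective_of_mono S.f ?_)⟩, Subtype.ext hz⟩
    rw [map_smul, LinearMap.map_smul_of_tower, hz]
    exact mem_weightSpace.1 x.2
  · rintro ⟨y, rfl⟩
    rw [← weightMap_comp, S.zero]
    rfl

theorem dim_shortExact {S : ShortComplex (Block lam)} (hS : S.ShortExact) (c : ℂ) :
    dim c S.X₂ = dim c S.X₁ + dim c S.X₃ := by
  have := hS.mono_f
  have := hS.epi_g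
  have h₁ := LinearMap.finrank_range_add_finrank_ker (weightMap S.g.hom.hom c)
  rw [LinearMap.range_eq_top.2 (weightMap_surjective_of_epi S.g c), finrank_top,
    (exact_weightMap hS c).linearMap_ker_eq,
    LinearMap.finrank_range_of_inj (weightMap_injective_of_mono S.f c)] at h₁
  rw [dim, dim, dim, ← h₁, add_comm]

theorem dim_biprod (M N : Block lam) (c : ℂ) : dim c (M ⊞ N) = dim c M + dim c N :=
  dim_shortExact (S := ShortComplex.mk (biprod.inl : M ⟶ M ⊞ N) biprod.snd biprod.inl_snd)
    (ShortComplex.Splitting.shortExact (ShortComplex.Splitting.ofHasBinaryBiproduct M N)) c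

/-! ### Objects representing weight spaces -/

/-- The object `P` represents the functor sending `M` to the weight space `M_c`. -/
def RepresentsWeight (P : Block lam) (c : ℂ) : Prop :=
  ∃ p : weightSpace P.obj c, ∀ M : Block lam,
    Function.Bijective fun f : P ⟶ M => weightMap f.hom.hom c p

theorem RepresentsWeight.of_iso {P P' : Block lam} {c : ℂ} (h : RepresentsWeight P c)
    (e : P ≅ P') : RepresentsWeight P' c := by
  obtain ⟨p, hp⟩ := h
  refine ⟨weightMap e.hom.hom.hom c p, fun M => ?_⟩
  exact (hp M).comp (e.homFromEquiv (Z := M)).symm.bijective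

/-- Epimorphisms are surjective on weight spaces, so the image of the universal vector lifts. -/
theorem RepresentsWeight.projective {P : Block lam} {c : ℂ} (h : RepresentsWeight P c) :
    Projective P where
  factors {M N} f g hg := by
    obtain ⟨p, hp⟩ := h
    obtain ⟨y, hy⟩ := weightMap_surjective_of_epi g c (weightMap f.hom.hom c p)
    obtain ⟨k, hk⟩ := (hp _).2 y
    refine ⟨k, (hp _).1 ?_⟩
    change weightMap (k ≫ g).hom.hom c p = _
    rw [weightMap_comp]
    exact (congrArg _ hk).trans hy

/-- Evaluation at the universal weight vector. -/
theorem RepresentsWeight.finrank_hom {P : Block lam} {c : ℂ} (h : RepresentsWeight P c)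
    (M : Block lam) : Module.finrank ℂ (P ⟶ M) = dim c M := by
  obtain ⟨p, hp⟩ := h
  let f : (P ⟶ M) →ₗ[ℂ] weightSpace M.obj c :=
    { toFun := fun f => weightMap f.hom.hom c p
      map_add' := fun f g => rfl
      map_smul' := fun z f => rfl }
  exact (LinearEquiv.ofBijective f (hp M)).finrank_eq

theorem RepresentsWeight.eq_zero {P : Block lam} {c : ℂ} (h : RepresentsWeight P c)
    {M : Block lam} (f : P ⟶ M) (hf : ∀ p : weightSpace P.obj c, weightMap f.hom.hom c p = 0) :
    f = 0 := by
  obtain ⟨p, hp⟩ := h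
  exact (hp M).1 (hf p)

theorem RepresentsWeight.eq_zero_of_dim {P : Block lam} {c : ℂ} (h : RepresentsWeight P c)
    {M : Block lam} (hM : dim c M = 0) (f : P ⟶ M) : f = 0 :=
  h.eq_zero f fun _ => SL2.eq_zero_of_dim hM _

theorem RepresentsWeight.dim_eq_zero {P : Block lam} {c : ℂ} (h : RepresentsWeight P c)
    {M : Block lam} (hM : ∀ f : P ⟶ M, f = 0) : dim c M = 0 := by
  obtain ⟨p, hp⟩ := h
  have h₁ (x : weightSpace M.obj c) : x = 0 := by
    obtain ⟨f, rfl⟩ := (hp M).2 x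
    rw [hM f]
    rfl
  exact Module.finrank_zero_iff.2 ⟨fun x y => (h₁ x).trans (h₁ y).symm⟩

/-- The hypothesis excludes the weight `c + 2`, since a vector of that weight would lead to a
highest weight in the dot-orbit. Every vector of weight `c` is then a highest weight vector, and the
Verma module of highest weight `c` represents the weight space. -/
theorem E_smul_eq_zero {M : Block lam} {c : ℂ} (hc : ∀ k : ℕ, c + 2 + 2 * k ∉ dotOrbit lam)
    {m : M.obj} (hm : H • m = c • m) : E • m = 0 := by
  by_contra h
  obtain ⟨k, hk⟩ := (isInBlock M).exists_add_mem h (E_mem_weightSpace hm)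
  exact hc k hk

/-- The Verma modules as objects of blocks. -/
def vermaObj {c : ℂ} (hc : c ∈ dotOrbit lam) (W : Type) [AddCommGroup W] [Module ℂ W]
    [FiniteDimensional ℂ W] : Block lam where
  obj := ModuleCat.of U (Verma c W)
  property := by
    have h := Verma.isInBlock (W := W) hc
    exact blockProperty_of_injective (ModuleCat.of U (Verma c W)) (N := Verma c W) LinearMap.id
      Function.injective_id h.isCatO.weight h.isCatO.nil h.isCatO.finite_weightSpace
      (h.highestWeights.mono le_top)

section Verma

variable {c : ℂ} (hc : c ∈ dotOrbit lam) (W : Type) [AddCommGroup W] [Module ℂ W]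
  [FiniteDimensional ℂ W]

/-- The identity of a Verma module, relating two a priori different complex structures. -/
def vermaId : Verma c W →ₗ[U] (vermaObj hc W).obj := LinearMap.id

theorem vermaId_bijective : Function.Bijective (vermaId hc W) := Function.bijective_id

variable {W} in
/-- The highest weight vectors of a Verma module. -/
def vermaTop : W →ₗ[ℂ] weightSpace (vermaObj hc W).obj c :=
  (weightMap (vermaId hc W) c) ∘ₗ
    (Verma.basis c 0).codRestrict _ fun w => mem_weightSpace.2 (Verma.highest_basis_zero w).2

theorem dim_vermaObj (k : ℕ) : dim (c - 2 * k) (vermaObj hc W) = Module.finrank ℂ W := by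
  have h := (Verma.weightEquiv (c := c) (W := W) k).finrank_eq
  rw [h]
  exact (LinearEquiv.ofBijective (weightMap (vermaId hc W) (c - 2 * k))
    ⟨weightMap_injective (vermaId_bijective hc W).1 _,
      weightMap_surjective (vermaId_bijective hc W).2 Verma.weight _⟩).finrank_eq.symm

variable {W}

theorem vermaObj_hom_ext {M : Block lam} {f g : vermaObj hc W ⟶ M}
    (h : ∀ w, weightMap f.hom.hom c (vermaTop hc w) = weightMap g.hom.hom c (vermaTop hc w)) :
    f = g := by
  have h' : f.hom.hom.comp (vermaId hc W) = g.hom.hom.comp (vermaId hc W) :=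
    Verma.linearMap_ext fun w => congrArg Subtype.val (h w)
  exact hom_ext' (LinearMap.ext fun x => LinearMap.congr_fun h' x)

/-- Morphisms out of Verma modules. -/
def vermaDesc (hdom : ∀ k : ℕ, c + 2 + 2 * k ∉ dotOrbit lam) {M : Block lam}
    (φ : W →ₗ[ℂ] weightSpace M.obj c) : vermaObj hc W ⟶ M :=
  ofLinear ((Verma.lift ((weightSpace M.obj c).subtype ∘ₗ φ)
    (fun w => E_smul_eq_zero hdom (mem_weightSpace.1 (φ w).2))
    (fun w => mem_weightSpace.1 (φ w).2) : Verma c W →ₗ[U] M.obj))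

theorem weightMap_vermaDesc (hdom : ∀ k : ℕ, c + 2 + 2 * k ∉ dotOrbit lam) {M : Block lam}
    (φ : W →ₗ[ℂ] weightSpace M.obj c) (w : W) :
    weightMap (vermaDesc hc hdom φ).hom.hom c (vermaTop hc w) = φ w :=
  Subtype.ext (Verma.lift_basis_zero (c := c) ((weightSpace M.obj c).subtype ∘ₗ φ)
    (fun w => E_smul_eq_zero hdom (mem_weightSpace.1 (φ w).2))
    (fun w => mem_weightSpace.1 (φ w).2) w)

theorem representsWeight_vermaObj (hdom : ∀ k : ℕ, c + 2 + 2 * k ∉ dotOrbit lam) :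
    RepresentsWeight (vermaObj hc ℂ) c :=
  ⟨vermaTop hc 1, fun M => ⟨fun f g h => vermaObj_hom_ext hc fun w => by
      have h' : weightMap f.hom.hom c (vermaTop hc 1) = weightMap g.hom.hom c (vermaTop hc 1) := h
      rw [← mul_one w, ← smul_eq_mul, map_smul, map_smul, map_smul, h'], fun m =>
    ⟨vermaDesc hc hdom (LinearMap.toSpanSingleton ℂ _ m),
      (weightMap_vermaDesc hc hdom _ 1).trans (one_smul ℂ m)⟩⟩⟩

theorem bijective_vermaTop : Function.Bijective (vermaTop hc (W := W)) := by
  have hinj : Function.Injective (vermaTop hc (W := W)) := fun w w' h =>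
    Verma.basis_injective (c := c) 0 (congrArg Subtype.val h)
  refine ⟨hinj, (LinearMap.injective_iff_surjective_of_finrank_eq_finrank ?_).1 hinj⟩
  have h := dim_vermaObj hc W 0
  rw [Nat.cast_zero, mul_zero, sub_zero] at h
  exact h.symm

end Verma

end

end SL2

/-! ### Weight spaces of translations and the block on the wall. -/

namespace SL2

noncomputable section

attribute [local instance 100] LieRing.ofAssociativeRing
attribute [local instance] ModuleCat.moduleOfAlgebraModule
attribute [local instance] ModuleCat.isScalarTower_of_algebra_moduleCat

/-! ### Weight spaces of translations -/

theorem not_mem_dotOrbit_wall (k : ℕ) : (-1 : ℂ) + 2 + 2 * k ∉ dotOrbit (-1) := by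
  rintro (h | h)
  · have h' : ((2 + 2 * k : ℕ) : ℂ) = (0 : ℕ) := by push_cast; linear_combination h
    have := Nat.cast_injective h'
    omega
  · have h' : ((2 + 2 * k : ℕ) : ℂ) = (0 : ℕ) := by
      push_cast
      rw [Set.mem_singleton_iff] at h
      linear_combination h
    have := Nat.cast_injective h'
    omega

theorem not_mem_dotOrbit_zero (k : ℕ) : (0 : ℂ) + 2 + 2 * k ∉ dotOrbit 0 := by
  rintro (h | h)
  · have h' : ((2 + 2 * k : ℕ) : ℂ) = (0 : ℕ) := by push_cast; linear_combination h
    have := Nat.cast_injective h'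
    omega
  · have h' : ((4 + 2 * k : ℕ) : ℂ) = (0 : ℕ) := by
      push_cast
      rw [Set.mem_singleton_iff] at h
      linear_combination h
    have := Nat.cast_injective h'
    omega

theorem zero_mem_dotOrbit : (0 : ℂ) ∈ dotOrbit 0 := Or.inl rfl

theorem neg_two_mem_dotOrbit : (-2 : ℂ) ∈ dotOrbit 0 := Or.inr (by simp)

theorem neg_one_mem_dotOrbit : (-1 : ℂ) ∈ dotOrbit (-1) := Or.inl rfl

theorem dotOrbit_wall {c : ℂ} (hc : c ∈ dotOrbit (-1)) : c = -1 := by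
  rcases hc with h | h
  · exact h
  · rw [Set.mem_singleton_iff] at h
    rw [h]
    norm_num

theorem dotOrbit_zero {c : ℂ} (hc : c ∈ dotOrbit 0) : c = 0 ∨ c = -2 := by
  rcases hc with h | h
  · exact Or.inl h
  · rw [Set.mem_singleton_iff] at h
    exact Or.inr (by rw [h]; norm_num)

/-- The weight spaces of `M ⊗ L(1)`. -/
def tensorWeightEquiv (M : Type) [AddCommGroup M] [Module ℂ M] [Module U M] [IsScalarTower ℂ U M]
    (c : ℂ) : weightSpace (TensorV M) c ≃ₗ[ℂ] weightSpace M (c - 1) × weightSpace M (c + 1) where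
  toFun t := (⟨coord 0 t, mem_weightSpace.2 (by
      have h := congrArg (coord 0) (mem_weightSpace.1 t.2)
      rw [coord_zero_H, map_smul] at h
      rw [sub_smul, one_smul, ← h, add_sub_cancel_right])⟩,
    ⟨coord 1 t, mem_weightSpace.2 (by
      have h := congrArg (coord 1) (mem_weightSpace.1 t.2)
      rw [coord_one_H, map_smul] at h
      rw [add_smul, one_smul, ← h, sub_add_cancel])⟩)
  map_add' _ _ := by ext <;> simp
  map_smul' _ _ := by ext <;> simp
  invFun p := ⟨tens p.1.1 (Pi.single 0 1) + tens p.2.1 (Pi.single 1 1), Submodule.add_mem _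
    (mem_weightSpace.2 (by
      rw [H_tens_zero (mem_weightSpace.1 p.1.2), sub_add_cancel]))
    (mem_weightSpace.2 (by
      rw [H_tens_one (mem_weightSpace.1 p.2.2), add_sub_cancel_right]))⟩
  left_inv t := Subtype.ext (eq_tens_coord (t : TensorV M)).symm
  right_inv p := by ext <;> simp [coord_tens]

/-- Let `t` be a highest weight vector of weight `c`. If its second coordinate is nonzero, that
coordinate is a highest weight vector of weight `c + 1`; otherwise the first coordinate is one of
weight `c - 1`. In `N` only the highest weight -1 occurs, so `c` is -2 or 0, and no part of the
tensor product is lost. -/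
theorem blockPart_tensorV (N : Block (-1)) : blockPart (TensorV N.obj) 0 = ⊤ := by
  refine blockPart_eq_top (casimirPart_eq_top (tensorV_weight (isInBlock N).isCatO.weight)
    (tensorV_nil (isInBlock N).isCatO.weight (isInBlock N).isCatO.nil)
    (tensorV_finite (isInBlock N).isCatO.weight (isInBlock N).isCatO.finite_weightSpace)
    fun t c ht hE hH => ?_)
  have h₀ := congrArg (coord 0) hE
  have h₁ := congrArg (coord 1) hE
  have h₂ := congrArg (coord 0) hH
  have h₃ := congrArg (coord 1) hH
  rw [coord_zero_E, map_zero] at h₀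
  rw [coord_one_E, map_zero] at h₁
  rw [coord_zero_H, map_smul] at h₂
  rw [coord_one_H, map_smul] at h₃
  by_cases h : coord 1 t = 0
  · rw [h, add_zero] at h₀
    have h₄ : coord 0 t ≠ 0 := fun h' => ht (coord_ext (by rw [h', map_zero]) (by rw [h, map_zero]))
    have h₅ := dotOrbit_wall ((isInBlock N).mem_dotOrbit h₄ h₀ (c := c - 1) (by
      rw [sub_smul, one_smul, ← h₂, add_sub_cancel_right]))
    exact Or.inl (by linear_combination h₅)
  · have h₅ := dotOrbit_wall ((isInBlock N).mem_dotOrbit h h₁ (c := c + 1) (by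
      rw [add_smul, one_smul, ← h₃, sub_add_cancel]))
    exact Or.inr (by
      rw [Set.mem_singleton_iff]
      linear_combination h₅)

theorem translationIncl_bijective (N : Block (-1)) : Function.Bijective (translationIncl 0 N) :=
  ⟨translationIncl_injective 0 N, fun t => ⟨⟨t, blockPart_tensorV N ▸ Submodule.mem_top⟩, rfl⟩⟩

theorem dim_outOfWall (N : Block (-1)) (c : ℂ) :
    dim c (outOfWall.obj N) = dim (c - 1) N + dim (c + 1) N := by
  have e := LinearEquiv.ofBijective (weightMap (translationIncl 0 N) c)
    ⟨weightMap_injective (translationIncl_bijective N).1 c,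
      weightMap_surjective (translationIncl_bijective N).2
        (isInBlock (outOfWall.obj N)).isCatO.weight c⟩
  exact (e.trans (tensorWeightEquiv N.obj c)).finrank_eq.trans (Module.finrank_prod)

/-- The highest weight vectors of weight `-1` in `M ⊗ L(1)`. -/
def wallVector (M : O₀) : weightSpace M.obj (-2) →ₗ[ℂ] TensorV M.obj where
  -- The second term is forced: `E` sends `m ⊗ e₀ + n ⊗ e₁` to `(Em + n) ⊗ e₀ + En ⊗ e₁`. The
  -- remaining condition `E • E • m = 0` holds because the weight 2 does not occur.
  toFun m := tens m.1 (Pi.single 0 1) - tens (E • m.1) (Pi.single 1 1)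
  map_add' m m' := by simp only [Submodule.coe_add, tens_add, smul_add]; abel
  map_smul' z m := by
    simp only [Submodule.coe_smul, tens_smul, smul_comm E, smul_sub, RingHom.id_apply]

theorem wallVector_apply (M : O₀) (m : weightSpace M.obj (-2)) :
    wallVector M m = tens m.1 (Pi.single 0 1) - tens (E • m.1) (Pi.single 1 1) := rfl

theorem E_E_smul (M : O₀) {m : M.obj} (hm : H • m = (-2 : ℂ) • m) : E • E • m = 0 := by
  have h := E_mem_weightSpace hm
  rw [show (-2 : ℂ) + 2 = 0 by ring] at h
  exact E_smul_eq_zero not_mem_dotOrbit_zero h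

theorem wallVector_highest (M : O₀) (m : weightSpace M.obj (-2)) :
    E • wallVector M m = 0 ∧ H • wallVector M m = (-1 : ℂ) • wallVector M m := by
  have hm := mem_weightSpace.1 m.2
  have h₁ := E_mem_weightSpace hm
  constructor
  · refine coord_ext ?_ ?_
    · rw [coord_zero_E]; simp [wallVector_apply, coord_tens]
    · rw [coord_one_E]; simp [wallVector_apply, coord_tens, E_E_smul M hm]
  · refine coord_ext ?_ ?_
    · rw [coord_zero_H, map_smul]
      simp only [wallVector_apply, map_sub, coord_tens]
      simp [hm]
      module
    · rw [coord_one_H, map_smul]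
      simp only [wallVector_apply, map_sub, coord_tens]
      simp [h₁]

theorem wallVector_mem (M : O₀) (m : weightSpace M.obj (-2)) :
    wallVector M m ∈ blockPart (TensorV M.obj) (-1) :=
  le_blockPart (highestWeightsIn_casimirPart (-1)) (mem_casimirPart_of_eigen
    (casimir_highest (wallVector_highest M m).1 (wallVector_highest M m).2))

theorem exists_translationIncl_eq_wallVector (M : O₀) (m : weightSpace M.obj (-2)) :
    ∃ x : weightSpace (ontoWall.obj M).obj (-1), translationIncl (-1) M x = wallVector M m := by
  let x : (ontoWall.obj M).obj := ⟨wallVector M m, wallVector_mem M m⟩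
  have hx : translationIncl (-1) M x = wallVector M m := rfl
  refine ⟨⟨x, mem_weightSpace.2 (translationIncl_injective (-1) M ?_)⟩, hx⟩
  rw [map_smul, LinearMap.map_smul_of_tower, hx, (wallVector_highest M m).2]

theorem exists_wallVector_eq_translationIncl (M : O₀) (x : weightSpace (ontoWall.obj M).obj (-1)) :
    ∃ m : weightSpace M.obj (-2), wallVector M m = translationIncl (-1) M x := by
  have hx := mem_weightSpace.1 x.2
  have hE := E_smul_eq_zero not_mem_dotOrbit_wall hx
  let t := translationIncl (-1) M x
  have hE' : E • t = 0 :=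
    (map_smul (translationIncl (-1) M) E x.1).symm.trans (by rw [hE, map_zero])
  have hH' : H • t = (-1 : ℂ) • t :=
    (map_smul (translationIncl (-1) M) H x.1).symm.trans (by rw [hx, LinearMap.map_smul_of_tower])
  have h₀ := congrArg (coord 0) hE'
  have h₂ := congrArg (coord 0) hH'
  rw [coord_zero_E, map_zero] at h₀
  rw [coord_zero_H, map_smul] at h₂
  refine ⟨⟨coord 0 t, mem_weightSpace.2 ?_⟩, ?_⟩
  · rw [eq_sub_of_add_eq h₂]
    module
  · refine coord_ext ?_ ?_
    · simp [wallVector_apply, coord_tens, t]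
    · simp only [wallVector_apply, map_sub, coord_tens]
      simpa using neg_eq_of_add_eq_zero_right h₀

theorem wallVector_injective (M : O₀) : Function.Injective (wallVector M) := fun m m' h => by
  have h' := congrArg (coord 0) h
  simp only [wallVector_apply, map_sub, coord_tens] at h'
  exact Subtype.ext (by simpa using h')

/-- On the wall every vector of weight -1 is a highest weight vector, and those of `M ⊗ L(1)` are
exactly the vectors `wallVector M m`. -/
theorem dim_ontoWall (M : O₀) : dim (-1) (ontoWall.obj M) = dim (-2) M := by
  let f : weightSpace (ontoWall.obj M).obj (-1) →ₗ[ℂ] TensorV M.obj :=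
    ((translationIncl (-1) M).restrictScalars ℂ) ∘ₗ (weightSpace (ontoWall.obj M).obj (-1)).subtype
  have hf : Function.Injective f := (translationIncl_injective (-1) M).comp Subtype.val_injective
  have hr : LinearMap.range f = LinearMap.range (wallVector M) := by
    refine le_antisymm ?_ ?_
    · rintro _ ⟨x, rfl⟩
      exact exists_wallVector_eq_translationIncl M x
    · rintro _ ⟨m, rfl⟩
      exact exists_translationIncl_eq_wallVector M m
  rw [dim, dim, ← LinearMap.finrank_range_of_inj hf, hr, LinearMap.finrank_range_of_inj (wallVector_injective M)]

/-! ### The block on the wall -/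

/-- The simple Verma module on the wall. -/
def wallObj : Block (-1) := vermaObj neg_one_mem_dotOrbit ℂ

/-- An object on the wall is a direct sum of copies of the simple Verma module. -/
theorem exists_iso_vermaObj (N : Block (-1)) :
    Nonempty (vermaObj neg_one_mem_dotOrbit (weightSpace N.obj (-1)) ≅ N) := by
  let f : vermaObj neg_one_mem_dotOrbit (weightSpace N.obj (-1)) ⟶ N :=
    vermaDesc neg_one_mem_dotOrbit not_mem_dotOrbit_wall LinearMap.id
  have hf (m) : weightMap f.hom.hom (-1) (vermaTop neg_one_mem_dotOrbit m) = m :=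
    weightMap_vermaDesc neg_one_mem_dotOrbit not_mem_dotOrbit_wall LinearMap.id m
  have : Epi f := epi_of_weight f fun c hc => by
    rw [dotOrbit_wall hc]
    exact fun m => ⟨_, hf m⟩
  have : IsIso f := isIso_of_epi_of_dim f fun c hc => by
    rw [dotOrbit_wall hc]
    have h := dim_vermaObj neg_one_mem_dotOrbit (weightSpace N.obj (-1)) 0
    rw [Nat.cast_zero, mul_zero, sub_zero] at h
    exact h.le
  exact ⟨asIso f⟩

theorem dim_neg_three (N : Block (-1)) : dim (-3) N = dim (-1) N := by
  obtain ⟨e⟩ := exists_iso_vermaObj N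
  have h := dim_vermaObj neg_one_mem_dotOrbit (weightSpace N.obj (-1)) 1
  rw [show (-1 : ℂ) - 2 * (1 : ℕ) = -3 by norm_num] at h
  exact (dim_eq_of_iso e (-3)).symm.trans h

theorem dim_one (N : Block (-1)) : dim 1 N = 0 := by
  refine Module.finrank_zero_iff.2 ⟨fun x y => ?_⟩
  have h (x : weightSpace N.obj 1) : x = 0 := by
    by_contra hx
    obtain ⟨k, hk⟩ := (isInBlock N).exists_add_mem (fun h => hx (Subtype.ext h))
      (mem_weightSpace.1 x.2)
    exact not_mem_dotOrbit_wall k (by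
      rw [show (-1 : ℂ) + 2 = 1 by norm_num]; exact hk)
  rw [h x, h y]

theorem dim_zero_outOfWall (N : Block (-1)) : dim 0 (outOfWall.obj N) = dim (-1) N := by
  rw [dim_outOfWall, show (0 : ℂ) - 1 = -1 by norm_num, show (0 : ℂ) + 1 = 1 by norm_num, dim_one,
    add_zero]

theorem dim_neg_two_outOfWall (N : Block (-1)) : dim (-2) (outOfWall.obj N) = 2 * dim (-1) N := by
  rw [dim_outOfWall, show (-2 : ℂ) - 1 = -3 by norm_num, show (-2 : ℂ) + 1 = -1 by norm_num,
    dim_neg_three, two_mul]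

theorem dim_wallObj : dim (-1) wallObj = 1 := by
  have h := dim_vermaObj neg_one_mem_dotOrbit ℂ 0
  rw [Nat.cast_zero, mul_zero, sub_zero, Module.finrank_self] at h
  exact h

theorem representsWeight_wallObj : RepresentsWeight wallObj (-1) :=
  representsWeight_vermaObj _ not_mem_dotOrbit_wall

theorem isZero_of_dim_wall {N : Block (-1)} (h : dim (-1) N = 0) : IsZero N :=
  isZero_of_dim fun c hc => by rwa [dotOrbit_wall hc]

/-- Every object is a sum of copies of the simple Verma module, indexed by its weight space at -1,
so the dimension of that space counts the copies. -/
theorem isSemisimpleDim_wallObj : BoundedDerived.IsSemisimpleDim wallObj (dim (-1)) where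
  simple :=
    { mono_isIso_iff_nonzero := by
        intro Y f hf
        constructor
        · intro h h0
          have hz : IsZero Y := by
            rw [IsZero.iff_id_eq_zero, ← cancel_mono f, h0, comp_zero, comp_zero]
          have h₁ := dim_eq_zero_of_isZero (hz.of_iso (asIso f).symm) (-1)
          rw [dim_wallObj] at h₁
          exact one_ne_zero h₁
        · intro h0
          refine isIso_of_mono_of_dim f fun c hc => ?_
          rw [dotOrbit_wall hc, dim_wallObj, Nat.one_le_iff_ne_zero]
          exact fun h => h0 ((isZero_of_dim_wall h).eq_of_src _ _) }
  generates N h := isZero_of_dim_wall (representsWeight_wallObj.dim_eq_zero h)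
  cogenerates N h := by
    obtain ⟨e⟩ := exists_iso_vermaObj N
    have hx (x : weightSpace N.obj (-1)) : x = 0 := by
      rw [← Module.forall_dual_apply_eq_zero_iff ℂ]
      intro φ
      -- A linear functional on the weight space extends to a morphism to `wallObj`. If all these
      -- morphisms vanish, so do all functionals.
      let g : vermaObj neg_one_mem_dotOrbit (weightSpace N.obj (-1)) ⟶ wallObj :=
        vermaDesc neg_one_mem_dotOrbit not_mem_dotOrbit_wall
          (vermaTop neg_one_mem_dotOrbit ∘ₗ φ)
      have hg : g = 0 := by rw [← cancel_epi e.inv, h (e.inv ≫ g), comp_zero]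
      have h₁ := weightMap_vermaDesc neg_one_mem_dotOrbit not_mem_dotOrbit_wall
        (M := wallObj) (vermaTop neg_one_mem_dotOrbit ∘ₗ φ) x
      change weightMap g.hom.hom _ _ = _ at h₁
      rw [hg] at h₁
      exact (bijective_vermaTop neg_one_mem_dotOrbit).1 (h₁.symm.trans (map_zero _).symm)
    exact isZero_of_dim_wall (Module.finrank_zero_iff.2 ⟨fun x y => (hx x).trans (hx y).symm⟩)
  dim_simple := dim_wallObj
  dim_biprod A B := dim_biprod A B (-1)
  le_of_mono f _ := dim_le_of_mono f (-1)
  le_of_epi f _ := dim_le_of_epi f (-1)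
  isIso_of_mono f _ h := isIso_of_mono_of_dim f fun c hc => by rwa [dotOrbit_wall hc]
  isIso_of_epi f _ h := isIso_of_epi_of_dim f fun c hc => by
    rw [dotOrbit_wall hc]
    exact h.ge

theorem dim_onto_out (N : Block (-1)) :
    dim (-1) (ontoWall.obj (outOfWall.obj N)) = 2 * dim (-1) N := by
  rw [dim_ontoWall, dim_neg_two_outOfWall]

end

end SL2

/-! ### Resolutions for shuffling and the derived shuffling equivalence. -/

namespace SL2

noncomputable section

attribute [local instance 100] LieRing.ofAssociativeRing
attribute [local instance] ModuleCat.moduleOfAlgebraModule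
attribute [local instance] ModuleCat.isScalarTower_of_algebra_moduleCat

open BoundedDerived

instance (lam mu : ℂ) : (translation lam mu).Additive :=
  additive_of_biadjoint (translationAdjunction lam mu) (translationAdjunction mu lam)

instance (lam mu : ℂ) : (translation lam mu).PreservesHomology :=
  preservesHomology_of_biadjoint (translationAdjunction lam mu) (translationAdjunction mu lam)

variable (adj : ontoWall ⊣ outOfWall) (adj' : outOfWall ⊣ ontoWall)

/-! ### Monomorphy of the unit -/

theorem dim_neg_two_of_map_eq_zero {K M : O₀} (f : K ⟶ M) [Mono f] (h : ontoWall.map f = 0) :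
    dim (-2) K = 0 := by
  have hz : IsZero (ontoWall.obj K) := by
    rw [IsZero.iff_id_eq_zero, ← cancel_mono (ontoWall.map f), h, comp_zero, comp_zero]
  rw [← dim_ontoWall]
  exact dim_eq_zero_of_isZero hz _

theorem dim_neg_two_of_map_eq_zero' {K M : O₀} (f : M ⟶ K) [Epi f] (h : ontoWall.map f = 0) :
    dim (-2) K = 0 := by
  have hz : IsZero (ontoWall.obj K) := by
    rw [IsZero.iff_id_eq_zero, ← cancel_epi (ontoWall.map f), h, zero_comp, zero_comp]
  rw [← dim_ontoWall]
  exact dim_eq_zero_of_isZero hz _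

theorem isZero_of_dims {M : O₀} (h₀ : dim 0 M = 0) (h₂ : dim (-2) M = 0) : IsZero M :=
  isZero_of_dim fun c hc => by
    rcases dotOrbit_zero hc with rfl | rfl
    · exact h₀
    · exact h₂

/-- `F` acts injectively on the weight space of weight zero. -/
def FInjective (M : O₀) : Prop := ∀ m : M.obj, H • m = (0 : ℂ) • m → F • m = 0 → m = 0

theorem FInjective.dim_eq_zero {K M : O₀} (hM : FInjective M) (f : K ⟶ M) [Mono f]
    (h : dim (-2) K = 0) : IsZero K := by
  have h₀ (x : weightSpace K.obj 0) : x = 0 := by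
    have hx := mem_weightSpace.1 x.2
    have hF : F • x.1 = 0 := congrArg Subtype.val (eq_zero_of_dim h ⟨F • x.1, mem_weightSpace.2 (by
      rw [F_mem_weightSpace hx]
      norm_num)⟩)
    refine Subtype.ext (injective_of_mono f ?_)
    refine (hM _ ?_ ?_).trans (map_zero _).symm
    · rw [← map_smul, hx, LinearMap.map_smul_of_tower]
    · rw [← map_smul, hF, map_zero]
  exact isZero_of_dims (Module.finrank_zero_iff.2 ⟨fun x y => (h₀ x).trans (h₀ y).symm⟩) h

/-- `T(η)` is a split monomorphism, so `T` kills the inclusion of the kernel of `η`, and the kernel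
has no weight -2. Injectivity of `F` then excludes weight 0 too. -/
theorem mono_unit {M : O₀} (hM : FInjective M) : Mono (adj.unit.app M) := by
  refine Preadditive.mono_of_isZero_kernel _ (hM.dim_eq_zero (kernel.ι (adj.unit.app M))
    (dim_neg_two_of_map_eq_zero (kernel.ι (adj.unit.app M)) ?_))
  have h : ontoWall.map (kernel.ι (adj.unit.app M)) ≫ ontoWall.map (adj.unit.app M) = 0 := by
    rw [← Functor.map_comp, kernel.condition, Functor.map_zero]
  have h' := congrArg (· ≫ adj.counit.app _) h
  simpa using h'

theorem fInjective_vermaObj (W : Type) [AddCommGroup W] [Module ℂ W] [FiniteDimensional ℂ W] :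
    FInjective (vermaObj zero_mem_dotOrbit W) := by
  intro m hm hF
  obtain ⟨w, hw⟩ := (bijective_vermaTop zero_mem_dotOrbit).2 ⟨m, mem_weightSpace.2 hm⟩
  have hw' : vermaId zero_mem_dotOrbit W (Verma.basis 0 0 w) = m := congrArg Subtype.val hw
  rw [← hw', ← map_smul, Verma.F_basis] at hF
  have h₁ := (vermaId_bijective zero_mem_dotOrbit W).1 (hF.trans (map_zero _).symm)
  have h₂ : w = 0 := Verma.basis_injective (c := 0) 1 (h₁.trans (map_zero _).symm)
  rw [← hw', h₂, map_zero, map_zero]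

theorem mono_unit_Θ (M : O₀) : Mono (adj.unit.app (Θ.obj M)) :=
  SplitMono.mono ⟨outOfWall.map (adj.counit.app (ontoWall.obj M)),
    adj.right_triangle_components (ontoWall.obj M)⟩

/-! ### Functorial resolutions -/

/-- The Verma module on the weight space of weight zero. -/
abbrev vermaOn (M : O₀) : O₀ := vermaObj zero_mem_dotOrbit (weightSpace M.obj 0)

/-- The map of Verma modules induced by a morphism. -/
def vermaMap {M N : O₀} (f : M ⟶ N) : vermaOn M ⟶ vermaOn N :=
  vermaDesc zero_mem_dotOrbit not_mem_dotOrbit_zero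
    (vermaTop zero_mem_dotOrbit ∘ₗ weightMap f.hom.hom 0)

/-- The canonical map from a Verma module. -/
def vermaTo (M : O₀) : vermaOn M ⟶ M :=
  vermaDesc zero_mem_dotOrbit not_mem_dotOrbit_zero LinearMap.id

theorem weightMap_vermaMap {M N : O₀} (f : M ⟶ N) (w : weightSpace M.obj 0) :
    weightMap (vermaMap f).hom.hom 0 (vermaTop zero_mem_dotOrbit w)
      = vermaTop zero_mem_dotOrbit (weightMap f.hom.hom 0 w) :=
  weightMap_vermaDesc zero_mem_dotOrbit not_mem_dotOrbit_zero
    (vermaTop zero_mem_dotOrbit ∘ₗ weightMap f.hom.hom 0) w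

theorem weightMap_vermaTo (M : O₀) (w : weightSpace M.obj 0) :
    weightMap (vermaTo M).hom.hom 0 (vermaTop zero_mem_dotOrbit w) = w :=
  weightMap_vermaDesc zero_mem_dotOrbit not_mem_dotOrbit_zero LinearMap.id w

theorem vermaMap_id (M : O₀) : vermaMap (𝟙 M) = 𝟙 (vermaOn M) :=
  vermaObj_hom_ext _ fun w => weightMap_vermaMap (𝟙 M) w

theorem vermaDesc_comp {lam c : ℂ} (hc : c ∈ dotOrbit lam)
    (hdom : ∀ k : ℕ, c + 2 + 2 * k ∉ dotOrbit lam) {W : Type} [AddCommGroup W] [Module ℂ W]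
    [FiniteDimensional ℂ W] {X Y : Block lam} (φ : W →ₗ[ℂ] weightSpace X.obj c) (g : X ⟶ Y) :
    vermaDesc hc hdom φ ≫ g = vermaDesc hc hdom (weightMap g.hom.hom c ∘ₗ φ) :=
  vermaObj_hom_ext hc fun w =>
    (congrArg (weightMap g.hom.hom c) (weightMap_vermaDesc hc hdom φ w)).trans
      (weightMap_vermaDesc hc hdom (weightMap g.hom.hom c ∘ₗ φ) w).symm

theorem vermaMap_comp {M N K : O₀} (f : M ⟶ N) (g : N ⟶ K) :
    vermaMap (f ≫ g) = vermaMap f ≫ vermaMap g := by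
  have h := vermaDesc_comp zero_mem_dotOrbit not_mem_dotOrbit_zero
    (vermaTop zero_mem_dotOrbit ∘ₗ weightMap f.hom.hom 0) (vermaMap g)
  refine Eq.trans ?_ h.symm
  refine congrArg (vermaDesc zero_mem_dotOrbit not_mem_dotOrbit_zero) (LinearMap.ext fun w => ?_)
  exact (weightMap_vermaMap g (weightMap f.hom.hom 0 w)).symm

theorem vermaMap_zero (M N : O₀) : vermaMap (0 : M ⟶ N) = 0 :=
  vermaObj_hom_ext _ fun w => (weightMap_vermaMap (0 : M ⟶ N) w).trans
    (map_zero (vermaTop zero_mem_dotOrbit))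

theorem vermaMap_vermaTo {M N : O₀} (f : M ⟶ N) : vermaMap f ≫ vermaTo N = vermaTo M ≫ f := by
  have h₁ := vermaDesc_comp zero_mem_dotOrbit not_mem_dotOrbit_zero
    (vermaTop zero_mem_dotOrbit ∘ₗ weightMap f.hom.hom 0) (vermaTo N)
  have h₂ := vermaDesc_comp zero_mem_dotOrbit not_mem_dotOrbit_zero
    (LinearMap.id : weightSpace M.obj 0 →ₗ[ℂ] weightSpace M.obj 0) f
  refine h₁.trans (Eq.trans ?_ h₂.symm)
  refine congrArg (vermaDesc zero_mem_dotOrbit not_mem_dotOrbit_zero) (LinearMap.ext fun w => ?_)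
  exact weightMap_vermaTo N (weightMap f.hom.hom 0 w)

/-- The functor assigning to a module the Verma module on its weight space of weight zero. -/
def vermaFunctor : O₀ ⥤ O₀ where
  obj M := vermaOn M
  map f := vermaMap f
  map_id M := vermaMap_id M
  map_comp f g := vermaMap_comp f g

/-- The canonical transformation from the Verma functor. -/
def vermaCounit : vermaFunctor ⟶ 𝟭 O₀ where
  app M := vermaTo M
  naturality _ _ f := vermaMap_vermaTo f

instance : vermaFunctor.PreservesZeroMorphisms where
  map_zero M N := vermaMap_zero M N

/-- A functor with values in objects on which the unit is a monomorphism. -/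
abbrev coverFunctor : O₀ ⥤ O₀ := biprodFunctor vermaFunctor Θ

/-- The canonical epimorphism from the cover. -/
abbrev coverMap : coverFunctor ⟶ 𝟭 O₀ := biprodDesc vermaCounit adj'.counit

/-- The Verma summand hits all of `M₀`, so the cokernel has no weight 0. Since `T(ε)` is a split
epimorphism, `T` kills the projection to the cokernel, which excludes weight -2. -/
theorem epi_coverMap (M : O₀) : Epi ((coverMap adj').app M) := by
  let p : vermaFunctor.obj M ⊞ Θ.obj M ⟶ M :=
    biprod.desc (vermaCounit.app M) (adj'.counit.app M)
  let q : M ⟶ cokernel p := cokernel.π p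
  have hq : p ≫ q = 0 := cokernel.condition p
  have h₁ : vermaCounit.app M ≫ q = 0 := by
    have h := congrArg (biprod.inl ≫ ·) hq
    simpa [p] using h
  have h₂ : (adj'.counit.app M : Θ.obj M ⟶ M) ≫ q = 0 := by
    have h := congrArg (biprod.inr ≫ ·) hq
    simpa [p] using h
  have h₃ : ontoWall.map q = 0 := by
    have h := congrArg (fun t => adj'.unit.app (ontoWall.obj M) ≫ ontoWall.map t) h₂
    simpa using h
  have h₄ (y : weightSpace (cokernel p).obj 0) : y = 0 := by
    obtain ⟨x, rfl⟩ := weightMap_surjective_of_epi q 0 y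
    have h := congrArg (fun t => weightMap t.hom.hom 0 (vermaTop zero_mem_dotOrbit x)) h₁
    exact (congrArg (weightMap q.hom.hom 0) (weightMap_vermaTo M x)).symm.trans h
  exact Preadditive.epi_of_isZero_cokernel p (isZero_of_dims
    (Module.finrank_zero_iff.2 ⟨fun x y => (h₄ x).trans (h₄ y).symm⟩)
    (dim_neg_two_of_map_eq_zero' q h₃))

theorem mono_unit_coverFunctor (M : O₀) : Mono (adj.unit.app (coverFunctor.obj M)) :=
  mono_app_biprod adj.unit (mono_unit adj (fInjective_vermaObj _)) (mono_unit_Θ adj M)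

/-! ### Shuffling functors -/

/-- The projection onto the shuffling functor. -/
def shufflingπ (η : 𝟭 O₀ ⟶ Θ) : Θ ⟶ shuffling η where
  app M := cokernel.π (η.app M)
  naturality M N f := by simp [shuffling]

theorem shufflingπ_condition (η : 𝟭 O₀ ⟶ Θ) (M : O₀) :
    η.app M ≫ (shufflingπ η).app M = 0 := cokernel.condition (η.app M)

theorem shortExact_shufflingπ (η : 𝟭 O₀ ⟶ Θ) (M : O₀) (hM : Mono (η.app M)) :
    (ShortComplex.mk _ _ (shufflingπ_condition η M)).ShortExact where
  exact := ShortComplex.exact_cokernel (η.app M)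
  mono_f := hM
  epi_g := inferInstanceAs (Epi (cokernel.π (η.app M)))

/-- The shuffling functor is left adjoint to the coshuffling functor. -/
def shufflingAdjunction : shuffling adj.unit ⊣ coshuffling adj'.counit :=
  cokernelKernelAdjunction adj adj'

/-- The functor on the bounded derived category induced by the cone of the unit. -/
abbrev derivedShuffling : Db O₀ ⥤ Db O₀ := onDb (unitCone adj.unit) (descends_unitCone adj.unit)

include adj' in
theorem isEquivalence_derivedShuffling : (derivedShuffling adj).IsEquivalence :=
  isEquivalence_onDb_unitCone adj adj' isSemisimpleDim_wallObj dim_onto_out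

include adj' in
theorem isLeftDerivedFunctor_derivedShuffling :
    (derivedShuffling adj).IsLeftDerivedFunctor
      (derivedToCoker adj.unit (shufflingπ adj.unit) (shufflingπ_condition adj.unit))
      (quasiIso O₀) :=
  isLeftDerivedFunctor_onDb_unitCone (coverMap adj') adj.unit (shufflingπ adj.unit)
    (shufflingπ_condition adj.unit) (epi_coverMap adj') (mono_unit_coverFunctor adj)
    (shortExact_shufflingπ adj.unit)

include adj' in
theorem isLeftDerived_shuffling : IsLeftDerived (shuffling adj.unit) (derivedShuffling adj) :=
  ⟨_, isLeftDerivedFunctor_derivedShuffling adj adj'⟩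

theorem isRightDerived_coshuffling [(derivedShuffling adj).IsEquivalence] :
    IsRightDerived (coshuffling adj'.counit) (derivedShuffling adj).asEquivalence.inverse :=
  isRightDerived_inverse (coverMap adj') adj.unit (shufflingπ adj.unit)
    (shufflingπ_condition adj.unit) (epi_coverMap adj') (mono_unit_coverFunctor adj)
    (shortExact_shufflingπ adj.unit) (shufflingAdjunction adj adj')

include adj' in
-- Derived functors are unique, so results about the cone model apply to any left derived functor of
-- shuffling.
theorem nonempty_iso_derivedShuffling {L : Db O₀ ⥤ Db O₀}
    (h : IsLeftDerived (shuffling adj.unit) L) : Nonempty (derivedShuffling adj ≅ L) := by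
  obtain ⟨α, hα⟩ := h
  obtain ⟨β, hβ⟩ := isLeftDerived_shuffling adj adj'
  exact ⟨Functor.leftDerivedUnique _ _ β α (quasiIso O₀)⟩

theorem nonempty_iso_inverse [(derivedShuffling adj).IsEquivalence] {R : Db O₀ ⥤ Db O₀}
    (h : IsRightDerived (coshuffling adj'.counit) R) :
    Nonempty ((derivedShuffling adj).asEquivalence.inverse ≅ R) := by
  obtain ⟨α, hα⟩ := h
  obtain ⟨β, hβ⟩ := isRightDerived_coshuffling adj adj'
  exact ⟨Functor.rightDerivedUnique _ _ β α (quasiIso O₀)⟩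

theorem nonempty_derivedShuffling_obj (K : Cb O₀) (hK : ∀ i, Mono (adj.unit.app (K.obj.X i))) :
    Nonempty ((derivedShuffling adj).obj ((Q O₀).obj K) ≅
      (Q O₀).obj ((mapCb (shuffling adj.unit)).obj K)) :=
  have := isIso_derivedToCoker_app adj.unit (shufflingπ adj.unit) (shufflingπ_condition adj.unit)
    (shortExact_shufflingπ adj.unit) K hK
  ⟨asIso ((derivedToCoker adj.unit (shufflingπ adj.unit)
    (shufflingπ_condition adj.unit)).app K)⟩

end

end SL2

/-! ### The two indecomposable projectives and the morphisms between them. -/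

namespace SL2

noncomputable section

attribute [local instance 100] LieRing.ofAssociativeRing
attribute [local instance] ModuleCat.moduleOfAlgebraModule
attribute [local instance] ModuleCat.isScalarTower_of_algebra_moduleCat

/-! ### Raising and lowering in the principal block -/

/-- The action of `E` from the weight space of weight `-2` to that of weight zero. -/
def raise (M : O₀) : weightSpace M.obj (-2) →ₗ[ℂ] weightSpace M.obj 0 where
  toFun m := ⟨E • m.1, mem_weightSpace.2 (by
    rw [E_mem_weightSpace (mem_weightSpace.1 m.2)]
    norm_num)⟩
  map_add' m m' := Subtype.ext (smul_add E m.1 m'.1)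
  map_smul' z m := Subtype.ext (smul_comm E z m.1)

/-- The action of `F` from the weight space of weight zero to that of weight `-2`. -/
def lower (M : O₀) : weightSpace M.obj 0 →ₗ[ℂ] weightSpace M.obj (-2) where
  toFun m := ⟨F • m.1, mem_weightSpace.2 (by
    rw [F_mem_weightSpace (mem_weightSpace.1 m.2)]
    norm_num)⟩
  map_add' m m' := Subtype.ext (smul_add F m.1 m'.1)
  map_smul' z m := Subtype.ext (smul_comm F z m.1)

theorem weightMap_raise {M N : O₀} (f : M ⟶ N) (m : weightSpace M.obj (-2)) :
    weightMap f.hom.hom 0 (raise M m) = raise N (weightMap f.hom.hom (-2) m) :=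
  Subtype.ext (map_smul f.hom.hom E m.1)

theorem weightMap_lower {M N : O₀} (f : M ⟶ N) (m : weightSpace M.obj 0) :
    weightMap f.hom.hom (-2) (lower M m) = lower N (weightMap f.hom.hom 0 m) :=
  Subtype.ext (map_smul f.hom.hom F m.1)

theorem raise_lower (M : O₀) (m : weightSpace M.obj 0) : raise M (lower M m) = 0 := by
  have hm := mem_weightSpace.1 m.2
  refine Subtype.ext ?_
  change E • F • m.1 = 0
  rw [EF_smul, E_smul_eq_zero not_mem_dotOrbit_zero hm, hm, smul_zero, zero_smul, add_zero]

theorem fInjective_iff (M : O₀) : FInjective M ↔ Function.Injective (lower M) := by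
  rw [injective_iff_map_eq_zero]
  constructor
  · exact fun h m hm => Subtype.ext (h m.1 (mem_weightSpace.1 m.2) (congrArg Subtype.val hm))
  · exact fun h m hm hF => congrArg Subtype.val (h ⟨m, mem_weightSpace.2 hm⟩ (Subtype.ext hF))

theorem FInjective.of_mono {M N : O₀} (hN : FInjective N) (f : M ⟶ N) [Mono f] :
    FInjective M := by
  rw [fInjective_iff] at hN ⊢
  intro x y h
  refine weightMap_injective_of_mono f 0 (hN ?_)
  rw [← weightMap_lower, ← weightMap_lower, h]

theorem fInjective_of_dim_eq_zero {M : O₀} (h : dim 0 M = 0) : FInjective M :=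
  (fInjective_iff M).2 fun x y _ => (eq_zero_of_dim h x).trans (eq_zero_of_dim h y).symm

/-- `E` acts surjectively onto the weight space of weight zero. -/
def ESurjective (M : O₀) : Prop := Function.Surjective (raise M)

theorem ESurjective.of_epi {M N : O₀} (hM : ESurjective M) (f : M ⟶ N) [Epi f] :
    ESurjective N := fun y => by
  obtain ⟨x, rfl⟩ := weightMap_surjective_of_epi f 0 y
  obtain ⟨x', rfl⟩ := hM x
  exact ⟨_, (weightMap_raise f x').symm⟩

theorem coord_one_eq_zero (N : Block (-1)) (x : weightSpace (outOfWall.obj N).obj 0) :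
    coord 1 (translationIncl 0 N x) = 0 := by
  have h : H • translationIncl 0 N x = (0 : ℂ) • translationIncl 0 N x := by
    rw [← map_smul, mem_weightSpace.1 x.2, LinearMap.map_smul_of_tower]
  have h₁ := congrArg (coord 1) h
  rw [coord_one_H, map_smul, zero_smul, sub_eq_zero] at h₁
  exact congrArg Subtype.val (eq_zero_of_dim (dim_one N)
    ⟨coord 1 (translationIncl 0 N x), mem_weightSpace.2 (h₁.trans (one_smul ℂ _).symm)⟩)

/-- Vectors of weight 0 in `N ⊗ L(1)` have the form `n ⊗ e₀` with `n` of weight -1, since `N` has no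
weight 1. The second coordinate of `F(n ⊗ e₀)` is `n`. -/
theorem fInjective_outOfWall (N : Block (-1)) : FInjective (outOfWall.obj N) := by
  intro x hx hF
  refine translationIncl_injective 0 N (Eq.trans ?_ (map_zero _).symm)
  have h := coord_one_eq_zero N ⟨x, mem_weightSpace.2 hx⟩
  have h₁ : coord 1 (F • translationIncl 0 N x) = 0 := by
    rw [← map_smul, hF, map_zero, map_zero]
  rw [coord_one_F, h, smul_zero, zero_add] at h₁
  exact coord_ext (h₁.trans (map_zero _).symm) (h.trans (map_zero _).symm)

/-- With the same description of weight 0, `n ⊗ e₀ = E(n ⊗ e₁)`, because `E` kills the vectors of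
weight -1 in `N`. -/
theorem eSurjective_outOfWall (N : Block (-1)) : ESurjective (outOfWall.obj N) := by
  intro x
  have h₁ := coord_one_eq_zero N x
  let n : N.obj := coord 0 (translationIncl 0 N x)
  have hH : H • translationIncl 0 N x = (0 : ℂ) • translationIncl 0 N x := by
    rw [← map_smul, mem_weightSpace.1 x.2, LinearMap.map_smul_of_tower]
  have hn : H • n = (-1 : ℂ) • n := by
    have h₂ := congrArg (coord 0) hH
    rw [coord_zero_H, map_smul, zero_smul] at h₂
    rw [neg_one_smul]
    exact eq_neg_of_add_eq_zero_left h₂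
  obtain ⟨y, hy⟩ := (translationIncl_bijective N).2 (tens n (Pi.single 1 1))
  refine ⟨⟨y, mem_weightSpace.2 (translationIncl_injective 0 N ?_)⟩,
    Subtype.ext (translationIncl_injective 0 N ?_)⟩
  · rw [map_smul, LinearMap.map_smul_of_tower, hy]
    refine coord_ext ?_ ?_
    · rw [coord_zero_H, map_smul]
      simp [coord_tens]
    · rw [coord_one_H, map_smul]
      simp only [coord_tens, Pi.single_eq_same, one_smul, hn]
      module
  · change translationIncl 0 N (E • y) = _
    rw [map_smul, hy]
    refine coord_ext ?_ ?_
    · rw [coord_zero_E]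
      simp [coord_tens, n]
    · rw [coord_one_E, h₁]
      simp [coord_tens, E_smul_eq_zero not_mem_dotOrbit_wall hn]

theorem wallVector_natural {M N : O₀} (f : M ⟶ N) (m : weightSpace M.obj (-2)) :
    wallVector N (weightMap f.hom.hom (-2) m) = tensorMap f.hom.hom (wallVector M m) := by
  refine coord_ext ?_ ?_
  · rw [coord_tensorMap]
    simp [wallVector_apply, coord_tens, coe_weightMap]
  · rw [coord_tensorMap]
    simp [wallVector_apply, coord_tens, coe_weightMap]

/-- Maps T'X → M are maps X → TM, hence vectors of weight -1 in TM, hence vectors of weight -2 in M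
by `wallVector`. -/
theorem representsWeight_outOfWall : RepresentsWeight (outOfWall.obj wallObj) (-2) := by
  obtain ⟨x, hx⟩ := representsWeight_wallObj
  let adj' := translationAdjunction (-1) 0
  let y := weightMap (adj'.unit.app wallObj).hom.hom (-1) x
  obtain ⟨p, hp⟩ := exists_wallVector_eq_translationIncl _ y
  have key (M : O₀) (f : outOfWall.obj wallObj ⟶ M) :
      wallVector M (weightMap f.hom.hom (-2) p) =
        translationIncl (-1) M (weightMap (adj'.homEquiv _ _ f).hom.hom (-1) x) := by
    rw [wallVector_natural, hp, Adjunction.homEquiv_unit]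
    exact (translationIncl_map f y.1).symm
  refine ⟨p, fun M => ⟨fun f g h => ?_, fun m => ?_⟩⟩
  · have h' := congrArg (wallVector M) h
    refine (adj'.homEquiv _ _).injective ((hx _).1 (Subtype.ext
      (translationIncl_injective (-1) M ?_)))
    exact (key M f).symm.trans (h'.trans (key M g))
  · obtain ⟨z, hz⟩ := exists_translationIncl_eq_wallVector M m
    obtain ⟨g, hg⟩ := (hx _).2 z
    refine ⟨(adj'.homEquiv _ _).symm g, wallVector_injective M ?_⟩
    refine (key M _).trans ?_
    rw [Equiv.apply_symm_apply]
    exact (congrArg (fun t => translationIncl (-1) M t.1) hg).trans hz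

/-! ### The indecomposable projectives -/

/-- The objects isomorphic to the dominant Verma module. -/
structure IsDominant (P : O₀) : Prop where
  represents : RepresentsWeight P 0
  dim_zero : dim 0 P = 1
  dim_neg_two : dim (-2) P = 1
  fInjective : FInjective P

/-- The objects isomorphic to the antidominant projective module. -/
structure IsAntidominant (P : O₀) : Prop where
  dim_zero : dim 0 P = 1
  dim_neg_two : dim (-2) P = 2
  fInjective : FInjective P
  eSurjective : ESurjective P

theorem IsDominant.of_iso {P P' : O₀} (h : IsDominant P) (e : P ≅ P') : IsDominant P' where
  represents := h.represents.of_iso e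
  dim_zero := (dim_eq_of_iso e 0).symm.trans h.dim_zero
  dim_neg_two := (dim_eq_of_iso e (-2)).symm.trans h.dim_neg_two
  fInjective := h.fInjective.of_mono e.inv

theorem IsAntidominant.of_iso {P P' : O₀} (h : IsAntidominant P) (e : P ≅ P') :
    IsAntidominant P' where
  dim_zero := (dim_eq_of_iso e 0).symm.trans h.dim_zero
  dim_neg_two := (dim_eq_of_iso e (-2)).symm.trans h.dim_neg_two
  fInjective := h.fInjective.of_mono e.inv
  eSurjective := h.eSurjective.of_epi e.hom

/-- The dominant Verma module. -/
def dominantObj : O₀ := vermaObj zero_mem_dotOrbit ℂ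

/-- The antidominant projective module. -/
def antidominantObj : O₀ := outOfWall.obj wallObj

theorem representsWeight_antidominantObj : RepresentsWeight antidominantObj (-2) :=
  representsWeight_outOfWall

theorem isDominant_dominantObj : IsDominant dominantObj where
  represents := representsWeight_vermaObj _ not_mem_dotOrbit_zero
  dim_zero := by
    have h := dim_vermaObj zero_mem_dotOrbit ℂ 0
    rw [Nat.cast_zero, mul_zero, sub_zero, Module.finrank_self] at h
    exact h
  dim_neg_two := by
    have h := dim_vermaObj zero_mem_dotOrbit ℂ 1
    rw [Nat.cast_one, mul_one, zero_sub, Module.finrank_self] at h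
    exact h
  fInjective := fInjective_vermaObj ℂ

theorem isAntidominant_antidominantObj : IsAntidominant antidominantObj where
  dim_zero := (dim_zero_outOfWall wallObj).trans dim_wallObj
  dim_neg_two := (dim_neg_two_outOfWall wallObj).trans (by rw [dim_wallObj])
  fInjective := fInjective_outOfWall wallObj
  eSurjective := eSurjective_outOfWall wallObj

/-- In an antidominant object, the kernel of `E` in weight `-2` is the image of `F`. -/
theorem IsAntidominant.exists_lower {P : O₀} (h : IsAntidominant P) {y : weightSpace P.obj (-2)}
    (hy : raise P y = 0) : ∃ x, lower P x = y := by
  have h₁ := LinearMap.finrank_range_add_finrank_ker (raise P)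
  rw [LinearMap.range_eq_top.2 h.eSurjective, finrank_top] at h₁
  have h₂ : LinearMap.range (lower P) ≤ LinearMap.ker (raise P) := by
    rintro _ ⟨x, rfl⟩
    exact raise_lower P x
  have h₃ := LinearMap.finrank_range_of_inj ((fInjective_iff P).1 h.fInjective)
  have h₄ : Module.finrank ℂ (weightSpace P.obj 0) = 1 := h.dim_zero
  have h₅ : Module.finrank ℂ (weightSpace P.obj (-2)) = 2 := h.dim_neg_two
  have h₆ := Submodule.eq_of_le_of_finrank_eq h₂ (by omega)
  exact LinearMap.mem_range.1 (h₆.symm ▸ LinearMap.mem_ker.2 hy)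

/-- A morphism which is nonzero on a one-dimensional weight space is injective on it. -/
theorem weightMap_injective_of_dim {lam c : ℂ} {M N : Block lam} (hM : dim c M = 1) (f : M ⟶ N)
    {x : weightSpace M.obj c} (hx : weightMap f.hom.hom c x ≠ 0) :
    Function.Injective (weightMap f.hom.hom c) := by
  refine (injective_iff_map_eq_zero _).2 fun y hy => ?_
  have hx' : x ≠ 0 := fun h => hx (by rw [h, map_zero])
  obtain ⟨z, rfl⟩ := (finrank_eq_one_iff_of_nonzero' x hx').1 hM y
  rw [map_smul, smul_eq_zero] at hy
  rw [hy.resolve_right hx, zero_smul]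

theorem mono_of_dotOrbit_zero {M N : O₀} (f : M ⟶ N)
    (h₀ : Function.Injective (weightMap f.hom.hom 0))
    (h₂ : Function.Injective (weightMap f.hom.hom (-2))) : Mono f :=
  mono_of_weight f fun c hc => by
    rcases dotOrbit_zero hc with rfl | rfl
    · exact h₀
    · exact h₂

theorem isIso_of_mono_of_dims {M N : O₀} (f : M ⟶ N) [Mono f] (h₀ : dim 0 M = dim 0 N)
    (h₂ : dim (-2) M = dim (-2) N) : IsIso f :=
  isIso_of_mono_of_dim f fun c hc => by
    rcases dotOrbit_zero hc with rfl | rfl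
    · exact h₀.ge
    · exact h₂.ge

/-- Send the universal vector to some `q` with `E • q ≠ 0`. The resulting map is injective on the
line of weight 0. A vector of weight -2 in its kernel is killed by `E`, so it lies in the image of
`F`, where injectivity of `F` on `P` makes it zero. The dimensions agree. -/
theorem IsAntidominant.nonempty_iso {P : O₀} (h : IsAntidominant P) :
    Nonempty (antidominantObj ≅ P) := by
  have h' := isAntidominant_antidominantObj
  have : Nontrivial (weightSpace P.obj 0) :=
    Module.nontrivial_of_finrank_pos (R := ℂ) (Nat.lt_of_lt_of_eq one_pos h.dim_zero.symm)
  obtain ⟨v, hv⟩ := exists_ne (0 : weightSpace P.obj 0)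
  obtain ⟨q, rfl⟩ := h.eSurjective v
  obtain ⟨p, hp⟩ := representsWeight_antidominantObj
  obtain ⟨f, hf⟩ := (hp P).2 q
  have h₀ : Function.Injective (weightMap f.hom.hom 0) :=
    weightMap_injective_of_dim h'.dim_zero f (x := raise antidominantObj p) (by
      rw [weightMap_raise]
      exact fun h => hv ((congrArg (raise P) hf).symm.trans h))
  have : Mono f := by
    refine mono_of_dotOrbit_zero f h₀ ((injective_iff_map_eq_zero _).2 fun y hy => ?_)
    have h₁ : raise antidominantObj y = 0 := h₀ (by
      rw [weightMap_raise, map_zero]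
      exact (congrArg (raise P) hy).trans (map_zero _))
    obtain ⟨x, rfl⟩ := h'.exists_lower h₁
    have h₂ := (fInjective_iff P).1 h.fInjective (a₁ := weightMap f.hom.hom 0 x) (a₂ := 0)
      ((weightMap_lower f x).symm.trans (hy.trans (map_zero _).symm))
    rw [h₀ (h₂.trans (map_zero _).symm), map_zero]
  have := isIso_of_mono_of_dims f (h'.dim_zero.trans h.dim_zero.symm)
    (h'.dim_neg_two.trans h.dim_neg_two.symm)
  exact ⟨asIso f⟩

theorem IsAntidominant.represents {P : O₀} (h : IsAntidominant P) : RepresentsWeight P (-2) := by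
  obtain ⟨e⟩ := h.nonempty_iso
  exact representsWeight_outOfWall.of_iso e

/-! ### Simple objects -/

theorem simple_of_dims {L : O₀} (h : dim 0 L + dim (-2) L = 1) : Simple L where
  mono_isIso_iff_nonzero {Y} f hf := by
    constructor
    · intro hi h0
      have hz : IsZero Y := by
        rw [IsZero.iff_id_eq_zero, ← cancel_mono f, h0, comp_zero, comp_zero]
      have hz' := hz.of_iso (asIso f).symm
      rw [dim_eq_zero_of_isZero hz', dim_eq_zero_of_isZero hz'] at h
      exact zero_ne_one h
    · intro h0
      have h₁ := dim_le_of_mono f 0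
      have h₂ := dim_le_of_mono f (-2)
      have h₃ : ¬(dim 0 Y = 0 ∧ dim (-2) Y = 0) := fun h =>
        h0 ((isZero_of_dims h.1 h.2).eq_of_src _ _)
      exact isIso_of_mono_of_dims f (by omega) (by omega)

/-- The antidominant Verma module, which is simple. -/
def antidominantVerma : O₀ := vermaObj neg_two_mem_dotOrbit ℂ

theorem dim_neg_two_antidominantVerma : dim (-2) antidominantVerma = 1 := by
  have h := dim_vermaObj neg_two_mem_dotOrbit ℂ 0
  rw [Nat.cast_zero, mul_zero, sub_zero, Module.finrank_self] at h
  exact h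

theorem dim_zero_antidominantVerma : dim 0 antidominantVerma = 0 := by
  have h := weightSpace_le (M := Verma (-2) ℂ) (fun p : ℕ × ℂ => Verma.basis (-2) p.1 p.2)
    (fun p => -2 - 2 * p.1) (fun p => Verma.H_basis p.1 p.2) Verma.span_basis 0
  have h₁ : {p : ℕ × ℂ | (-2 : ℂ) - 2 * p.1 = 0} = ∅ := by
    refine Set.eq_empty_of_forall_notMem fun p hp => ?_
    have h₂ : (-2 : ℂ) - 2 * p.1 = 0 := hp
    have h₃ : ((p.1 + 1 : ℕ) : ℂ) = 0 := by
      push_cast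
      linear_combination (-1 / 2 : ℂ) * h₂
    exact Nat.succ_ne_zero _ (Nat.cast_eq_zero.1 h₃)
  rw [h₁, Set.image_empty, Submodule.span_empty, le_bot_iff] at h
  have h₃ (x : weightSpace antidominantVerma.obj 0) : x = 0 := by
    obtain ⟨y, hy⟩ := (vermaId_bijective neg_two_mem_dotOrbit ℂ).2 x.1
    have hy' : H • y = (0 : ℂ) • y := (vermaId_bijective neg_two_mem_dotOrbit ℂ).1 (by
      rw [map_smul, hy, zero_smul, map_zero]
      exact (mem_weightSpace.1 x.2).trans (zero_smul ℂ _))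
    refine Subtype.ext (hy.symm.trans ?_)
    rw [(Submodule.eq_bot_iff _).1 h y (mem_weightSpace.2 hy'), map_zero]
    rfl
  exact Module.finrank_zero_iff.2 ⟨fun x y => (h₃ x).trans (h₃ y).symm⟩

/-- A highest weight vector of weight `-2` gives a map from the antidominant Verma module. -/
theorem exists_antidominantVerma_hom {M : O₀} (m : weightSpace M.obj (-2)) (hm : raise M m = 0) :
    ∃ (f : antidominantVerma ⟶ M) (x : weightSpace antidominantVerma.obj (-2)),
      weightMap f.hom.hom (-2) x = m := by
  let φ : ℂ →ₗ[ℂ] M.obj := LinearMap.toSpanSingleton ℂ _ m.1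
  have hE (w : ℂ) : E • φ w = 0 := by
    change E • w • m.1 = 0
    rw [smul_comm, show E • m.1 = 0 from congrArg Subtype.val hm, smul_zero]
  have hH (w : ℂ) : H • φ w = (-2 : ℂ) • φ w := by
    change H • w • m.1 = (-2 : ℂ) • w • m.1
    rw [smul_comm, mem_weightSpace.1 m.2, smul_comm]
  refine ⟨ofLinear (Verma.lift φ hE hH : Verma (-2) ℂ →ₗ[U] M.obj),
    vermaTop neg_two_mem_dotOrbit 1, Subtype.ext ?_⟩
  exact (Verma.lift_basis_zero φ hE hH 1).trans (one_smul ℂ _)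

theorem exists_nonzero_weight {lam c : ℂ} {M : Block lam} (h : dim c M ≠ 0) :
    ∃ v : weightSpace M.obj c, v ≠ 0 :=
  have : Nontrivial (weightSpace M.obj c) :=
    Module.nontrivial_of_finrank_pos (R := ℂ) (Nat.pos_of_ne_zero h)
  exists_ne _

/-- The finite-dimensional simple quotient of a dominant object. -/
theorem IsDominant.exists_quotient {P : O₀} (h : IsDominant P) :
    ∃ (L : O₀) (q : P ⟶ L), Epi q ∧ dim 0 L = 1 ∧ dim (-2) L = 0 := by
  obtain ⟨v, hv⟩ := exists_nonzero_weight (c := 0) (M := P) (by rw [h.dim_zero]; exact one_ne_zero)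
  -- `F • v` is itself a highest weight vector, of weight -2. Dividing by the submodule it generates
  -- removes the weight -2 and keeps the weight 0.
  obtain ⟨f, x, hx⟩ := exists_antidominantVerma_hom (lower P v) (raise_lower P v)
  have hne : lower P v ≠ 0 := fun h' =>
    hv ((fInjective_iff P).1 h.fInjective (h'.trans (map_zero _).symm))
  have : Mono f := mono_of_dotOrbit_zero f
    (fun x y _ => (eq_zero_of_dim dim_zero_antidominantVerma x).trans
      (eq_zero_of_dim dim_zero_antidominantVerma y).symm)
    (weightMap_injective_of_dim dim_neg_two_antidominantVerma f (x := x) (hx ▸ hne))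
  have hS : (ShortComplex.mk f (cokernel.π f) (cokernel.condition f)).ShortExact :=
    { exact := ShortComplex.exact_cokernel f }
  have h₀ : dim 0 P = dim 0 antidominantVerma + dim 0 (cokernel f) := dim_shortExact hS 0
  have h₂ : dim (-2) P = dim (-2) antidominantVerma + dim (-2) (cokernel f) := dim_shortExact hS _
  rw [h.dim_zero, dim_zero_antidominantVerma] at h₀
  rw [h.dim_neg_two, dim_neg_two_antidominantVerma] at h₂
  exact ⟨cokernel f, cokernel.π f, inferInstance, by omega, by omega⟩

/-! ### Morphisms between the projectives -/

section Morphisms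

variable {Pe Ps : O₀} (hPe : IsDominant Pe) (hPs : IsAntidominant Ps)

include hPe in
theorem IsDominant.injective_zero {M : O₀} {a : Pe ⟶ M} (ha : a ≠ 0) :
    Function.Injective (weightMap a.hom.hom 0) := by
  have h : ∃ p, weightMap a.hom.hom 0 p ≠ 0 := by
    by_contra! h
    exact ha (hPe.represents.eq_zero a h)
  obtain ⟨p, hp⟩ := h
  exact weightMap_injective_of_dim hPe.dim_zero a hp

-- A nonzero map is injective on the line of weight 0, and `F` carries this over to weight -2.
include hPe in
theorem IsDominant.mono {M : O₀} (hM : FInjective M) {a : Pe ⟶ M} (ha : a ≠ 0) : Mono a := by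
  have h₀ := hPe.injective_zero ha
  refine mono_of_dotOrbit_zero a h₀ ((injective_iff_map_eq_zero _).2 fun y hy => ?_)
  have h₁ : Function.Surjective (lower Pe) :=
    (LinearMap.injective_iff_surjective_of_finrank_eq_finrank
      (hPe.dim_zero.trans hPe.dim_neg_two.symm)).1 ((fInjective_iff Pe).1 hPe.fInjective)
  obtain ⟨x, rfl⟩ := h₁ y
  have h₂ := (fInjective_iff M).1 hM (a₁ := weightMap a.hom.hom 0 x) (a₂ := 0)
    ((weightMap_lower a x).symm.trans (hy.trans (map_zero _).symm))
  rw [h₀ (h₂.trans (map_zero _).symm), map_zero]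

-- `Ps` represents the weight space at -2, which the quotient `L` of `Pe` lacks, so `b` vanishes in
-- `L`. The projection of `Pe` to `L` is injective on weight 0.
include hPe hPs in
theorem weightMap_zero_eq_zero (b : Ps ⟶ Pe) (x : weightSpace Ps.obj 0) :
    weightMap b.hom.hom 0 x = 0 := by
  by_contra hx
  obtain ⟨L, q, _, h₀, h₂⟩ := hPe.exists_quotient
  have hb : b ≫ q = 0 := hPs.represents.eq_zero_of_dim h₂ _
  have hq : q ≠ 0 := fun h => by
    obtain ⟨v, hv⟩ := exists_nonzero_weight (c := 0) (M := L) (by rw [h₀]; exact one_ne_zero)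
    obtain ⟨w, rfl⟩ := weightMap_surjective_of_epi q 0 v
    exact hv (by rw [h]; rfl)
  refine hx (hPe.injective_zero hq ?_)
  rw [← weightMap_comp, hb, map_zero]
  rfl

include hPe hPs in
theorem comp_eq_zero (a : Pe ⟶ Ps) (b : Ps ⟶ Pe) : a ≫ b = 0 :=
  hPe.represents.eq_zero _ fun p => by
    rw [weightMap_comp]
    exact weightMap_zero_eq_zero hPe hPs b _

include hPe hPs in
/-- The endomorphisms of the antidominant projective. -/
theorem exists_eq_smul_add {a : Pe ⟶ Ps} {b : Ps ⟶ Pe} (ha : a ≠ 0) (hb : b ≠ 0)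
    (h : Ps ⟶ Ps) : ∃ z t : ℂ, h = z • 𝟙 Ps + t • (b ≫ a) := by
  have := hPe.mono hPs.fInjective ha
  have hab := comp_eq_zero hPe hPs a b
  have hx : b ≫ a ≠ 0 := fun h => hb ((cancel_mono a).1 (h.trans zero_comp.symm))
  -- The endomorphism `b ≫ a` is nonzero of square zero, so it is independent of the identity.
  -- Together they fill the endomorphism space, whose dimension is that of the weight space of `Ps`
  -- at -2.
  have hli : LinearIndependent ℂ ![𝟙 Ps, b ≫ a] := by
    refine LinearIndependent.pair_iff.2 fun z t hzt => ?_
    have h₁ : z • (b ≫ a) = 0 := by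
      have h₂ := congrArg (· ≫ b ≫ a) hzt
      simpa [reassoc_of% hab] using h₂
    have hz := (smul_eq_zero.1 h₁).resolve_right hx
    rw [hz, zero_smul, zero_add] at hzt
    exact ⟨hz, (smul_eq_zero.1 hzt).resolve_right hx⟩
  have hfin : Module.finrank ℂ (Ps ⟶ Ps) = 2 :=
    (hPs.represents.finrank_hom Ps).trans hPs.dim_neg_two
  have htop := hli.span_eq_top_of_card_eq_finrank (by rw [hfin, Fintype.card_fin])
  have hmem : h ∈ Submodule.span ℂ (Set.range ![𝟙 Ps, b ≫ a]) := htop ▸ Submodule.mem_top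
  rw [Matrix.range_cons, Matrix.range_cons, Matrix.range_empty, Set.union_empty,
    Set.singleton_union, Submodule.mem_span_pair] at hmem
  obtain ⟨z, t, rfl⟩ := hmem
  exact ⟨z, t, rfl⟩

theorem exists_hom_ne_zero {lam c : ℂ} {P M : Block lam} (h : RepresentsWeight P c)
    (hM : dim c M ≠ 0) : ∃ f : P ⟶ M, f ≠ 0 := by
  by_contra! h'
  exact hM (h.dim_eq_zero h')

include hPe hPs in
theorem exists_hom_dominant_antidominant : ∃ a : Pe ⟶ Ps, a ≠ 0 :=
  exists_hom_ne_zero hPe.represents (by rw [hPs.dim_zero]; exact one_ne_zero)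

include hPe hPs in
theorem exists_hom_antidominant_dominant : ∃ b : Ps ⟶ Pe, b ≠ 0 :=
  exists_hom_ne_zero hPs.represents (by rw [hPe.dim_neg_two]; exact one_ne_zero)

end Morphisms

end

end SL2

/-! ### Local endomorphism rings and uniqueness of projective covers. -/

namespace SL2

noncomputable section

attribute [local instance 100] LieRing.ofAssociativeRing
attribute [local instance] ModuleCat.moduleOfAlgebraModule
attribute [local instance] ModuleCat.isScalarTower_of_algebra_moduleCat

/-! ### Local endomorphism rings -/

section LocalEnd

variable {C : Type*} [Category* C] [Abelian C] [Linear ℂ C]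

/-- Every endomorphism is the sum of a scalar and an endomorphism of square zero. -/
def HasLocalEnd (P : C) : Prop :=
  ∀ e : P ⟶ P, ∃ (z : ℂ) (n : P ⟶ P), e = z • 𝟙 P + n ∧ n ≫ n = 0

/-- For `e = z + n`, idempotency reads `(z² - z) + (2z - 1)n = 0`. Multiplying by `n` gives `(z² -
z)n = 0`, and in either case `e` is 0 or 1. -/
theorem HasLocalEnd.eq_zero_or_eq_id {P : C} (h : HasLocalEnd P) {e : P ⟶ P} (he : e ≫ e = e) :
    e = 0 ∨ e = 𝟙 P := by
  obtain ⟨z, n, rfl, hn⟩ := h e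
  have h₁ : (z * z - z) • 𝟙 P + (2 * z - 1) • n = 0 := by
    simp only [Preadditive.add_comp, Preadditive.comp_add, Linear.smul_comp, Linear.comp_smul,
      Category.comp_id, Category.id_comp, hn] at he
    rw [← sub_eq_zero] at he
    rw [← he]
    module
  have h₂ : (z * z - z) • n = 0 := by
    have h₃ := congrArg (· ≫ n) h₁
    simpa [hn] using h₃
  rcases smul_eq_zero.1 h₂ with h₃ | h₃
  · rw [h₃, zero_smul, zero_add] at h₁
    have hz : z * (z - 1) = 0 := by linear_combination h₃
    rcases mul_eq_zero.1 hz with hz | hz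
    · refine Or.inl ?_
      rw [hz, mul_zero, zero_sub, smul_eq_zero] at h₁
      rw [hz, zero_smul, zero_add, h₁.resolve_left (by norm_num)]
    · refine Or.inr ?_
      rw [sub_eq_zero.1 hz, smul_eq_zero] at h₁
      rw [sub_eq_zero.1 hz, one_smul, h₁.resolve_left (by norm_num), add_zero]
  · rw [h₃, smul_zero, add_zero, smul_eq_zero] at h₁
    rcases h₁ with h₁ | h₁
    · have hz : z * (z - 1) = 0 := by linear_combination h₁
      rw [h₃]
      rcases mul_eq_zero.1 hz with hz | hz
      · exact Or.inl (by rw [hz, zero_smul, zero_add])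
      · exact Or.inr (by rw [sub_eq_zero.1 hz, one_smul, add_zero])
    · exact Or.inl (by rw [h₁, h₃, smul_zero, zero_add])

theorem HasLocalEnd.indecomposable {P : C} (h : HasLocalEnd P) (hP : ¬IsZero P) :
    Indecomposable P := by
  refine ⟨hP, fun Y Z e => ?_⟩
  rcases h.eq_zero_or_eq_id (e := e.hom ≫ biprod.fst ≫ biprod.inl ≫ e.inv) (by simp) with h₁ | h₁
  · refine Or.inl ((IsZero.iff_id_eq_zero Y).2 ?_)
    have h₂ := congrArg (fun t => biprod.inl ≫ e.inv ≫ t ≫ e.hom ≫ biprod.fst) h₁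
    simpa using h₂
  · refine Or.inr ((IsZero.iff_id_eq_zero Z).2 ?_)
    have h₂ := congrArg (fun t => biprod.inr ≫ e.inv ≫ t ≫ e.hom ≫ biprod.snd) h₁
    simpa using h₂.symm

/-- For `e = z + n`, the hypothesis says that `n` acts on `r` as `1 - z`. As `n` has square zero and
`r ≠ 0`, this forces `z = 1`, and `1 + n` has inverse `1 - n`. -/
theorem HasLocalEnd.isIso {P L : C} (h : HasLocalEnd P) {r : P ⟶ L} (hr : r ≠ 0) {e : P ⟶ P}
    (he : e ≫ r = r) : IsIso e := by
  obtain ⟨z, n, rfl, hn⟩ := h e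
  simp only [Preadditive.add_comp, Linear.smul_comp, Category.id_comp] at he
  have h₁ : n ≫ r = (1 - z) • r := by
    rw [eq_sub_of_add_eq' he, sub_smul, one_smul]
  have h₂ : (1 - z) • (1 - z) • r = 0 := by
    rw [← h₁, ← Linear.comp_smul, ← h₁, ← Category.assoc, hn, zero_comp]
  have hz : z = 1 := by
    rcases smul_eq_zero.1 h₂ with h₃ | h₃
    · exact (sub_eq_zero.1 h₃).symm
    · exact (sub_eq_zero.1 ((smul_eq_zero.1 h₃).resolve_right hr)).symm
  exact ⟨𝟙 P - n, by simp [hz, hn], by simp [hz, hn]⟩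

/-- An indecomposable projective object covering the same simple object as a projective object with
local endomorphism ring is isomorphic to it. -/
theorem HasLocalEnd.nonempty_iso {R P L : C} (h : HasLocalEnd R) [Projective R] [Projective P]
    (hP : Indecomposable P) (r : R ⟶ L) (p : P ⟶ L) [Epi r] [Epi p] (hr : r ≠ 0) :
    Nonempty (R ≅ P) := by
  let f : P ⟶ R := Projective.factorThru p r
  let g : R ⟶ P := Projective.factorThru r p
  have hf : f ≫ r = p := Projective.factorThru_comp p r
  have hg : g ≫ p = r := Projective.factorThru_comp r p
  have : IsIso (g ≫ f) := h.isIso hr (by rw [Category.assoc, hf, hg])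
  have : IsSplitMono g := IsSplitMono.mk' ⟨f ≫ inv (g ≫ f), by
    rw [← Category.assoc, IsIso.hom_inv_id]⟩
  let c := CokernelCofork.ofπ (cokernel.π g) (cokernel.condition g)
  let hc : IsColimit c := cokernelIsCokernel g
  let e := biprod.uniqueUpToIso _ _ (isBilimitBinaryBiconeOfIsSplitMonoOfCokernel hc)
  rcases hP.2 _ _ e with h₁ | h₁
  · exact absurd (h₁.eq_of_src r 0) hr
  · have : Epi g := Preadditive.epi_of_isZero_cokernel g h₁
    have := isIso_of_mono_of_epi g
    exact ⟨asIso g⟩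

end LocalEnd

theorem IsDominant.hasLocalEnd {P : O₀} (h : IsDominant P) : HasLocalEnd P := by
  intro e
  have hne : 𝟙 P ≠ 0 := fun h' => by
    have h₁ := dim_eq_zero_of_isZero ((IsZero.iff_id_eq_zero P).2 h') 0
    rw [h.dim_zero] at h₁
    exact one_ne_zero h₁
  obtain ⟨z, rfl⟩ := (finrank_eq_one_iff_of_nonzero' (𝟙 P) hne).1
    ((h.represents.finrank_hom P).trans h.dim_zero) e
  exact ⟨z, 0, (add_zero _).symm, zero_comp⟩

theorem IsAntidominant.hasLocalEnd {P : O₀} (h : IsAntidominant P) : HasLocalEnd P := by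
  intro e
  have h' := isDominant_dominantObj
  obtain ⟨a, ha⟩ := exists_hom_dominant_antidominant h' h
  obtain ⟨b, hb⟩ := exists_hom_antidominant_dominant h' h
  obtain ⟨z, t, rfl⟩ := exists_eq_smul_add h' h ha hb e
  have hab := comp_eq_zero h' h a b
  exact ⟨z, _, rfl, by simp [reassoc_of% hab]⟩

theorem not_isZero_of_dim_ne_zero {lam c : ℂ} {M : Block lam} (h : dim c M ≠ 0) : ¬IsZero M :=
  fun hz => h (dim_eq_zero_of_isZero hz c)

theorem IsDominant.isIndecomposableProjective {P : O₀} (h : IsDominant P) :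
    IsIndecomposableProjective P 0 := by
  refine ⟨h.represents.projective, h.hasLocalEnd.indecomposable (not_isZero_of_dim_ne_zero (c := 0)
    (by rw [h.dim_zero]; exact one_ne_zero)), ?_⟩
  obtain ⟨L, q, hq, h₀, h₂⟩ := h.exists_quotient
  obtain ⟨v, hv⟩ := exists_nonzero_weight (c := 0) (M := L) (by rw [h₀]; exact one_ne_zero)
  have hv' := mem_weightSpace.1 v.2
  exact ⟨L, q, hq, simple_of_dims (by rw [h₀, h₂]), v.1, fun h => hv (Subtype.ext h),
    E_smul_eq_zero not_mem_dotOrbit_zero hv', hv'⟩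

theorem IsAntidominant.isIndecomposableProjective {P : O₀} (h : IsAntidominant P) :
    IsIndecomposableProjective P (-2) := by
  refine ⟨h.represents.projective, h.hasLocalEnd.indecomposable (not_isZero_of_dim_ne_zero (c := 0)
    (by rw [h.dim_zero]; exact one_ne_zero)), ?_⟩
  have hL : dim (-2) antidominantVerma ≠ 0 := by
    rw [dim_neg_two_antidominantVerma]
    exact one_ne_zero
  have hs : Simple antidominantVerma :=
    simple_of_dims (by rw [dim_zero_antidominantVerma, dim_neg_two_antidominantVerma])
  obtain ⟨q, hq⟩ := exists_hom_ne_zero h.represents hL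
  obtain ⟨v, hv⟩ := exists_nonzero_weight hL
  exact ⟨_, q, epi_of_nonzero_to_simple hq, hs, v.1, fun h => hv (Subtype.ext h),
    congrArg Subtype.val (eq_zero_of_dim dim_zero_antidominantVerma (raise _ v)),
    mem_weightSpace.1 v.2⟩

/-- The highest weight vector of the simple quotient of `P` is the image of the universal vector of
`R`, so both objects cover the same simple object. -/
theorem IsIndecomposableProjective.nonempty_iso {lam c : ℂ} {R P : Block lam}
    (hR : RepresentsWeight R c) (hR' : HasLocalEnd R) (h : IsIndecomposableProjective P c) :
    Nonempty (R ≅ P) := by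
  obtain ⟨_, hP, L, p, _, _, v, hv, -, hH⟩ := h
  have := hR.projective
  obtain ⟨x, hx⟩ := hR
  obtain ⟨r, hr⟩ := (hx L).2 ⟨v, mem_weightSpace.2 hH⟩
  have hr' : r ≠ 0 := fun h₀ => hv (by
    rw [h₀] at hr
    exact (congrArg Subtype.val hr).symm)
  have := epi_of_nonzero_to_simple hr'
  exact hR'.nonempty_iso hP r p hr'

theorem IsIndecomposableProjective.isDominant {P : O₀} (h : IsIndecomposableProjective P 0) :
    IsDominant P := by
  have h' := isDominant_dominantObj
  obtain ⟨e⟩ := h.nonempty_iso h'.represents h'.hasLocalEnd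
  exact h'.of_iso e

theorem IsIndecomposableProjective.isAntidominant {P : O₀}
    (h : IsIndecomposableProjective P (-2)) : IsAntidominant P := by
  have h' := isAntidominant_antidominantObj
  obtain ⟨e⟩ := h.nonempty_iso h'.represents h'.hasLocalEnd
  exact h'.of_iso e

end

end SL2

/-! ### Shuffling the projectives and their string complexes. -/

namespace SL2

noncomputable section

attribute [local instance 100] LieRing.ofAssociativeRing
attribute [local instance] ModuleCat.moduleOfAlgebraModule
attribute [local instance] ModuleCat.isScalarTower_of_algebra_moduleCat

open BoundedDerived

theorem shortExact_of_dims {S : ShortComplex O₀} (hf : Mono S.f) (hg : Epi S.g)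
    (h₀ : dim 0 S.X₂ = dim 0 S.X₁ + dim 0 S.X₃)
    (h₂ : dim (-2) S.X₂ = dim (-2) S.X₁ + dim (-2) S.X₃) : S.ShortExact where
  exact := by
    rw [ShortComplex.exact_iff_epi_kernel_lift]
    have hS : (ShortComplex.mk (kernel.ι S.g) S.g (kernel.condition S.g)).ShortExact :=
      { exact := ShortComplex.exact_kernel S.g }
    have h₀' : dim 0 S.X₂ = dim 0 (kernel S.g) + dim 0 S.X₃ := dim_shortExact hS 0
    have h₂' : dim (-2) S.X₂ = dim (-2) (kernel S.g) + dim (-2) S.X₃ := dim_shortExact hS (-2)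
    have : Mono (kernel.lift S.g S.f S.zero ≫ kernel.ι S.g) := by
      rw [kernel.lift_ι]
      exact hf
    have : Mono (kernel.lift S.g S.f S.zero) := mono_of_mono _ (kernel.ι S.g)
    have := isIso_of_mono_of_dims (kernel.lift S.g S.f S.zero) (by omega) (by omega)
    infer_instance

variable (adj : ontoWall ⊣ outOfWall)

/-! ### Shuffling the projectives -/

theorem dim_zero_Θ (M : O₀) : dim 0 (Θ.obj M) = dim (-2) M :=
  (dim_zero_outOfWall (ontoWall.obj M)).trans (dim_ontoWall M)

theorem dim_neg_two_Θ (M : O₀) : dim (-2) (Θ.obj M) = 2 * dim (-2) M :=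
  (dim_neg_two_outOfWall (ontoWall.obj M)).trans (by rw [dim_ontoWall])

theorem dim_zero_shuffling {M : O₀} (hM : FInjective M) :
    dim (-2) M = dim 0 M + dim 0 ((shuffling adj.unit).obj M) :=
  (dim_zero_Θ M).symm.trans
    (dim_shortExact (shortExact_shufflingπ adj.unit M (mono_unit adj hM)) 0)

theorem dim_neg_two_shuffling {M : O₀} (hM : FInjective M) :
    2 * dim (-2) M = dim (-2) M + dim (-2) ((shuffling adj.unit).obj M) :=
  (dim_neg_two_Θ M).symm.trans
    (dim_shortExact (shortExact_shufflingπ adj.unit M (mono_unit adj hM)) (-2))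

theorem epi_shufflingπ (M : O₀) : Epi ((shufflingπ adj.unit).app M) :=
  inferInstanceAs (Epi (cokernel.π (adj.unit.app M)))

/-- The unit splits on objects T'N, so the shuffled object is both a subobject and a quotient of an
object translated out of the wall. It inherits injectivity of `F` from the one and surjectivity of
`E` onto weight 0 from the other. Its dimensions are 2 - 1 = 1 and 4 - 2 = 2. -/
theorem isAntidominant_shuffling_antidominantObj :
    IsAntidominant ((shuffling adj.unit).obj antidominantObj) := by
  have h := isAntidominant_antidominantObj
  have h₀ := dim_zero_shuffling adj h.fInjective
  have h₂ := dim_neg_two_shuffling adj h.fInjective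
  rw [h.dim_neg_two, h.dim_zero] at h₀
  rw [h.dim_neg_two] at h₂
  have hS := shortExact_shufflingπ adj.unit antidominantObj (mono_unit adj h.fInjective)
  have hepi := epi_shufflingπ adj antidominantObj
  let σ := ShortComplex.Splitting.ofExactOfRetraction _ hS.exact
    (outOfWall.map (adj.counit.app wallObj)) (adj.right_triangle_components wallObj) hepi
  have hσ : σ.s ≫ (shufflingπ adj.unit).app antidominantObj = 𝟙 _ := σ.s_g
  have : Mono (σ.s ≫ (shufflingπ adj.unit).app antidominantObj) := by
    rw [hσ]
    infer_instance
  have : Mono σ.s := mono_of_mono _ ((shufflingπ adj.unit).app antidominantObj)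
  exact
    { dim_zero := by omega
      dim_neg_two := by omega
      fInjective := (fInjective_outOfWall (ontoWall.obj antidominantObj)).of_mono σ.s
      eSurjective := (eSurjective_outOfWall (ontoWall.obj antidominantObj)).of_epi
        ((shufflingπ adj.unit).app antidominantObj) }

theorem IsAntidominant.shuffling {P : O₀} (h : IsAntidominant P) :
    IsAntidominant ((SL2.shuffling adj.unit).obj P) := by
  obtain ⟨e⟩ := h.nonempty_iso
  exact (isAntidominant_shuffling_antidominantObj adj).of_iso ((SL2.shuffling adj.unit).mapIso e)

theorem IsAntidominant.nonempty_iso_shuffling {P : O₀} (h : IsAntidominant P) :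
    Nonempty (P ≅ (SL2.shuffling adj.unit).obj P) := by
  obtain ⟨e⟩ := h.nonempty_iso
  obtain ⟨e'⟩ := (h.shuffling adj).nonempty_iso
  exact ⟨e.symm.trans e'⟩

theorem π_shuffling_map {M N : O₀} (f : M ⟶ N) :
    cokernel.π (adj.unit.app M) ≫ (shuffling adj.unit).map f
      = Θ.map f ≫ cokernel.π (adj.unit.app N) := cokernel.π_desc _ _ _

theorem epi_ontoWall_map {M N : O₀} (f : M ⟶ N) (h : dim (-2) (cokernel f) = 0) :
    Epi (ontoWall.map f) := by
  have hS : (ShortComplex.mk f (cokernel.π f) (cokernel.condition f)).Exact :=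
    ShortComplex.exact_cokernel f
  refine (hS.map ontoWall).epi_f ((isZero_of_dim_wall ?_).eq_of_tgt _ _)
  exact (dim_ontoWall (cokernel f)).trans h

theorem epi_shuffling_map {M N : O₀} (f : M ⟶ N) (h : dim (-2) (cokernel f) = 0) :
    Epi ((shuffling adj.unit).map f) := by
  have := epi_ontoWall_map f h
  have : Epi (Θ.map f) := inferInstanceAs (Epi (outOfWall.map (ontoWall.map f)))
  have h₁ := π_shuffling_map adj f
  have : Epi (cokernel.π (adj.unit.app M) ≫ (shuffling adj.unit).map f) := by
    rw [h₁]
    exact epi_comp (Θ.map f) (cokernel.π (adj.unit.app N))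
  exact epi_of_epi (cokernel.π (adj.unit.app M)) _

section

variable {Pe Ps : O₀} (hPe : IsDominant Pe) (hPs : IsAntidominant Ps) {a : Pe ⟶ Ps} {b : Ps ⟶ Pe}

include hPe hPs in
theorem epi_shuffling_map_antidominant (hb : b ≠ 0) : Epi ((shuffling adj.unit).map b) := by
  refine epi_shuffling_map adj b ?_
  obtain ⟨p, hp⟩ := hPs.represents
  have hbp : weightMap b.hom.hom (-2) p ≠ 0 := fun h => hb ((hp Pe).1 h)
  have h₁ (x : weightSpace (cokernel b).obj (-2)) : x = 0 := by
    obtain ⟨y, rfl⟩ := weightMap_surjective_of_epi (cokernel.π b) (-2) x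
    obtain ⟨z, rfl⟩ := (finrank_eq_one_iff_of_nonzero' _ hbp).1 hPe.dim_neg_two y
    rw [map_smul, ← weightMap_comp, cokernel.condition]
    exact smul_zero z
  exact Module.finrank_zero_iff.2 ⟨fun x y => (h₁ x).trans (h₁ y).symm⟩

-- The cokernel of `a` has no weight 0, so `η` is a monomorphism on it and `mono_of_mono_unit`
-- applies.
include hPe hPs in
theorem mono_shuffling_map_dominant (ha : a ≠ 0) : Mono ((shuffling adj.unit).map a) := by
  have := hPe.mono hPs.fInjective ha
  have hS : (ShortComplex.mk a (cokernel.π a) (cokernel.condition a)).ShortExact :=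
    { exact := ShortComplex.exact_cokernel a }
  have h₀ : dim 0 Ps = dim 0 Pe + dim 0 (cokernel a) := dim_shortExact hS 0
  rw [hPe.dim_zero, hPs.dim_zero] at h₀
  have := mono_unit adj (fInjective_of_dim_eq_zero (M := cokernel a) (by omega))
  have : Mono (Θ.map a) := inferInstanceAs (Mono (outOfWall.map (ontoWall.map a)))
  exact mono_of_mono_unit adj.unit a (cokernel.π a) (cokernel.condition a) hS.exact _
    (π_shuffling_map adj a)

include hPe in
theorem dim_zero_shuffling_dominant : dim 0 ((shuffling adj.unit).obj Pe) = 0 := by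
  have h := dim_zero_shuffling adj hPe.fInjective
  rw [hPe.dim_neg_two, hPe.dim_zero] at h
  omega

include hPe in
theorem dim_neg_two_shuffling_dominant : dim (-2) ((shuffling adj.unit).obj Pe) = 1 := by
  have h := dim_neg_two_shuffling adj hPe.fInjective
  rw [hPe.dim_neg_two] at h
  omega

include hPe hPs in
theorem shuffling_map_comp_ne_zero (ha : a ≠ 0) (hb : b ≠ 0) :
    (shuffling adj.unit).map (b ≫ a) ≠ 0 := by
  have := epi_shuffling_map_antidominant adj hPe hPs hb
  have := mono_shuffling_map_dominant adj hPe hPs ha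
  intro h
  rw [Functor.map_comp] at h
  have h₁ : (shuffling adj.unit).map b = 0 := (cancel_mono _).1 (h.trans zero_comp.symm)
  have h₂ : 𝟙 ((shuffling adj.unit).obj Pe) = 0 := by
    rw [← cancel_epi ((shuffling adj.unit).map b), h₁, zero_comp, zero_comp]
  have h₃ := dim_eq_zero_of_isZero ((IsZero.iff_id_eq_zero _).2 h₂) (-2)
  rw [dim_neg_two_shuffling_dominant adj hPe] at h₃
  exact one_ne_zero h₃

-- Transported to `Ps`, the image of `b ≫ a` is `z + t • (b ≫ a)`. It has square zero, so `z = 0`,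
-- and it is nonzero, so `t ≠ 0`.
include hPe hPs in
theorem exists_iso_shuffling (ha : a ≠ 0) (hb : b ≠ 0) :
    ∃ (φ : Ps ≅ (shuffling adj.unit).obj Ps) (t : ℂ), t ≠ 0 ∧
      φ.hom ≫ (shuffling adj.unit).map (b ≫ a) = t • (b ≫ a) ≫ φ.hom := by
  obtain ⟨φ⟩ := hPs.nonempty_iso_shuffling adj
  have hab := comp_eq_zero hPe hPs a b
  have h₀ := shuffling_map_comp_ne_zero adj hPe hPs ha hb
  obtain ⟨z, t, h⟩ := exists_eq_smul_add hPe hPs ha hb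
    (φ.hom ≫ (shuffling adj.unit).map (b ≫ a) ≫ φ.inv)
  have hne : 𝟙 Ps ≠ 0 := fun h' => by
    have h₁ := dim_eq_zero_of_isZero ((IsZero.iff_id_eq_zero Ps).2 h') 0
    rw [hPs.dim_zero] at h₁
    exact one_ne_zero h₁
  have hsq : (b ≫ a) ≫ b ≫ a = 0 := by rw [Category.assoc, reassoc_of% hab, zero_comp, comp_zero]
  have h₁ : (z • 𝟙 Ps + t • (b ≫ a)) ≫ (z • 𝟙 Ps + t • (b ≫ a)) = 0 := by
    rw [← h]
    simp only [Category.assoc, Iso.inv_hom_id_assoc]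
    rw [← Functor.map_comp_assoc, hsq, Functor.map_zero, zero_comp, comp_zero]
  have hz : z = 0 := by
    have h₂ := congrArg (· ≫ b ≫ a) h₁
    have hx : b ≫ a ≠ 0 := fun h => h₀ (by rw [h, Functor.map_zero])
    simp only [Preadditive.add_comp, Preadditive.comp_add, Linear.smul_comp, Linear.comp_smul,
      Category.comp_id, Category.id_comp, hsq, smul_zero, add_zero, zero_comp] at h₂
    rcases smul_eq_zero.1 h₂ with h₃ | h₃
    · exact h₃
    · exact (smul_eq_zero.1 h₃).resolve_right hx
  rw [hz, zero_smul, zero_add] at h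
  have h₂ : φ.hom ≫ (shuffling adj.unit).map (b ≫ a) = t • (b ≫ a) ≫ φ.hom := by
    rw [← Linear.smul_comp, ← h]
    simp
  refine ⟨φ, t, fun ht => h₀ ?_, h₂⟩
  rw [← cancel_epi φ.hom, h₂, ht, zero_smul, comp_zero]

-- The scalar `t` is absorbed by using `t ^ i • φ` in degree `i`; this is why the comparison of
-- string complexes allows isomorphisms that depend on the degree.
include hPe hPs in
theorem exists_family_iso_shuffling (ha : a ≠ 0) (hb : b ≠ 0) :
    ∃ φ : ℤ → (Ps ≅ (shuffling adj.unit).obj Ps), ∀ i,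
      (φ i).hom ≫ (shuffling adj.unit).map (b ≫ a) = (b ≫ a) ≫ (φ (i + 1)).hom := by
  obtain ⟨φ, t, ht, h⟩ := exists_iso_shuffling adj hPe hPs ha hb
  refine ⟨fun i =>
    { hom := t ^ i • φ.hom
      inv := t ^ (-i) • φ.inv
      hom_inv_id := by
        rw [Linear.smul_comp, Linear.comp_smul, φ.hom_inv_id, smul_smul, ← zpow_add₀ ht,
          add_neg_cancel, zpow_zero, one_smul]
      inv_hom_id := by
        rw [Linear.smul_comp, Linear.comp_smul, φ.inv_hom_id, smul_smul, ← zpow_add₀ ht,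
          neg_add_cancel, zpow_zero, one_smul] }, fun i => ?_⟩
  change (t ^ i • φ.hom) ≫ _ = (b ≫ a) ≫ (t ^ (i + 1) • φ.hom)
  rw [Linear.smul_comp, h, Linear.comp_smul, smul_smul, zpow_add_one₀ ht]

include hPe in
theorem comp_shuffling_map_eq_zero (f : Pe ⟶ (shuffling adj.unit).obj Pe) : f = 0 :=
  hPe.represents.eq_zero_of_dim (dim_zero_shuffling_dominant adj hPe) f

-- The composite vanishes because the shuffled `Pe` has no weight 0. The dimensions add up as 1 = 1
-- + 0 and 2 = 1 + 1, which forces exactness in the middle.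
include hPe hPs in
theorem shortExact_shuffling_map (ha : a ≠ 0) (hb : b ≠ 0)
    (φ : Ps ≅ (shuffling adj.unit).obj Ps) :
    (ShortComplex.mk a (φ.hom ≫ (shuffling adj.unit).map b)
      (comp_shuffling_map_eq_zero adj hPe _)).ShortExact := by
  have := epi_shuffling_map_antidominant adj hPe hPs hb
  refine shortExact_of_dims (hPe.mono hPs.fInjective ha)
    (epi_comp φ.hom ((shuffling adj.unit).map b)) ?_ ?_
  · change dim 0 Ps = dim 0 Pe + dim 0 ((shuffling adj.unit).obj Pe)
    rw [hPs.dim_zero, hPe.dim_zero, dim_zero_shuffling_dominant adj hPe]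
  · change dim (-2) Ps = dim (-2) Pe + dim (-2) ((shuffling adj.unit).obj Pe)
    rw [hPs.dim_neg_two, hPe.dim_neg_two, dim_neg_two_shuffling_dominant adj hPe]

-- The unit is a monomorphism on every term, so derived shuffling is computed term by term, and
-- `stringMap` compares the result with the next string complex.
include hPe hPs in
theorem nonempty_derivedShuffling_stringObject (ha : a ≠ 0) (hb : b ≠ 0) (w : a ≫ b = 0) (n : ℤ) :
    Nonempty ((derivedShuffling adj).obj (stringObject a b w n) ≅ stringObject a b w (n + 1)) := by
  obtain ⟨φ, hφ⟩ := exists_family_iso_shuffling adj hPe hPs ha hb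
  have hq := quasiIso_stringMap a b (shuffling adj.unit) φ hφ
    (fun i => comp_shuffling_map_eq_zero adj hPe _) w
    (fun i => shortExact_shuffling_map adj hPe hPs ha hb (φ i)) n
  let K : Cb O₀ := ⟨_, bounded_stringComplex a b w n⟩
  have hK (i : ℤ) : Mono (adj.unit.app (K.obj.X i)) := by
    change Mono (adj.unit.app (spotObj Pe Ps (spot n i)))
    cases spot n i with
    | zero => exact ⟨fun _ _ _ => (isZero_spotObj_zero (Pe := Pe) (Ps := Ps)).eq_of_tgt _ _⟩
    | e => exact mono_unit adj hPe.fInjective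
    | s => exact mono_unit adj hPs.fInjective
  obtain ⟨e⟩ := nonempty_derivedShuffling_obj adj K hK
  let L : Cb O₀ := ⟨_, bounded_stringComplex a b w (n + 1)⟩
  have : IsIso ((Q O₀).map (ObjectProperty.homMk (stringMap a b (shuffling adj.unit) φ hφ
      (fun i => comp_shuffling_map_eq_zero adj hPe _) w n) :
        L ⟶ (mapCb (shuffling adj.unit)).obj K)) :=
    Localization.inverts (Q O₀) (quasiIso O₀) _ hq
  exact ⟨e.trans (asIso ((Q O₀).map (ObjectProperty.homMk (stringMap a b (shuffling adj.unit) φ hφ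
      (fun i => comp_shuffling_map_eq_zero adj hPe _) w n) :
        L ⟶ (mapCb (shuffling adj.unit)).obj K))).symm⟩

end

theorem nonempty_derivedShuffling_single {P : O₀} (hP : IsAntidominant P) :
    Nonempty ((derivedShuffling adj).obj (single P) ≅ single P) := by
  let K : Cb O₀ := ⟨_, bounded_single P⟩
  have hK (i : ℤ) : Mono (adj.unit.app (K.obj.X i)) := by
    by_cases hi : i = 0
    · subst hi
      exact mono_unit adj (hP.of_iso (HomologicalComplex.singleObjXSelf (ComplexShape.up ℤ) 0
        P).symm).fInjective
    · exact ⟨fun _ _ _ =>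
        (HomologicalComplex.isZero_single_obj_X (ComplexShape.up ℤ) 0 P i hi).eq_of_tgt _ _⟩
  obtain ⟨e⟩ := nonempty_derivedShuffling_obj adj K hK
  obtain ⟨φ⟩ := hP.nonempty_iso_shuffling adj
  let e₁ : ((shuffling adj.unit).mapHomologicalComplex (ComplexShape.up ℤ)).obj
      ((HomologicalComplex.single O₀ (ComplexShape.up ℤ) 0).obj P) ≅
        (HomologicalComplex.single O₀ (ComplexShape.up ℤ) 0).obj P :=
    ((HomologicalComplex.singleMapHomologicalComplex (shuffling adj.unit) (ComplexShape.up ℤ)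
      0).app P).trans ((HomologicalComplex.single O₀ (ComplexShape.up ℤ) 0).mapIso φ.symm)
  let e₂ : (mapCb (shuffling adj.unit)).obj K ≅ K := ObjectProperty.isoMk _ e₁
  exact ⟨e.trans ((Q O₀).mapIso e₂)⟩

end

end SL2

/-! ### Powers of an autoequivalence and the action of the braid group. -/

namespace Autoeq

variable {D : Type*} [Category* D]

/-- Every functor in the class `x` sends `A` to `B`, up to isomorphism. -/
def Sends (x : Autoeq D) (A B : D) : Prop :=
  ∀ G : D ⥤ D, Represents G x → Nonempty (G.obj A ≅ B)

theorem sends_mk {e : D ≌ D} {A B : D} (h : Nonempty (e.functor.obj A ≅ B)) :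
    Sends (mk e) A B := by
  rintro G ⟨e', he, ⟨i⟩⟩
  obtain ⟨j⟩ : Nonempty (e'.functor ≅ e.functor) := Quotient.exact he
  obtain ⟨k⟩ := h
  exact ⟨i.symm.app A ≪≫ j.app A ≪≫ k⟩

theorem Sends.nonempty_iso {e : D ≌ D} {A B : D} (h : Sends (mk e) A B) :
    Nonempty (e.functor.obj A ≅ B) :=
  h e.functor ⟨e, rfl, ⟨Iso.refl _⟩⟩

theorem sends_one {A B : D} (h : Nonempty (A ≅ B)) : Sends (1 : Autoeq D) A B :=
  sends_mk (e := CategoryTheory.Equivalence.refl) h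

theorem Sends.mul {x y : Autoeq D} {A B C : D} (hx : Sends x B C) (hy : Sends y A B) :
    Sends (x * y) A C := by
  obtain ⟨e, rfl⟩ := Quotient.exists_rep x
  obtain ⟨e', rfl⟩ := Quotient.exists_rep y
  obtain ⟨i⟩ := Sends.nonempty_iso hx
  obtain ⟨j⟩ := Sends.nonempty_iso hy
  exact sends_mk (e := e'.trans e) ⟨e.functor.mapIso j ≪≫ i⟩

theorem Sends.inv {x : Autoeq D} {A B : D} (hx : Sends x A B) : Sends x⁻¹ B A := by
  obtain ⟨e, rfl⟩ := Quotient.exists_rep x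
  obtain ⟨i⟩ := Sends.nonempty_iso hx
  exact sends_mk (e := e.symm) ⟨e.inverse.mapIso i.symm ≪≫ e.unitIso.symm.app A⟩

theorem Sends.of_iso {x : Autoeq D} {A A' B : D} (hx : Sends x A B) (h : Nonempty (A' ≅ A)) :
    Sends x A' B := by
  rw [← mul_one x]
  exact hx.mul (sends_one h)

theorem sends_zpow {x : Autoeq D} {A : ℤ → D} (h : ∀ n, Sends x (A n) (A (n + 1))) (n : ℤ) :
    Sends (x ^ n) (A 0) (A n) := by
  induction n with
  | zero =>
    rw [zpow_zero]
    exact sends_one ⟨Iso.refl _⟩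
  | succ n ih =>
    rw [add_comm, zpow_one_add, add_comm]
    exact (h n).mul ih
  | pred n ih =>
    rw [sub_eq_neg_add, zpow_add, zpow_neg_one]
    -- The step from `-n - 1` to `-n`, inverted.
    have h' := (h (-n - 1)).inv
    rw [sub_add_cancel] at h'
    rw [neg_add_eq_sub]
    exact h'.mul ih

end Autoeq

/-- The homomorphism from the braid group of type `A₁` determined by an element of a group. -/
def braidLift {G : Type*} [Group G] (g : G) : BraidA₁ →* G :=
  PresentedGroup.toGroup (f := fun _ => g) (by
    rintro r ⟨i, j, rfl⟩
    -- There is only one Coxeter generator, so every braid relation is trivial.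
    rw [Subsingleton.elim i j, mul_inv_cancel, map_one])

theorem braidLift_braidGen {G : Type*} [Group G] (g : G) : braidLift g braidGen = g :=
  PresentedGroup.toGroup.of _

theorem bijective_braidGen_zpow : Function.Bijective (fun n : ℤ => braidGen ^ n) := by
  constructor
  · intro m n h
    -- The homomorphism to ℤ that sends the generator to 1 recovers the exponent.
    have h' := congrArg (fun x => (braidLift (Multiplicative.ofAdd (1 : ℤ)) x).toAdd) h
    simpa [braidLift_braidGen] using h'
  · intro x
    have hx : x ∈ Subgroup.closure (Set.range PresentedGroup.of) :=
      PresentedGroup.closure_range_of _ ▸ Subgroup.mem_top x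
    have hr : Set.range PresentedGroup.of = {braidGen} := by
      rw [Set.range_unique]
      rfl
    rw [hr, ← Subgroup.zpowers_eq_closure] at hx
    exact Subgroup.mem_zpowers_iff.1 hx

theorem mainTheorem11 :
    -- the two translation functors are biadjoint, and the objects and morphisms occurring exist
    Nonempty (SL2.ontoWall ⊣ SL2.outOfWall) ∧ Nonempty (SL2.outOfWall ⊣ SL2.ontoWall) ∧
    (∃ (Pe Ps : SL2.O₀) (a : Pe ⟶ Ps) (b : Ps ⟶ Pe), SL2.IsIndecomposableProjective Pe 0 ∧
      SL2.IsIndecomposableProjective Ps (-2) ∧ a ≠ 0 ∧ b ≠ 0) ∧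
    -- the braid group is infinite cyclic
    Function.Bijective (fun n : ℤ => braidGen ^ n) ∧
    ∀ (adj : SL2.ontoWall ⊣ SL2.outOfWall) (adj' : SL2.outOfWall ⊣ SL2.ontoWall),
      (∃ LSh, BoundedDerived.IsLeftDerived (SL2.shuffling adj.unit) LSh) ∧
      (∃ RCsh, BoundedDerived.IsRightDerived (SL2.coshuffling adj'.counit) RCsh) ∧
      ∀ LSh RCsh : BoundedDerived.Db SL2.O₀ ⥤ BoundedDerived.Db SL2.O₀,
        BoundedDerived.IsLeftDerived (SL2.shuffling adj.unit) LSh →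
        BoundedDerived.IsRightDerived (SL2.coshuffling adj'.counit) RCsh →
        ∃ ρ : BraidA₁ →* Autoeq (BoundedDerived.Db SL2.O₀),
          Autoeq.Represents LSh (ρ braidGen) ∧ Autoeq.Represents RCsh (ρ braidGen⁻¹) ∧
          ∀ (Pe Ps : SL2.O₀), SL2.IsIndecomposableProjective Pe 0 →
            SL2.IsIndecomposableProjective Ps (-2) →
            ∀ (a : Pe ⟶ Ps) (b : Ps ⟶ Pe), a ≠ 0 → b ≠ 0 →
              ∃ w : a ≫ b = 0,
                ∀ (n : ℤ) (G : BoundedDerived.Db SL2.O₀ ⥤ BoundedDerived.Db SL2.O₀),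
                  Autoeq.Represents G (ρ (braidGen ^ n)) →
                    Nonempty (G.obj (BoundedDerived.single Ps) ≅ BoundedDerived.single Ps) ∧
                    Nonempty (G.obj (BoundedDerived.single Pe) ≅
                      BoundedDerived.stringObject a b w n) := by
  refine ⟨⟨SL2.translationAdjunction 0 (-1)⟩, ⟨SL2.translationAdjunction (-1) 0⟩, ?_,
    bijective_braidGen_zpow, fun adj adj' => ?_⟩
  · have hPe := SL2.isDominant_dominantObj
    have hPs := SL2.isAntidominant_antidominantObj
    obtain ⟨a, ha⟩ := SL2.exists_hom_dominant_antidominant hPe hPs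
    obtain ⟨b, hb⟩ := SL2.exists_hom_antidominant_dominant hPe hPs
    exact ⟨_, _, a, b, hPe.isIndecomposableProjective, hPs.isIndecomposableProjective, ha, hb⟩
  have := SL2.isEquivalence_derivedShuffling adj adj'
  refine ⟨⟨_, SL2.isLeftDerived_shuffling adj adj'⟩, ⟨_, SL2.isRightDerived_coshuffling adj adj'⟩,
    fun LSh RCsh hL hR => ?_⟩
  -- The action is built from the cone model. The given derived functors represent the same classes
  -- by uniqueness, since the inverse equivalence is a right derived functor of coshuffling.
  let e : BoundedDerived.Db SL2.O₀ ≌ BoundedDerived.Db SL2.O₀ :=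
    (SL2.derivedShuffling adj).asEquivalence
  refine ⟨braidLift (Autoeq.mk e), ?_, ?_, fun Pe Ps hPe hPs a b ha hb => ?_⟩
  · rw [braidLift_braidGen]
    exact ⟨e, rfl, SL2.nonempty_iso_derivedShuffling adj adj' hL⟩
  · rw [map_inv, braidLift_braidGen]
    exact ⟨e.symm, rfl, SL2.nonempty_iso_inverse adj adj' hR⟩
  · have hPe' := hPe.isDominant
    have hPs' := hPs.isAntidominant
    refine ⟨SL2.comp_eq_zero hPe' hPs' a b, fun n G hG => ?_⟩
    rw [map_zpow, braidLift_braidGen] at hG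
    exact ⟨Autoeq.sends_zpow (A := fun _ => BoundedDerived.single Ps)
        (fun _ => Autoeq.sends_mk (SL2.nonempty_derivedShuffling_single adj hPs')) n G hG,
      -- The one-step statement holds for every integer, so powers of either sign are reached from
      -- the complex for `n = 0`, which is `Pe` in degree zero.
      (Autoeq.sends_zpow (A := BoundedDerived.stringObject a b _)
        (fun n => Autoeq.sends_mk (SL2.nonempty_derivedShuffling_stringObject adj hPe' hPs' ha hb
          _ n)) n).of_iso
        ((BoundedDerived.nonempty_stringObject_zero a b _).map Iso.symm) G hG⟩
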